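/- **Setting.** For each $n$ let $P_{n,\theta}$, $\theta\in\mathbb R^s$, be probability measures on a space carrying data $y=y^{(n)}$, let $l(\theta)=l_n(\theta,y)$ be a real criterion function and let $d_i=d_{n,i}>0$ ($1\le i\le s$) with $d_*=\min_i d_i\to\infty$ as $n\to\infty$; put $D=\mathrm{diag}(d_1,\dots,d_s)$. Let $\Theta\subseteq\mathbb R^s$ be the parameter space and $\sigma$ the true parameter, fixed in $n$. $E_\theta$ is the expectation under $P_{n,\theta}$ and $E=E_\sigma$. All derivatives are with respect to the parameter; in functions of $\theta$ such as $A(\theta)$ both the integrand and the expectation are taken at $\theta$. Put $$a=\frac{\partial l}{\partial\sigma},\quad F=\frac{\partial^2 l}{\partial\sigma^2},\quad H_i=\frac{\partial^3 l}{\partial\sigma_i\,\partial\sigma^2},\quad A=E(F),\quad Q=D^{-1}AD^{-1},$$ and let $C$ be the $s\times s$ matrix with $i$th row $a'A^{-1}H_i$. Let $(\lambda_i)=D^{-1}a$, $(\lambda_{jk})=D^{-1/2}(F-A)D^{-1/2}$, $(\lambda_{ijk})_{j,k}=D^{-1}H_iD^{-1}$, and $$U_1=(E\lambda_i\lambda_l),\qquad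 U_2=(E\lambda_{jk}\lambda_l),\qquad U_3=(E\lambda_{jkm}\lambda_l\lambda_n).$$ $|\cdot|$ is the Euclidean norm of a vector, $\|\cdot\|$ the spectral norm of a matrix and the maximum of the absolute values of the entries for arrays with three or more indices. For $\delta>0$ let $S_\delta(\sigma)=\{\tilde\sigma:|\tilde\sigma_i-\sigma_i|\le\delta d_*/d_i,\ 1\le i\le s\}$. "Bounded" means bounded in $n$. Let $\eta=\eta_n$ be real functions of the parameter, $b=\partial\eta/\partial\sigma$, $B=\partial^2\eta/\partial\sigma^2$, and $$\Delta_0=-2b'A^{-1}E(a),\quad \Delta_1=b'A^{-1}E(FA^{-1}a),\quad \Delta_2=\tfrac12E(a'A^{-1}BA^{-1}a),\quad \Delta_3=-\tfrac12 b'A^{-1}E(CA^{-1}a).$$ Fix constants $c_0,\lambda>0$ and a point $\sigma^*\in\Theta$ with $\eta(\sigma^*)=O(d_*^{\lambda})$. For an estimator $\hat\sigma=\hat\sigma(y)$ let $$\hat\eta=\eta(\hat\sigma)-\sum_{j=0}^{3}\Delta_j(\hat\sigma)$$ if the absolute value of the right-hand side is at most $c_0d_*^\lambda$, and $\hat\eta=\eta(\sigma^*)$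 otherwise. **Theorem 4.1.** Suppose that for some $\delta>0$ with $S_\delta(\sigma)\subset\Theta^\circ$ for all $n$: (i) $\eta$ is three times continuously differentiable on $\Theta^\circ$, and $\eta(\sigma)$, $|b(\sigma)|$, $\|B(\sigma)\|$ and $\sup_{\tilde\sigma\in S_\delta(\sigma)}|\partial^3\eta(\tilde\sigma)/\partial\sigma_i\partial\sigma_j\partial\sigma_k|$ are bounded for all $i,j,k$. (ii) $\sigma\in\Theta^\circ$; $l$ is four times continuously differentiable in the parameter on $\Theta^\circ$; $-\infty<\limsup_{n\to\infty}\lambda_{\max}(Q(\sigma))<0$, where $\lambda_{\max}$ is the largest eigenvalue; and for some $g>8+4\lambda$ the $g$th moments (at $\sigma$) of the following are bounded for all $i,j,k$: $$\frac1{d_i}\Big|\frac{\partial l(\sigma)}{\partial\sigma_i}\Big|,\quad \frac1{\sqrt{d_id_j}}\Big|\frac{\partial^2l(\sigma)}{\partial\sigma_i\partial\sigma_j}-E\Big[\frac{\partial^2l(\sigma)}{\partial\sigma_i\partial\sigma_j}\Big]\Big|,\quad \frac{d_*}{d_id_jd_k}\sup_{\tilde\sigma\in S_\delta(\sigma)}\Big|\frac{\partial^3l(\tilde\sigma)}{\partial\sigma_i\partial\sigma_j\partial\sigma_k}\Big|.$$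 (iii) The $g$th moments (at $\sigma$) of the following are bounded for all $i,j,k,m$: $$\frac1{\sqrt{d_jd_k}}\Big|\frac{\partial^3l(\sigma)}{\partial\sigma_i\partial\sigma_j\partial\sigma_k}-E\Big[\frac{\partial^3l(\sigma)}{\partial\sigma_i\partial\sigma_j\partial\sigma_k}\Big]\Big|,\quad \frac1{d_jd_k}\Big|\frac{\partial^3l(\sigma)}{\partial\sigma_i\partial\sigma_j\partial\sigma_k}\Big|,\quad \frac{d_*^2}{d_id_jd_kd_m}\sup_{\tilde\sigma\in S_\delta(\sigma)}\Big|\frac{\partial^4l(\tilde\sigma)}{\partial\sigma_i\partial\sigma_j\partial\sigma_k\partial\sigma_m}\Big|.$$ (iv) For $\tilde\sigma\in S_\delta(\sigma)$ the expectations defining $E(a)$, $A$, $U_1,U_2,U_3$ at $\tilde\sigma$ exist, and $\sup_{\tilde\sigma\in S_{\delta'}(\sigma)}\|Q(\tilde\sigma)-Q(\sigma)\|\to0$ and $\sup_{\tilde\sigma\in S_{\delta'}(\sigma)}\|U_j(\tilde\sigma)-U_j(\sigma)\|\to0$, $j=1,2,3$, as $\delta'\to0$, uniformly in $n$. (v)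 $|E(a)|$ is bounded at $\sigma$, and $\sup_{\tilde\sigma\in S_{\delta'}(\sigma)}|E(a)|_{\sigma=\tilde\sigma}-E(a)|\to0$ as $\delta'\to0$, uniformly in $n$. Then there is an estimator $\hat\sigma$ such that (R) for every $0<\rho<1$ there are a constant $c$ and events $\mathcal B=\mathcal B_n$ with $P_{n,\sigma}(\mathcal B^c)\le c\,d_*^{-\tau g}$, $\tau=\tfrac14\wedge(1-\rho)$, for large $n$, such that for large $n$, on $\mathcal B$, $\hat\sigma\in\Theta$, $\partial l(\hat\sigma)/\partial\sigma=0$ and $|D(\hat\sigma-\sigma)|<d_*^{1-\rho}$; and for every estimator $\hat\sigma$ with property (R), $E(\hat\eta)$ exists and $$E(\hat\eta)=\eta(\sigma)+o(d_*^{-2}).$$ Consequently, if $t(\hat\sigma)=t(\hat\sigma,y)$ is an empirical predictor of a random quantity $\mu$ whose mean squared error $\mathrm{MSE}[t(\hat\sigma)]=E[t(\hat\sigma)-\mu]^2$ is finite and is approximated to second order by $\eta$, that is, $\mathrm{MSE}[t(\hat\sigma)]=\eta(\sigma)+o(d_*^{-2})$, then $\hat\eta$ is a second-order unbiased estimator of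 it: $E(\hat\eta)=\mathrm{MSE}[t(\hat\sigma)]+o(d_*^{-2})$. -/

import Mathlib

open MeasureTheory Filter Topology Asymptotics
open scoped Matrix ENNReal NNReal

universe u v

/-- The space of dispersion parameters `σ = (σ₁, …, σₛ)'`, with the Euclidean norm. -/
abbrev Param (s : ℕ) : Type := EuclideanSpace ℝ (Fin s)

noncomputable section

/-- The partial derivative `∂f/∂σᵢ`. -/
def pderiv {s : ℕ} (i : Fin s) (f : Param s → ℝ) (θ : Param s) : ℝ :=
  fderiv ℝ f θ (EuclideanSpace.single i 1)

/-- The Euclidean length of a vector. -/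
def vecNorm {s : ℕ} (v : Fin s → ℝ) : ℝ := ‖(WithLp.toLp 2 v : Param s)‖

/-- The spectral norm of a matrix: its operator norm for the Euclidean norm. -/
def specNorm {s : ℕ} (B : Matrix (Fin s) (Fin s) ℝ) : ℝ :=
  ‖Matrix.toEuclideanCLM (n := Fin s) (𝕜 := ℝ) B‖

/-- The largest (real) eigenvalue; it is only used for symmetric matrices. -/
def lambdaMax {s : ℕ} (B : Matrix (Fin s) (Fin s) ℝ) : ℝ := sSup (spectrum ℝ B)

/-- The gradient of a function of the parameter, as a vector of partial derivatives. -/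
def gradVec {s : ℕ} (f : Param s → ℝ) (θ : Param s) : Fin s → ℝ := fun i => pderiv i f θ

/-- The matrix of second partial derivatives. -/
def hessMat {s : ℕ} (f : Param s → ℝ) (θ : Param s) : Matrix (Fin s) (Fin s) ℝ :=
  Matrix.of fun i j => pderiv i (pderiv j f) θ

/-- One member (one sample size) of the sequence of statistical experiments: for each parameter
value `θ` a probability `P θ` on a space `Ω` that carries the data `Y` (and possibly more, such as
unobserved random effects), a criterion function `l(θ, y)` and the normalizing
constants `d₁, …, dₛ`. -/
structure Experiment (s : ℕ) where
  Ω : Type u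
  𝒴 : Type v
  [mΩ : MeasurableSpace Ω]
  [m𝒴 : MeasurableSpace 𝒴]
  P : Param s → Measure Ω
  isProb : ∀ θ, IsProbabilityMeasure (P θ)
  Y : Ω → 𝒴
  measurable_Y : Measurable Y
  l : Param s → 𝒴 → ℝ
  d : Fin s → ℝ

attribute [instance] Experiment.mΩ Experiment.m𝒴 Experiment.isProb

namespace Experiment

variable {s : ℕ} (M : Experiment.{u, v} s)

/-- `d_* = min dᵢ`. -/
def dstar : ℝ := ⨅ i, M.d i

/-- `S_δ(σ) = {θ : |θᵢ - σᵢ| ≤ δ d_* / dᵢ for all i}`. -/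
def box (σ : Param s) (δ : ℝ) : Set (Param s) :=
  {θ | ∀ i, |θ i - σ i| ≤ δ * M.dstar / M.d i}

/-- The expectation at `θ` of a function of the data. -/
def expect (θ : Param s) (f : M.𝒴 → ℝ) : ℝ := ∫ ω, f (M.Y ω) ∂(M.P θ)

/-- A function of the data has a finite expectation at `θ`. -/
def HasExpect (θ : Param s) (f : M.𝒴 → ℝ) : Prop := Integrable (fun ω => f (M.Y ω)) (M.P θ)

/-- `a = ∂l/∂σ`, evaluated at `θ`. -/
def a (θ : Param s) (y : M.𝒴) : Fin s → ℝ := gradVec (fun τ => M.l τ y) θ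

/-- `F = ∂²l/∂σ²`, evaluated at `θ`. -/
def F (θ : Param s) (y : M.𝒴) : Matrix (Fin s) (Fin s) ℝ := hessMat (fun τ => M.l τ y) θ

/-- `∂³l/∂σᵢ∂σⱼ∂σₖ`, evaluated at `θ`. -/
def l3 (i j k : Fin s) (θ : Param s) (y : M.𝒴) : ℝ :=
  pderiv i (pderiv j (pderiv k (fun τ => M.l τ y))) θ

/-- `∂⁴l/∂σᵢ∂σⱼ∂σₖ∂σₘ`, evaluated at `θ`. -/
def l4 (i j k m : Fin s) (θ : Param s) (y : M.𝒴) : ℝ :=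
  pderiv i (pderiv j (pderiv k (pderiv m (fun τ => M.l τ y)))) θ

/-- `Hᵢ = ∂³l/∂σᵢ∂σ²`, evaluated at `θ`. -/
def H (i : Fin s) (θ : Param s) (y : M.𝒴) : Matrix (Fin s) (Fin s) ℝ :=
  Matrix.of fun j k => M.l3 i j k θ y

/-- `E(a)`; the expectation is taken at the same `θ` at which `a` is evaluated. -/
def Ea (θ : Param s) : Fin s → ℝ := fun i => M.expect θ fun y => M.a θ y i

/-- `A = E(∂²l/∂σ²)`; the expectation is taken at the same `θ` at which the derivative is. -/
def A (θ : Param s) : Matrix (Fin s) (Fin s) ℝ :=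
  Matrix.of fun i j => M.expect θ fun y => M.F θ y i j

/-- `Q = D⁻¹ A D⁻¹` with `D = diag(d₁, …, dₛ)`. -/
def Q (θ : Param s) : Matrix (Fin s) (Fin s) ℝ :=
  (Matrix.diagonal M.d)⁻¹ * M.A θ * (Matrix.diagonal M.d)⁻¹

/-- `C`, the matrix whose `i`th row is `a' A⁻¹ Hᵢ`. -/
def C (θ : Param s) (y : M.𝒴) : Matrix (Fin s) (Fin s) ℝ :=
  Matrix.of fun i => (M.a θ y ᵥ* (M.A θ)⁻¹) ᵥ* M.H i θ y

/-- `λᵢ`, the entries of `D⁻¹ a`. -/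
def lam1 (i : Fin s) (θ : Param s) (y : M.𝒴) : ℝ := M.a θ y i / M.d i

/-- `λⱼₖ`, the entries of `D^{-1/2} (F - A) D^{-1/2}`. -/
def lam2 (j k : Fin s) (θ : Param s) (y : M.𝒴) : ℝ :=
  (M.F θ y j k - M.A θ j k) / (√(M.d j) * √(M.d k))

/-- `λᵢⱼₖ`, the entries of `D⁻¹ Hᵢ D⁻¹`. -/
def lam3 (i j k : Fin s) (θ : Param s) (y : M.𝒴) : ℝ :=
  M.H i θ y j k / (M.d j * M.d k)

/-- `U₁ = (E(λᵢ λₗ))`. -/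
def U1 (θ : Param s) : Matrix (Fin s) (Fin s) ℝ :=
  Matrix.of fun i l => M.expect θ fun y => M.lam1 i θ y * M.lam1 l θ y

/-- `U₂ = (E(λⱼₖ λₗ))`; the norm on this type is the maximum of the absolute values. -/
def U2 (θ : Param s) : Fin s → Fin s → Fin s → ℝ :=
  fun j k l => M.expect θ fun y => M.lam2 j k θ y * M.lam1 l θ y

/-- `U₃ = (E(λⱼₖₘ λₗ λₙ))`; the norm on this type is the maximum of the absolute values. -/
def U3 (θ : Param s) : Fin s → Fin s → Fin s → Fin s → Fin s → ℝ :=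
  fun j k l m n => M.expect θ fun y => M.lam3 j k m θ y * M.lam1 l θ y * M.lam1 n θ y

/-- All the expectations that define `E(a)`, `A`, `U₁`, `U₂`, `U₃` at `θ` exist. -/
def ExpectationsExist (θ : Param s) : Prop :=
  (∀ i, M.HasExpect θ fun y => M.a θ y i) ∧
  (∀ i j, M.HasExpect θ fun y => M.F θ y i j) ∧
  (∀ i l, M.HasExpect θ fun y => M.lam1 i θ y * M.lam1 l θ y) ∧
  (∀ j k l, M.HasExpect θ fun y => M.lam2 j k θ y * M.lam1 l θ y) ∧
  (∀ j k l m n, M.HasExpect θ fun y => M.lam3 j k m θ y * M.lam1 l θ y * M.lam1 n θ y)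

/-- `Δ₀ = -2 b' A⁻¹ E(a)`, where `b = ∂η/∂σ`. -/
def Delta0 (η : Param s → ℝ) (θ : Param s) : ℝ :=
  -2 * (gradVec η θ ⬝ᵥ ((M.A θ)⁻¹ *ᵥ M.Ea θ))

/-- `Δ₁ = b' A⁻¹ E(F A⁻¹ a)`. -/
def Delta1 (η : Param s → ℝ) (θ : Param s) : ℝ :=
  gradVec η θ ⬝ᵥ ((M.A θ)⁻¹ *ᵥ
    fun i => M.expect θ fun y => (M.F θ y *ᵥ ((M.A θ)⁻¹ *ᵥ M.a θ y)) i)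

/-- `Δ₂ = (1/2) E(a' A⁻¹ B A⁻¹ a)`, where `B = ∂²η/∂σ²`. -/
def Delta2 (η : Param s → ℝ) (θ : Param s) : ℝ :=
  (1 / 2) * M.expect θ fun y =>
    M.a θ y ⬝ᵥ (((M.A θ)⁻¹ * hessMat η θ * (M.A θ)⁻¹) *ᵥ M.a θ y)

/-- `Δ₃ = -(1/2) b' A⁻¹ E(C A⁻¹ a)`. -/
def Delta3 (η : Param s → ℝ) (θ : Param s) : ℝ :=
  -(1 / 2) * (gradVec η θ ⬝ᵥ ((M.A θ)⁻¹ *ᵥ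
    fun i => M.expect θ fun y => (M.C θ y *ᵥ ((M.A θ)⁻¹ *ᵥ M.a θ y)) i))

/-- `η(θ) - ∑_{j=0}^3 Δⱼ(θ)`. -/
def corrected (η : Param s → ℝ) (θ : Param s) : ℝ :=
  η θ - (M.Delta0 η θ + M.Delta1 η θ + M.Delta2 η θ + M.Delta3 η θ)

open Classical in
/-- The truncated estimator: `η(σ̂) - ∑ Δⱼ(σ̂)` if its absolute value is at most `c₀ d_*^κ`,
and `η(σ*)` otherwise. -/
def etaHat (η : Param s → ℝ) (c₀ κ : ℝ) (σstar : Param s) (σhat : M.𝒴 → Param s) (y : M.𝒴) : ℝ :=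
  if |M.corrected η (σhat y)| ≤ c₀ * M.dstar ^ κ then M.corrected η (σhat y) else η σstar

/-- The mean squared error at `σ` of the predictor `t` (a function of the data) of the
random quantity `μ`. -/
def mse (σ : Param s) (t : M.𝒴 → ℝ) (μ : M.Ω → ℝ) : ℝ :=
  ∫ ω, (t (M.Y ω) - μ ω) ^ 2 ∂(M.P σ)

/-- `sup_{θ ∈ S_δ(σ)} |f θ|` -/
def supBox (σ : Param s) (δ : ℝ) (f : Param s → ℝ) : ℝ≥0∞ :=
  ⨆ θ ∈ M.box σ δ, ENNReal.ofReal |f θ|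

end Experiment

open Experiment

/-- The `g`th moments, at the true `σ`, of the nonnegative variables `f n` are bounded in `n`. -/
def MomentsBounded {s : ℕ} (M : ℕ → Experiment.{u, v} s) (σ : Param s) (g : ℝ)
    (f : ∀ n, (M n).𝒴 → ℝ≥0∞) : Prop :=
  ∃ K : ℝ≥0, ∀ n, ∫⁻ ω, (f n ((M n).Y ω)) ^ g ∂((M n).P σ) ≤ K

/-- `sup_{θ ∈ S_δ(σ)} f n θ → 0` as `δ → 0`, uniformly in `n` (for nonnegative `f`). -/
def VanishesUniformly {s : ℕ} (M : ℕ → Experiment.{u, v} s) (σ : Param s)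
    (f : ℕ → Param s → ℝ) : Prop :=
  ∀ ε > 0, ∃ δ > 0, ∀ n, ∀ θ ∈ (M n).box σ δ, f n θ ≤ ε

/-- `σhat` is a consistent solution of the score equation `∂l/∂σ = 0`: for every `0 < ρ < 1` there
are events `ℬ n` with `P(ℬ nᶜ) ≤ c d_*^{-τ g}`, `τ = (1/4) ∧ (1 - ρ)`, such that for large `n`, on
`ℬ n`, `σhat ∈ Θ`, `∂l(σhat)/∂σ = 0` and `|D(σhat - σ)| < d_*^{1-ρ}`. -/
def IsScoreRoot {s : ℕ} (M : ℕ → Experiment.{u, v} s) (Θ : Set (Param s)) (σ : Param s) (g : ℝ)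
    (σhat : ∀ n, (M n).𝒴 → Param s) : Prop :=
  (∀ n, Measurable (σhat n)) ∧
  ∀ ρ : ℝ, 0 < ρ → ρ < 1 → ∃ (ℬ : ∀ n, Set (M n).Ω) (c : ℝ),
    ∀ᶠ n in atTop,
      (∀ ω ∈ ℬ n,
        σhat n ((M n).Y ω) ∈ Θ ∧
        (M n).a (σhat n ((M n).Y ω)) ((M n).Y ω) = 0 ∧
        vecNorm (fun i => (M n).d i * (σhat n ((M n).Y ω) i - σ i)) < (M n).dstar ^ (1 - ρ)) ∧
      (M n).P σ (ℬ n)ᶜ ≤ ENNReal.ofReal (c * (M n).dstar ^ (-(min (1 / 4) (1 - ρ) * g)))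

end

/-!
`Q(σ)` is negative definite by a fixed margin, so on the box `S_r(σ)` with `r = d_*^{-1/4}` the
normalized Hessian of `l` is negative definite outside an event of probability `O(d_*^{-τg})`.
There `l` is strongly concave, and its maximizer over the box is a root of the score equation.

The normalized derivatives of `l` are dominated by one variable `X` with bounded `g`th moments.
Where `X` is small compared with `√d_*`, the score equation expands the deviation `h = D(σ̂ - σ)`
of any consistent root in powers of `1 / d_*`, with coefficients polynomial in `X`. Inserting this
in the Taylor expansion of `η` gives `η(σ̂) - η(σ)` as a leading part, whose expectation is
exactly `∑ Δ_j(σ)`, plus a remainder of smaller order than `d_*^{-2}`. By (iv) and (v) the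
functions `d_*² ∑ Δ_j` are bounded and equicontinuous at `σ`, so that replacing `∑ Δ_j(σ)` by
`∑ Δ_j(σ̂)` costs `o(d_*^{-2})`. On the exceptional event the truncation bounds `η̂` by a multiple
of `d_*^κ`, and `g > 8 + 4κ` makes `d_*^κ d_*^{-g/4}` of smaller order than `d_*^{-2}`.
-/

open Experiment

section RealTaylor

variable {f f₁ f₂ f₃ : ℝ → ℝ}

lemma abs_sub_le_of_hasDerivAt {C : ℝ} (hf : ∀ t ∈ Set.Icc (0 : ℝ) 1, HasDerivAt f (f₁ t) t)
    (hC : ∀ t ∈ Set.Icc (0 : ℝ) 1, |f₁ t| ≤ C) {t : ℝ} (ht : t ∈ Set.Icc (0 : ℝ) 1) :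
    |f t - f 0| ≤ C := by
  have hC0 : 0 ≤ C := (abs_nonneg _).trans (hC t ht)
  calc |f t - f 0| ≤ C * (t - 0) :=
        norm_image_sub_le_of_norm_deriv_le_segment' (fun x hx => (hf x hx).hasDerivWithinAt)
          (fun x hx => hC x ⟨hx.1, hx.2.le⟩) t ht
    _ ≤ C := mul_le_of_le_one_right hC0 (by simpa using ht.2)

lemma abs_sub_taylor_two_le_of_hasDerivAt {C : ℝ}
    (hf : ∀ t ∈ Set.Icc (0 : ℝ) 1, HasDerivAt f (f₁ t) t)
    (hf₁ : ∀ t ∈ Set.Icc (0 : ℝ) 1, HasDerivAt f₁ (f₂ t) t)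
    (hf₂ : ∀ t ∈ Set.Icc (0 : ℝ) 1, HasDerivAt f₂ (f₃ t) t)
    (hC : ∀ t ∈ Set.Icc (0 : ℝ) 1, |f₃ t| ≤ C) :
    |f 1 - f 0 - f₁ 0 - 1 / 2 * f₂ 0| ≤ C := by
  have h₂ : ∀ t ∈ Set.Icc (0 : ℝ) 1, |f₂ t - f₂ 0| ≤ C := fun t ht =>
    abs_sub_le_of_hasDerivAt hf₂ hC ht
  have h₁ : ∀ t ∈ Set.Icc (0 : ℝ) 1, |f₁ t - t * f₂ 0 - f₁ 0| ≤ C := fun t ht => by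
    simpa using abs_sub_le_of_hasDerivAt (f := fun r => f₁ r - r * f₂ 0)
      (fun r hr => ((hf₁ r hr).sub ((hasDerivAt_id r).mul_const _)).congr_deriv (by simp)) h₂ ht
  have h₀ := abs_sub_le_of_hasDerivAt (f := fun r => f r - r * f₁ 0 - 1 / 2 * r ^ 2 * f₂ 0)
    (fun r hr => (((hf r hr).sub ((hasDerivAt_id r).mul_const _)).sub
      ((((hasDerivAt_id r).pow 2).const_mul (1 / 2 : ℝ)).mul_const (f₂ 0))).congr_deriv
        (by simp; ring)) h₁ (Set.right_mem_Icc.2 zero_le_one)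
  convert h₀ using 2
  ring

lemma le_taylor_one_of_hasDerivAt_le {m : ℝ}
    (hf : ∀ t ∈ Set.Icc (0 : ℝ) 1, HasDerivAt f (f₁ t) t)
    (hf₁ : ∀ t ∈ Set.Icc (0 : ℝ) 1, HasDerivAt f₁ (f₂ t) t)
    (hm : ∀ t ∈ Set.Icc (0 : ℝ) 1, f₂ t ≤ -m) :
    f 1 ≤ f 0 + f₁ 0 - m / 2 := by
  have antitone {φ φ' : ℝ → ℝ} (hφ : ∀ t ∈ Set.Icc (0 : ℝ) 1, HasDerivAt φ (φ' t) t)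
      (hφ' : ∀ t ∈ Set.Icc (0 : ℝ) 1, φ' t ≤ 0) : AntitoneOn φ (Set.Icc 0 1) :=
    antitoneOn_of_hasDerivWithinAt_nonpos (convex_Icc 0 1)
      (fun t ht => (hφ t ht).continuousAt.continuousWithinAt)
      (fun t ht => (hφ t (interior_subset ht)).hasDerivWithinAt)
      (fun t ht => hφ' t (interior_subset ht))
  have h₁ : AntitoneOn (fun r => f₁ r + m * r) (Set.Icc 0 1) :=
    antitone (fun t ht => (hf₁ t ht).add ((hasDerivAt_id t).const_mul m))
      fun t ht => by linarith [hm t ht]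
  have h₀ : AntitoneOn (fun r => f r - f₁ 0 * r + m / 2 * r ^ 2) (Set.Icc 0 1) := by
    refine antitone (φ' := fun t => f₁ t - f₁ 0 + m * t) (fun t ht => ?_) fun t ht => ?_
    · exact (((hf t ht).sub ((hasDerivAt_id t).const_mul (f₁ 0))).add
        (((hasDerivAt_id t).pow 2).const_mul (m / 2))).congr_deriv (by simp; ring)
    · linarith [h₁ (Set.left_mem_Icc.2 zero_le_one) ht ht.1]
  linarith [h₀ (Set.left_mem_Icc.2 zero_le_one) (Set.right_mem_Icc.2 zero_le_one) zero_le_one]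

end RealTaylor

section PartialDerivatives

variable {s : ℕ} {U : Set (Param s)} {f : Param s → ℝ}

lemma contDiffOn_pderiv {m n : WithTop ℕ∞} (hU : IsOpen U) (hf : ContDiffOn ℝ n f U)
    (h : m + 1 ≤ n) (i : Fin s) : ContDiffOn ℝ m (pderiv i f) U :=
  (hf.fderiv_of_isOpen hU h).clm_apply contDiffOn_const

lemma pderiv_congr (hU : IsOpen U) {g : Param s → ℝ} (h : Set.EqOn f g U) (i : Fin s)
    {x : Param s} (hx : x ∈ U) : pderiv i f x = pderiv i g x := by
  rw [pderiv, pderiv, (h.eventuallyEq_of_mem (hU.mem_nhds hx)).fderiv_eq]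

lemma pderiv_comm (hU : IsOpen U) (hf : ContDiffOn ℝ 2 f U) (i j : Fin s) {x : Param s}
    (hx : x ∈ U) : pderiv i (pderiv j f) x = pderiv j (pderiv i f) x := by
  have hd : DifferentiableAt ℝ (fderiv ℝ f) x :=
    ((hf.fderiv_of_isOpen hU (m := 1) (by norm_num)).differentiableOn
      (by norm_num)).differentiableAt (hU.mem_nhds hx)
  have pderiv_pderiv (i j : Fin s) : pderiv i (pderiv j f) x
      = fderiv ℝ (fderiv ℝ f) x (EuclideanSpace.single i 1) (EuclideanSpace.single j 1) := by
    change fderiv ℝ (fun y => fderiv ℝ f y (EuclideanSpace.single j 1)) x _ = _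
    rw [fderiv_clm_apply hd (by fun_prop)]
    simp
  rw [pderiv_pderiv, pderiv_pderiv]
  exact (hf.contDiffAt (hU.mem_nhds hx)).isSymmSndFDerivAt (by simp) _ _

lemma pderiv_reverse (hU : IsOpen U) (hf : ContDiffOn ℝ 3 f U) (i j k : Fin s) {x : Param s}
    (hx : x ∈ U) : pderiv k (pderiv j (pderiv i f)) x = pderiv i (pderiv j (pderiv k f)) x := by
  have hf₂ : ContDiffOn ℝ 2 f U := hf.of_le (by norm_num)
  calc pderiv k (pderiv j (pderiv i f)) x
      = pderiv k (pderiv i (pderiv j f)) x :=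
        pderiv_congr hU (fun _ => pderiv_comm hU hf₂ j i) k hx
    _ = pderiv i (pderiv k (pderiv j f)) x :=
        pderiv_comm hU (contDiffOn_pderiv hU hf (by norm_num) j) k i hx
    _ = pderiv i (pderiv j (pderiv k f)) x :=
        pderiv_congr hU (fun _ => pderiv_comm hU hf₂ k j) i hx

lemma fderiv_apply_eq_sum_pderiv (f : Param s → ℝ) (x v : Param s) :
    fderiv ℝ f x v = ∑ i, v i * pderiv i f x := by
  have hv : ∑ i, v i • EuclideanSpace.single i (1 : ℝ) = v := by
    simpa using (EuclideanSpace.basisFun (Fin s) ℝ).sum_repr v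
  conv_lhs => rw [← hv]
  simp [pderiv]

lemma hasDerivAt_comp_line (hU : IsOpen U) (hf : DifferentiableOn ℝ f U) (x v : Param s)
    {t : ℝ} (ht : x + t • v ∈ U) :
    HasDerivAt (fun r : ℝ => f (x + r • v)) (∑ i, v i * pderiv i f (x + t • v)) t := by
  rw [← fderiv_apply_eq_sum_pderiv]
  have hline : HasDerivAt (fun r : ℝ => x + r • v) v t := by
    simpa using ((hasDerivAt_id t).smul_const v).const_add x
  exact (hf.differentiableAt (hU.mem_nhds ht)).hasFDerivAt.comp_hasDerivAt t hline

lemma hasDerivAt_comp_line₂ (hU : IsOpen U) (hf : ContDiffOn ℝ 2 f U) (x v : Param s)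
    {t : ℝ} (ht : x + t • v ∈ U) :
    HasDerivAt (fun r : ℝ => ∑ i, v i * pderiv i f (x + r • v))
      (∑ i, v i * ∑ j, v j * pderiv j (pderiv i f) (x + t • v)) t :=
  HasDerivAt.fun_sum fun i _ => (hasDerivAt_comp_line hU ((contDiffOn_pderiv hU hf (m := 1)
    (by norm_num) i).differentiableOn (by norm_num)) x v ht).const_mul _

lemma hasDerivAt_comp_line₃ (hU : IsOpen U) (hf : ContDiffOn ℝ 3 f U) (x v : Param s)
    {t : ℝ} (ht : x + t • v ∈ U) :
    HasDerivAt (fun r : ℝ => ∑ i, v i * ∑ j, v j * pderiv j (pderiv i f) (x + r • v))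
      (∑ i, v i * ∑ j, v j * ∑ k, v k * pderiv k (pderiv j (pderiv i f)) (x + t • v)) t :=
  HasDerivAt.fun_sum fun i _ => (hasDerivAt_comp_line₂ hU
    (contDiffOn_pderiv hU hf (m := 2) (by norm_num) i) x v ht).const_mul _

lemma abs_sub_le_of_abs_sum_pderiv_le (hU : IsOpen U) (hf : DifferentiableOn ℝ f U)
    (x v : Param s) (hseg : ∀ t ∈ Set.Icc (0 : ℝ) 1, x + t • v ∈ U) {C : ℝ}
    (hC : ∀ t ∈ Set.Icc (0 : ℝ) 1, |∑ i, v i * pderiv i f (x + t • v)| ≤ C) :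
    |f (x + v) - f x| ≤ C := by
  simpa using abs_sub_le_of_hasDerivAt (fun t ht => hasDerivAt_comp_line hU hf x v (hseg t ht)) hC
    (Set.right_mem_Icc.2 zero_le_one)

lemma abs_sub_taylor_two_le (hU : IsOpen U) (hf : ContDiffOn ℝ 3 f U) (x v : Param s)
    (hseg : ∀ t ∈ Set.Icc (0 : ℝ) 1, x + t • v ∈ U) {C : ℝ}
    (hC : ∀ t ∈ Set.Icc (0 : ℝ) 1,
      |∑ i, v i * ∑ j, v j * ∑ k, v k * pderiv k (pderiv j (pderiv i f)) (x + t • v)| ≤ C) :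
    |f (x + v) - f x - ∑ i, v i * pderiv i f x
      - 1 / 2 * ∑ i, v i * ∑ j, v j * pderiv j (pderiv i f) x| ≤ C := by
  simpa using abs_sub_taylor_two_le_of_hasDerivAt
    (fun t ht => hasDerivAt_comp_line hU (hf.differentiableOn (by norm_num)) x v (hseg t ht))
    (fun t ht => hasDerivAt_comp_line₂ hU (hf.of_le (by norm_num)) x v (hseg t ht))
    (fun t ht => hasDerivAt_comp_line₃ hU hf x v (hseg t ht)) hC

lemma le_taylor_one_of_sum_pderiv_le (hU : IsOpen U) (hf : ContDiffOn ℝ 2 f U) (x v : Param s)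
    (hseg : ∀ t ∈ Set.Icc (0 : ℝ) 1, x + t • v ∈ U) {m : ℝ}
    (hm : ∀ t ∈ Set.Icc (0 : ℝ) 1,
      ∑ i, v i * ∑ j, v j * pderiv j (pderiv i f) (x + t • v) ≤ -m) :
    f (x + v) ≤ f x + ∑ i, v i * pderiv i f x - m / 2 := by
  simpa using le_taylor_one_of_hasDerivAt_le
    (fun t ht => hasDerivAt_comp_line hU (hf.differentiableOn (by norm_num)) x v (hseg t ht))
    (fun t ht => hasDerivAt_comp_line₂ hU hf x v (hseg t ht)) hm

-- The partial derivative is a pointwise limit of difference quotients along `1 / (n + 1)`.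
lemma measurable_pderiv {𝒴 : Type*} [MeasurableSpace 𝒴] {F : Param s → 𝒴 → ℝ} (hU : IsOpen U)
    (hm : ∀ θ ∈ U, Measurable (F θ)) (hd : ∀ y, DifferentiableOn ℝ (fun θ => F θ y) U)
    (i : Fin s) {x : Param s} (hx : x ∈ U) :
    Measurable fun y => pderiv i (fun θ => F θ y) x := by
  set v : Param s := EuclideanSpace.single i 1
  have hpoints : Tendsto (fun n : ℕ => x + ((n : ℝ) + 1)⁻¹ • v) atTop (𝓝 x) := by
    simpa [one_div] using
      ((tendsto_one_div_add_atTop_nhds_zero_nat (𝕜 := ℝ)).smul_const v).const_add x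
  obtain ⟨N, hN⟩ := eventually_atTop.1 (hpoints.eventually (hU.mem_nhds hx))
  refine measurable_of_tendsto_metrizable
    (f := fun n y => ((n + N : ℕ) + 1 : ℝ) *
      (F (x + (((n + N : ℕ) : ℝ) + 1)⁻¹ • v) y - F x y))
    (fun n => ((hm _ (hN _ (by omega))).sub (hm _ hx)).const_mul _)
    (tendsto_pi_nhds.2 fun y => ?_)
  have hscale : Tendsto (fun n : ℕ => ‖((n + N : ℕ) : ℝ) + 1‖) atTop atTop :=
    tendsto_norm_atTop_atTop.comp <| tendsto_atTop_add_const_right _ _ <|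
      tendsto_natCast_atTop_atTop.comp (tendsto_add_atTop_nat N)
  exact ((hd y).differentiableAt (hU.mem_nhds hx)).hasFDerivAt.lim v hscale

end PartialDerivatives

section MeasurableSelection

variable {E : Type*} [TopologicalSpace E] {K : Set E}

lemma tendsto_of_tendsto_unique_max (hK : IsCompact K) {f : E → ℝ} (hf : ContinuousOn f K) {θ : E}
    (huniq : ∀ θ' ∈ K, f θ ≤ f θ' → θ' = θ) {u : ℕ → E} (hu : ∀ m, u m ∈ K)
    (hlim : Tendsto (fun m => f (u m)) atTop (𝓝 (f θ))) : Tendsto u atTop (𝓝 θ) := by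
  refine hK.tendsto_nhds_of_unique_mapClusterPt (Eventually.of_forall hu)
    fun z hz hcluster => huniq z hz ?_
  by_contra! hlt
  obtain ⟨r, hzr, hrθ⟩ := exists_between hlt
  obtain ⟨V, hV, hVK⟩ := mem_nhdsWithin_iff_exists_mem_nhds_inter.1
    ((hf z hz).eventually (gt_mem_nhds hzr))
  obtain ⟨m, hmV, hmr⟩ := ((hcluster.frequently hV).and_eventually
    (hlim.eventually (lt_mem_nhds hrθ))).exists
  exact hmr.not_gt (hVK ⟨hmV, hu m⟩)

variable {𝒴 : Type*} [MeasurableSpace 𝒴] {F : E → 𝒴 → ℝ}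

lemma measurable_biSup_ofReal_abs [SecondCountableTopology E] (hm : ∀ θ ∈ K, Measurable (F θ))
    (hc : ∀ y, ContinuousOn (fun θ => F θ y) K) :
    Measurable fun y => ⨆ θ ∈ K, ENNReal.ofReal |F θ y| := by
  obtain ⟨t, htc, htd⟩ := TopologicalSpace.exists_countable_dense K
  have := htc.to_subtype
  have hsup (y : 𝒴) : (⨆ θ ∈ K, ENNReal.ofReal |F θ y|)
      = ⨆ θ : t, ENNReal.ofReal |F θ.1 y| := by
    rw [iSup_subtype', ← htd.ciSup' (f := fun θ : K => ENNReal.ofReal |F θ y|)]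
    exact ENNReal.continuous_ofReal.comp (continuousOn_iff_continuous_domRestrict.1 (hc y)).abs
  simp only [hsup]
  exact Measurable.iSup fun θ => (measurable_norm.comp (hm _ θ.1.2)).ennreal_ofReal

lemma exists_measurable_seq_tendsto_max [SecondCountableTopology E] [MeasurableSpace E]
    (hK : IsCompact K) (hne : K.Nonempty) (hm : ∀ θ ∈ K, Measurable (F θ))
    (hc : ∀ y, ContinuousOn (fun θ => F θ y) K) :
    ∃ τ : ℕ → 𝒴 → E, (∀ m, Measurable (τ m)) ∧ (∀ m y, τ m y ∈ K) ∧
      ∀ y, ∀ θ ∈ K, (∀ θ' ∈ K, F θ' y ≤ F θ y) →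
        Tendsto (fun m => F (τ m y) y) atTop (𝓝 (F θ y)) := by
  classical
  have : Nonempty K := hne.to_subtype
  set q : ℕ → K := TopologicalSpace.denseSeq K
  set S : 𝒴 → ℝ := fun y => ⨆ k, F (q k) y
  have hbdd (y : 𝒴) : BddAbove (Set.range fun k => F (q k) y) := by
    refine (hK.image_of_continuousOn (hc y)).bddAbove.mono ?_
    rintro _ ⟨k, rfl⟩
    exact ⟨q k, (q k).2, rfl⟩
  have hS : Measurable S := Measurable.iSup fun k => hm _ (q k).2
  have hnear (m : ℕ) (y : 𝒴) : ∃ k, S y - 1 / ((m : ℝ) + 1) < F (q k) y :=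
    exists_lt_of_lt_ciSup (sub_lt_self _ (by positivity))
  have hfind (m : ℕ) : Measurable fun y => Nat.find (hnear m y) :=
    measurable_find (hnear m) fun k => measurableSet_lt (hS.sub_const _) (hm _ (q k).2)
  refine ⟨fun m y => q (Nat.find (hnear m y)),
    fun m => (measurable_from_nat (f := fun k => (q k : E))).comp (hfind m),
    fun m y => (q _).2, fun y θ hθ hmax => ?_⟩
  have hSθ : S y = F θ y := by
    refine le_antisymm (ciSup_le fun k => hmax _ (q k).2) ?_
    have hcont : Continuous fun θ : K => F θ y := continuousOn_iff_continuous_domRestrict.1 (hc y)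
    exact closure_minimal (Set.range_subset_iff.2 fun k => le_ciSup (hbdd y) k)
      (isClosed_le hcont continuous_const) (TopologicalSpace.denseRange_denseSeq K ⟨θ, hθ⟩)
  refine tendsto_of_tendsto_of_tendsto_of_le_of_le
    (g := fun m : ℕ => S y - 1 / ((m : ℝ) + 1)) ?_ tendsto_const_nhds
    (fun m => (Nat.find_spec (hnear m y)).le) fun m => hmax _ (q _).2
  simpa [hSθ] using (tendsto_one_div_add_atTop_nhds_zero_nat (𝕜 := ℝ)).const_sub (S y)

lemma exists_measurable_unique_max [PolishSpace E] [MeasurableSpace E] [BorelSpace E]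
    (hK : IsCompact K) (hne : K.Nonempty) (hm : ∀ θ ∈ K, Measurable (F θ))
    (hc : ∀ y, ContinuousOn (fun θ => F θ y) K) :
    ∃ τ : 𝒴 → E, Measurable τ ∧ ∀ y, ∀ θ ∈ K,
      (∀ θ' ∈ K, F θ' y ≤ F θ y) → (∀ θ' ∈ K, F θ y ≤ F θ' y → θ' = θ) → τ y = θ := by
  obtain ⟨τ, hτm, hτK, hτ⟩ := exists_measurable_seq_tendsto_max hK hne hm hc
  have : Nonempty E := hne.to_type
  exact ⟨fun y => limUnder atTop fun m => τ m y,
    (StronglyMeasurable.limUnder fun m => (hτm m).stronglyMeasurable).measurable,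
    fun y θ hθ hmax huniq => (tendsto_of_tendsto_unique_max hK (hc y) huniq (hτK · y)
      (hτ y θ hθ hmax)).limUnder_eq⟩

end MeasurableSelection

section MatrixBounds

variable {ι : Type*} [Fintype ι]

lemma sum_abs_mul_abs_le (x : ι → ℝ) :
    ∑ i, ∑ j, |x i| * |x j| ≤ Fintype.card ι * (x ⬝ᵥ x) := by
  have hcs := sq_sum_le_card_mul_sum_sq (s := Finset.univ) (f := fun i => |x i|)
  simp only [← Finset.sum_mul_sum, ← sq, dotProduct]
  simpa only [sq_abs, Finset.card_univ] using hcs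

lemma abs_dotProduct_mulVec_le {B : Matrix ι ι ℝ} {ε : ℝ} (hB : ∀ i j, |B i j| ≤ ε) (hε : 0 ≤ ε)
    (x : ι → ℝ) : |x ⬝ᵥ (B *ᵥ x)| ≤ Fintype.card ι * ε * (x ⬝ᵥ x) := by
  calc |x ⬝ᵥ (B *ᵥ x)| ≤ ∑ i, ∑ j, |x i * (B i j * x j)| := by
        simp only [dotProduct, Matrix.mulVec, Finset.mul_sum]
        exact (Finset.abs_sum_le_sum_abs _ _).trans
          (Finset.sum_le_sum fun i _ => Finset.abs_sum_le_sum_abs _ _)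
    _ ≤ ∑ i, ∑ j, ε * (|x i| * |x j|) := by
        refine Finset.sum_le_sum fun i _ => Finset.sum_le_sum fun j _ => ?_
        rw [abs_mul, abs_mul, mul_left_comm]
        exact mul_le_mul_of_nonneg_right (hB i j) (by positivity)
    _ ≤ Fintype.card ι * ε * (x ⬝ᵥ x) := by
        rw [mul_comm _ ε, mul_assoc]
        simpa only [Finset.mul_sum] using mul_le_mul_of_nonneg_left (sum_abs_mul_abs_le x) hε

/-- The quadratic form of `B` is at most `-m` times the squared Euclidean norm. Symmetry of `B` is
not part of the notion. -/
def IsNegDefBy (m : ℝ) (B : Matrix ι ι ℝ) : Prop :=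
  ∀ x : ι → ℝ, x ⬝ᵥ (B *ᵥ x) ≤ -m * (x ⬝ᵥ x)

namespace IsNegDefBy

variable {B B' : Matrix ι ι ℝ} {m ε : ℝ}

lemma of_close (h : IsNegDefBy m B) (hclose : ∀ i j, |B' i j - B i j| ≤ ε) (hε : 0 ≤ ε)
    (hm : Fintype.card ι * ε ≤ m / 2) : IsNegDefBy (m / 2) B' := by
  intro x
  have hx : 0 ≤ x ⬝ᵥ x := Finset.sum_nonneg fun i _ => mul_self_nonneg (x i)
  have hdiff : x ⬝ᵥ ((B' - B) *ᵥ x) ≤ m / 2 * (x ⬝ᵥ x) :=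
    (le_abs_self _).trans ((abs_dotProduct_mulVec_le hclose hε x).trans
      (mul_le_mul_of_nonneg_right hm hx))
  rw [Matrix.sub_mulVec, dotProduct_sub] at hdiff
  linarith [h x]

variable [DecidableEq ι]

lemma isUnit_det (h : IsNegDefBy m B) (hm : 0 < m) : IsUnit B.det := by
  rw [isUnit_iff_ne_zero]
  intro hdet
  obtain ⟨v, hv, hBv⟩ := Matrix.exists_mulVec_eq_zero_iff.2 hdet
  have hvv : 0 < v ⬝ᵥ v := by simpa using Matrix.dotProduct_star_self_pos_iff.2 hv
  have := h v
  rw [hBv, dotProduct_zero] at this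
  nlinarith

lemma abs_inv_apply_le (h : IsNegDefBy m B) (hm : 0 < m) (i j : ι) : |B⁻¹ i j| ≤ 1 / m := by
  set y : ι → ℝ := B⁻¹ *ᵥ Pi.single j 1
  have hBy : B *ᵥ y = Pi.single j 1 := by
    simp only [y, Matrix.mulVec_mulVec, Matrix.mul_nonsing_inv _ (h.isUnit_det hm),
      Matrix.one_mulVec]
  have hform : m * (y ⬝ᵥ y) ≤ -y j := by
    have := h y
    rw [hBy, dotProduct_single, mul_one] at this
    linarith
  have hle (k : ι) : y k ^ 2 ≤ y ⬝ᵥ y := by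
    simpa only [dotProduct, ← sq] using
      Finset.single_le_sum (f := fun i => y i ^ 2) (fun i _ => sq_nonneg _) (Finset.mem_univ k)
  have hnorm : m ^ 2 * (y ⬝ᵥ y) ≤ 1 := by
    nlinarith [sq_nonneg (m * y j + 1), hle j, mul_le_mul_of_nonneg_left hform hm.le,
      mul_le_mul_of_nonneg_left (hle j) (sq_nonneg m)]
  have hy : y i = B⁻¹ i j := by simp [y]
  rw [← hy, le_div_iff₀ hm, ← abs_of_pos hm, ← abs_mul, ← sq_le_one_iff_abs_le_one]
  nlinarith [hle i, mul_le_mul_of_nonneg_left (hle i) (sq_nonneg m)]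

end IsNegDefBy

variable {s : ℕ}

lemma abs_apply_le_vecNorm (v : Fin s → ℝ) (i : Fin s) : |v i| ≤ vecNorm v :=
  PiLp.norm_apply_le (WithLp.toLp 2 v : Param s) i

lemma abs_apply_le_specNorm (B : Matrix (Fin s) (Fin s) ℝ) (i j : Fin s) :
    |B i j| ≤ specNorm B := by
  set T := Matrix.toEuclideanCLM (n := Fin s) (𝕜 := ℝ) B
  calc |B i j| = ‖T (EuclideanSpace.single j 1) i‖ := by simp [T]
    _ ≤ ‖T (EuclideanSpace.single j 1)‖ := PiLp.norm_apply_le _ i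
    _ ≤ ‖T‖ := by simpa using T.le_opNorm (EuclideanSpace.single j 1)

lemma isNegDefBy_of_lambdaMax_le {B : Matrix (Fin s) (Fin s) ℝ} (hB : B.IsSymm) {m : ℝ}
    (h : lambdaMax B ≤ -m) : IsNegDefBy m B := by
  have hHerm : B.IsHermitian := by
    rwa [Matrix.IsHermitian, Matrix.conjTranspose_eq_transpose_of_trivial]
  set S : Matrix (Fin s) (Fin s) ℝ := algebraMap ℝ _ (-m) - B
  have hS : S.IsHermitian := by
    refine Matrix.IsHermitian.sub ?_ hHerm
    rw [Matrix.IsHermitian, Matrix.algebraMap_eq_diagonal, Matrix.diagonal_conjTranspose]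
    simp
  have hpos : S.PosSemidef := hS.posSemidef_iff_eigenvalues_nonneg.2 fun i => by
    have hmem := hS.eigenvalues_mem_spectrum_real i
    rw [← spectrum.singleton_sub_eq] at hmem
    obtain ⟨_, rfl, r, hr, heq⟩ := hmem
    have : r ≤ -m := (le_csSup Matrix.finite_real_spectrum.bddAbove hr).trans h
    simp only [Pi.zero_apply, ← heq]
    linarith
  intro x
  have := hpos.dotProduct_mulVec_nonneg x
  simp only [S, star_trivial, Matrix.sub_mulVec, dotProduct_sub, Algebra.algebraMap_eq_smul_one,
    Matrix.smul_mulVec, Matrix.one_mulVec, dotProduct_smul, smul_eq_mul] at this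
  linarith

end MatrixBounds

namespace Experiment

section Box

variable {s : ℕ} {M : Experiment.{u, v} s} {σ : Param s} {r r' : ℝ}

lemma dstar_le (M : Experiment.{u, v} s) (i : Fin s) : M.dstar ≤ M.d i :=
  ciInf_le (Set.finite_range _).bddBelow i

lemma dstar_nonneg (hd : ∀ i, 0 < M.d i) : 0 ≤ M.dstar :=
  Real.iInf_nonneg fun i => (hd i).le

lemma dstar_pow_three_le (hd : ∀ i, 0 < M.d i) (i j k : Fin s) :
    M.dstar ^ 3 ≤ M.d i * M.d j * M.d k := by
  have hdstar := dstar_nonneg hd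
  rw [pow_succ, sq]
  exact mul_le_mul (mul_le_mul (M.dstar_le i) (M.dstar_le j) hdstar (hd i).le) (M.dstar_le k)
    hdstar (mul_pos (hd i) (hd j)).le

lemma abs_mul_dstar_le (hd : ∀ i, 0 < M.d i) {c K : ℝ} (h : |c| ≤ K) (i : Fin s) :
    |c| * M.dstar ≤ K * M.d i :=
  mul_le_mul h (M.dstar_le i) (dstar_nonneg hd) ((abs_nonneg c).trans h)

lemma box_mono (hd : ∀ i, 0 < M.d i) (h : r ≤ r') : M.box σ r ⊆ M.box σ r' := fun θ hθ i => by
  have := dstar_nonneg hd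
  have := hd i
  exact (hθ i).trans (by gcongr)

lemma self_mem_box (hd : ∀ i, 0 < M.d i) (hr : 0 ≤ r) : σ ∈ M.box σ r := fun i => by
  have := dstar_nonneg hd
  have := hd i
  simp only [sub_self, abs_zero]
  positivity

lemma box_eq_preimage (M : Experiment.{u, v} s) (σ : Param s) (r : ℝ) :
    M.box σ r = EuclideanSpace.equiv (Fin s) ℝ ⁻¹'
      Set.univ.pi fun i => Metric.closedBall (σ i) (r * M.dstar / M.d i) := by
  ext θ
  simp [box, Real.dist_eq]

lemma convex_box (M : Experiment.{u, v} s) (σ : Param s) (r : ℝ) : Convex ℝ (M.box σ r) := by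
  rw [box_eq_preimage]
  exact (convex_pi fun i _ => convex_closedBall _ _).linear_preimage
    (EuclideanSpace.equiv (Fin s) ℝ).toLinearMap

lemma segment_mem_box {x y : Param s} (hx : x ∈ M.box σ r) (hy : y ∈ M.box σ r) {t : ℝ}
    (ht : t ∈ Set.Icc (0 : ℝ) 1) : x + t • (y - x) ∈ M.box σ r :=
  (M.convex_box σ r).add_smul_sub_mem hx hy ht

lemma isCompact_box (M : Experiment.{u, v} s) (σ : Param s) (r : ℝ) : IsCompact (M.box σ r) := by
  rw [box_eq_preimage]
  exact (EuclideanSpace.equiv (Fin s) ℝ).toHomeomorph.isCompact_preimage.2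
    (isCompact_univ_pi fun i => isCompact_closedBall _ _)

end Box

section NormalizedInformation

variable {s : ℕ} {M : Experiment.{u, v} s} {θ : Param s}

lemma Q_apply (hd : ∀ i, 0 < M.d i) (θ : Param s) (i j : Fin s) :
    M.Q θ i j = M.A θ i j / (M.d i * M.d j) := by
  have hinv : (Matrix.diagonal M.d)⁻¹ = Matrix.diagonal fun i => (M.d i)⁻¹ :=
    Matrix.inv_eq_right_inv <| by
      simp [Matrix.diagonal_mul_diagonal, mul_inv_cancel₀ (hd _).ne']
  rw [Q, hinv, Matrix.mul_diagonal, Matrix.diagonal_mul]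
  field_simp

lemma Q_isSymm (hd : ∀ i, 0 < M.d i) (h : (M.A θ).IsSymm) : (M.Q θ).IsSymm := by
  ext i j
  rw [Matrix.transpose_apply, Q_apply hd, Q_apply hd, h.apply, mul_comm (M.d j)]

lemma inv_A_apply (hd : ∀ i, 0 < M.d i) (θ : Param s) (i j : Fin s) :
    (M.A θ)⁻¹ i j = (M.Q θ)⁻¹ i j / (M.d i * M.d j) := by
  have hdet : IsUnit (Matrix.diagonal M.d).det := by
    rw [Matrix.det_diagonal, isUnit_iff_ne_zero]
    exact Finset.prod_ne_zero_iff.2 fun i _ => (hd i).ne'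
  have hQ : (M.Q θ)⁻¹ = Matrix.diagonal M.d * (M.A θ)⁻¹ * Matrix.diagonal M.d := by
    rw [Q, Matrix.mul_inv_rev, Matrix.mul_inv_rev, Matrix.nonsing_inv_nonsing_inv _ hdet,
      Matrix.mul_assoc]
  rw [hQ, Matrix.mul_diagonal, Matrix.diagonal_mul, eq_div_iff (mul_pos (hd i) (hd j)).ne']
  ring

lemma isUnit_det_A (h : IsUnit (M.Q θ).det) : IsUnit (M.A θ).det := by
  rw [Q, Matrix.det_mul, Matrix.det_mul] at h
  exact isUnit_of_mul_isUnit_right (isUnit_of_mul_isUnit_left h)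

end NormalizedInformation

/-- The criterion function is measurable in the data and four times continuously differentiable in
the parameter on the open set `U`. -/
structure RegularOn {s : ℕ} (M : Experiment.{u, v} s) (U : Set (Param s)) : Prop where
  isOpen : IsOpen U
  measurable_l : ∀ θ ∈ U, Measurable (M.l θ)
  contDiffOn_l : ∀ y, ContDiffOn ℝ 4 (fun θ => M.l θ y) U

namespace RegularOn

variable {s : ℕ} {M : Experiment.{u, v} s} {U : Set (Param s)} {θ : Param s}

lemma contDiffOn_a (h : M.RegularOn U) (i : Fin s) (y : M.𝒴) :
    ContDiffOn ℝ 3 (fun θ => M.a θ y i) U :=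
  contDiffOn_pderiv h.isOpen (h.contDiffOn_l y) (by norm_num) i

lemma contDiffOn_F (h : M.RegularOn U) (i j : Fin s) (y : M.𝒴) :
    ContDiffOn ℝ 2 (fun θ => M.F θ y i j) U :=
  contDiffOn_pderiv h.isOpen (h.contDiffOn_a j y) (by norm_num) i

lemma contDiffOn_l3 (h : M.RegularOn U) (i j k : Fin s) (y : M.𝒴) :
    ContDiffOn ℝ 1 (fun θ => M.l3 i j k θ y) U :=
  contDiffOn_pderiv h.isOpen (h.contDiffOn_F j k y) (by norm_num) i

lemma continuousOn_l4 (h : M.RegularOn U) (i j k m : Fin s) (y : M.𝒴) :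
    ContinuousOn (fun θ => M.l4 i j k m θ y) U :=
  (contDiffOn_pderiv h.isOpen (h.contDiffOn_l3 j k m y) (m := 0) (by norm_num) i).continuousOn

lemma measurable_a (h : M.RegularOn U) (hθ : θ ∈ U) (i : Fin s) : Measurable fun y => M.a θ y i :=
  measurable_pderiv h.isOpen h.measurable_l
    (fun y => (h.contDiffOn_l y).differentiableOn (by norm_num)) i hθ

lemma measurable_F (h : M.RegularOn U) (hθ : θ ∈ U) (i j : Fin s) :
    Measurable fun y => M.F θ y i j :=
  measurable_pderiv h.isOpen (fun _ hθ => h.measurable_a hθ j)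
    (fun y => (h.contDiffOn_a j y).differentiableOn (by norm_num)) i hθ

lemma measurable_l3 (h : M.RegularOn U) (hθ : θ ∈ U) (i j k : Fin s) :
    Measurable fun y => M.l3 i j k θ y :=
  measurable_pderiv h.isOpen (fun _ hθ => h.measurable_F hθ j k)
    (fun y => (h.contDiffOn_F j k y).differentiableOn (by norm_num)) i hθ

lemma measurable_l4 (h : M.RegularOn U) (hθ : θ ∈ U) (i j k m : Fin s) :
    Measurable fun y => M.l4 i j k m θ y :=
  measurable_pderiv h.isOpen (fun _ hθ => h.measurable_l3 hθ j k m)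
    (fun y => (h.contDiffOn_l3 j k m y).differentiableOn (by norm_num)) i hθ

lemma F_symm (h : M.RegularOn U) (hθ : θ ∈ U) (i j : Fin s) (y : M.𝒴) :
    M.F θ y i j = M.F θ y j i :=
  pderiv_comm h.isOpen ((h.contDiffOn_l y).of_le (by norm_num)) i j hθ

lemma A_isSymm (h : M.RegularOn U) (hθ : θ ∈ U) : (M.A θ).IsSymm := by
  ext i j
  simp only [Matrix.transpose_apply, A, Matrix.of_apply, h.F_symm hθ j i]

end RegularOn

end Experiment

section BoundedMoments

variable {s : ℕ} {M : ℕ → Experiment.{u, v} s} {σ : Param s} {g : ℝ}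

/-- The statistics `f n` are measurable and their `g`th moments at `σ` are bounded in `n`. -/
def MeasurableMomentsBounded (M : ℕ → Experiment.{u, v} s) (σ : Param s) (g : ℝ)
    (f : ∀ n, (M n).𝒴 → ℝ≥0∞) : Prop :=
  (∀ n, Measurable (f n)) ∧ MomentsBounded M σ g f

namespace MeasurableMomentsBounded

lemma one : MeasurableMomentsBounded M σ g fun _ _ => 1 :=
  ⟨fun _ => measurable_const, 1, fun n => by simp⟩

lemma add (hg : 1 ≤ g) {f₁ f₂ : ∀ n, (M n).𝒴 → ℝ≥0∞} (h₁ : MeasurableMomentsBounded M σ g f₁)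
    (h₂ : MeasurableMomentsBounded M σ g f₂) :
    MeasurableMomentsBounded M σ g fun n y => f₁ n y + f₂ n y := by
  obtain ⟨hf₁, K₁, hK₁⟩ := h₁
  obtain ⟨hf₂, K₂, hK₂⟩ := h₂
  have htop : (2 : ℝ≥0∞) ^ (g - 1) ≠ ∞ :=
    ENNReal.rpow_ne_top_of_nonneg (by linarith) (by norm_num)
  refine ⟨fun n => (hf₁ n).add (hf₂ n), ((2 : ℝ≥0∞) ^ (g - 1)).toNNReal * (K₁ + K₂), fun n => ?_⟩
  calc ∫⁻ ω, (f₁ n ((M n).Y ω) + f₂ n ((M n).Y ω)) ^ g ∂((M n).P σ)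
      ≤ ∫⁻ ω, 2 ^ (g - 1) * (f₁ n ((M n).Y ω) ^ g + f₂ n ((M n).Y ω) ^ g) ∂((M n).P σ) :=
        lintegral_mono fun ω => ENNReal.rpow_add_le_mul_rpow_add_rpow _ _ hg
    _ = 2 ^ (g - 1) * (∫⁻ ω, f₁ n ((M n).Y ω) ^ g ∂((M n).P σ)
          + ∫⁻ ω, f₂ n ((M n).Y ω) ^ g ∂((M n).P σ)) := by
        rw [lintegral_const_mul' _ _ htop, lintegral_add_left]
        exact ((hf₁ n).comp (M n).measurable_Y).pow_const g
    _ ≤ 2 ^ (g - 1) * (K₁ + K₂) := by gcongr; exacts [hK₁ n, hK₂ n]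
    _ = _ := by rw [ENNReal.coe_mul, ENNReal.coe_toNNReal htop, ENNReal.coe_add]

lemma sum (hg : 1 ≤ g) {ι : Type*} [Fintype ι] {f : ι → ∀ n, (M n).𝒴 → ℝ≥0∞}
    (h : ∀ i, MeasurableMomentsBounded M σ g (f i)) :
    MeasurableMomentsBounded M σ g fun n y => ∑ i, f i n y := by
  classical
  induction (Finset.univ : Finset ι) using Finset.induction_on with
  | empty => exact ⟨fun _ => measurable_const, 0, fun n => by simp [show 0 < g by linarith]⟩
  | insert i t hi ih =>
    simp only [Finset.sum_insert hi]
    exact (h i).add hg ih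

end MeasurableMomentsBounded

/-- The moment conditions on the normalized derivatives of the criterion function that enter the
expansion; the notation is that of the paper with `l3` and `l4` for the third and fourth
derivatives. -/
structure DerivMomentsBounded (M : ℕ → Experiment.{u, v} s) (σ : Param s) (δ g : ℝ) : Prop where
  a : ∀ i, MomentsBounded M σ g fun n y => ENNReal.ofReal (|(M n).a σ y i| / (M n).d i)
  F : ∀ i j, MomentsBounded M σ g fun n y =>
    ENNReal.ofReal (|(M n).F σ y i j - (M n).expect σ fun y' => (M n).F σ y' i j|
      / √((M n).d i * (M n).d j))
  l3_box : ∀ i j k, MomentsBounded M σ g fun n y =>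
    ENNReal.ofReal ((M n).dstar / ((M n).d i * (M n).d j * (M n).d k)) *
      (M n).supBox σ δ fun θ => (M n).l3 i j k θ y
  l3 : ∀ i j k, MomentsBounded M σ g fun n y =>
    ENNReal.ofReal (|(M n).l3 i j k σ y| / ((M n).d j * (M n).d k))
  l4_box : ∀ i j k m, MomentsBounded M σ g fun n y =>
    ENNReal.ofReal ((M n).dstar ^ 2 / ((M n).d i * (M n).d j * (M n).d k * (M n).d m)) *
      (M n).supBox σ δ fun θ => (M n).l4 i j k m θ y

end BoundedMoments

namespace Experiment

variable {s : ℕ} {M : Experiment.{u, v} s} {σ : Param s} {δ : ℝ}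

/-- The value `x` dominates all the normalized derivatives of the criterion function. -/
structure Dominates (M : Experiment.{u, v} s) (σ : Param s) (δ : ℝ) (y : M.𝒴) (x : ℝ) : Prop where
  one_le : 1 ≤ x
  a_le : ∀ i, |M.a σ y i| ≤ x * M.d i
  F_le : ∀ i j, |M.F σ y i j - M.A σ i j| ≤ x * (√(M.d i) * √(M.d j))
  l3_le : ∀ i j k, ∀ θ ∈ M.box σ δ, |M.l3 i j k θ y| ≤ x * (M.d i * M.d j * M.d k / M.dstar)
  l3_self_le : ∀ i j k, |M.l3 i j k σ y| ≤ x * (M.d j * M.d k)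
  l4_le : ∀ i j k m, ∀ θ ∈ M.box σ δ,
    |M.l4 i j k m θ y| ≤ x * (M.d i * M.d j * M.d k * M.d m / M.dstar ^ 2)

/-- One plus the sum of all the normalized derivatives of the criterion function, a statistic that
dominates each of them. -/
noncomputable def envelope (M : Experiment.{u, v} s) (σ : Param s) (δ : ℝ) (y : M.𝒴) : ℝ≥0∞ :=
  1 + (∑ i, ENNReal.ofReal (|M.a σ y i| / M.d i))
    + (∑ i, ∑ j, ENNReal.ofReal
        (|M.F σ y i j - M.expect σ fun y' => M.F σ y' i j| / √(M.d i * M.d j)))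
    + (∑ i, ∑ j, ∑ k, ENNReal.ofReal (M.dstar / (M.d i * M.d j * M.d k)) *
        M.supBox σ δ fun θ => M.l3 i j k θ y)
    + (∑ i, ∑ j, ∑ k, ENNReal.ofReal (|M.l3 i j k σ y| / (M.d j * M.d k)))
    + ∑ i, ∑ j, ∑ k, ∑ m, ENNReal.ofReal (M.dstar ^ 2 / (M.d i * M.d j * M.d k * M.d m)) *
        M.supBox σ δ fun θ => M.l4 i j k m θ y

lemma one_le_envelope (M : Experiment.{u, v} s) (σ : Param s) (δ : ℝ) (y : M.𝒴) :
    1 ≤ M.envelope σ δ y := by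
  simp only [envelope, add_assoc, le_self_add]

lemma le_of_ofReal_mul_supBox_le {f : Param s → ℝ} {w : ℝ} (hw : 0 < w) {X : ℝ≥0∞} (hX : X ≠ ∞)
    (h : ENNReal.ofReal w⁻¹ * M.supBox σ δ f ≤ X) {θ : Param s} (hθ : θ ∈ M.box σ δ) :
    |f θ| ≤ X.toReal * w := by
  have hle : ENNReal.ofReal (w⁻¹ * |f θ|) ≤ X := by
    rw [ENNReal.ofReal_mul (by positivity)]
    refine le_trans ?_ h
    gcongr
    exact le_iSup₂ (f := fun θ (_ : θ ∈ M.box σ δ) => ENNReal.ofReal |f θ|) θ hθ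
  rwa [ENNReal.ofReal_le_iff_le_toReal hX, inv_mul_le_iff₀ hw, mul_comm] at hle

lemma dominates_envelope (hd : ∀ i, 0 < M.d i) (hdstar : 0 < M.dstar) {y : M.𝒴}
    (h : M.envelope σ δ y ≠ ∞) : M.Dominates σ δ y (M.envelope σ δ y).toReal := by
  have toReal_le {x : ℝ} (hx : ENNReal.ofReal x ≤ M.envelope σ δ y) :
      x ≤ (M.envelope σ δ y).toReal := (ENNReal.ofReal_le_iff_le_toReal h).1 hx
  have le_sum {f : Fin s → ℝ≥0∞} {x : ℝ≥0∞} (i : Fin s) (hx : x ≤ f i) : x ≤ ∑ i, f i :=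
    hx.trans (Finset.single_le_sum (fun _ _ => zero_le) (Finset.mem_univ i))
  refine ⟨?_, fun i => ?_, fun i j => ?_, fun i j k θ hθ => ?_, fun i j k => ?_,
    fun i j k m θ hθ => ?_⟩
  · exact toReal_le (by simpa only [ENNReal.ofReal_one] using M.one_le_envelope σ δ y)
  · rw [← div_le_iff₀ (hd i)]
    refine toReal_le (le_trans ?_ <| le_add_self.trans <| le_self_add.trans <|
      le_self_add.trans <| le_self_add.trans le_self_add)
    exact le_sum i le_rfl
  · rw [← Real.sqrt_mul (hd i).le, ← div_le_iff₀ (Real.sqrt_pos.2 (mul_pos (hd i) (hd j)))]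
    refine toReal_le (le_trans ?_ <| le_add_self.trans <| le_self_add.trans <|
      le_self_add.trans le_self_add)
    exact le_sum i (le_sum j le_rfl)
  · have := hd i; have := hd j; have := hd k
    refine le_of_ofReal_mul_supBox_le (f := fun θ => M.l3 i j k θ y) (by positivity) h ?_ hθ
    rw [inv_div]
    refine le_trans ?_ <| le_add_self.trans <| le_self_add.trans le_self_add
    exact le_sum i (le_sum j (le_sum k le_rfl))
  · rw [← div_le_iff₀ (mul_pos (hd j) (hd k))]
    refine toReal_le (le_trans ?_ <| le_add_self.trans le_self_add)
    exact le_sum i (le_sum j (le_sum k le_rfl))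
  · have := hd i; have := hd j; have := hd k; have := hd m
    refine le_of_ofReal_mul_supBox_le (f := fun θ => M.l4 i j k m θ y) (by positivity) h ?_ hθ
    rw [inv_div]
    refine le_trans ?_ le_add_self
    exact le_sum i (le_sum j (le_sum k (le_sum m le_rfl)))

end Experiment

lemma DerivMomentsBounded.envelope {s : ℕ} {M : ℕ → Experiment.{u, v} s} {σ : Param s}
    {U : Set (Param s)} {δ g : ℝ} (h : DerivMomentsBounded M σ δ g) (hg : 1 ≤ g)
    (hreg : ∀ n, (M n).RegularOn U) (hσ : σ ∈ U) (hbox : ∀ n, (M n).box σ δ ⊆ U) :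
    MeasurableMomentsBounded M σ g fun n => (M n).envelope σ δ := by
  refine ((((MeasurableMomentsBounded.one.add hg ?_).add hg ?_).add hg ?_).add hg ?_).add hg ?_
  · exact .sum hg fun i =>
      ⟨fun n => (((hreg n).measurable_a hσ i).abs.div_const _).ennreal_ofReal, h.a i⟩
  · exact .sum hg fun i => .sum hg fun j =>
      ⟨fun n => ((((hreg n).measurable_F hσ i j).sub_const _).abs.div_const _).ennreal_ofReal,
        h.F i j⟩
  · exact .sum hg fun i => .sum hg fun j => .sum hg fun k =>
      ⟨fun n => (measurable_biSup_ofReal_abs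
          (fun _ hθ => (hreg n).measurable_l3 (hbox n hθ) i j k)
          fun y => (((hreg n).contDiffOn_l3 i j k y).continuousOn).mono (hbox n)).const_mul _,
        h.l3_box i j k⟩
  · exact .sum hg fun i => .sum hg fun j => .sum hg fun k =>
      ⟨fun n => (((hreg n).measurable_l3 hσ i j k).abs.div_const _).ennreal_ofReal, h.l3 i j k⟩
  · exact .sum hg fun i => .sum hg fun j => .sum hg fun k => .sum hg fun m =>
      ⟨fun n => (measurable_biSup_ofReal_abs
          (fun _ hθ => (hreg n).measurable_l4 (hbox n hθ) i j k m)
          fun y => ((hreg n).continuousOn_l4 i j k m y).mono (hbox n)).const_mul _,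
        h.l4_box i j k m⟩

section Tame

variable {s : ℕ} {M : ℕ → Experiment.{u, v} s} {σ : Param s}

/-- The filter of pairs `(n, θ)` with `n → ∞` and `θ` in boxes `S_δ(σ)` whose `δ` tends to `0`
uniformly in `n`: convergence along it is convergence as `δ → 0`, uniformly in large `n`. -/
def shrinkingBoxes (M : ℕ → Experiment.{u, v} s) (σ : Param s) : Filter (ℕ × Param s) :=
  comap Prod.fst atTop ⊓ ⨅ δ ∈ Set.Ioi (0 : ℝ), 𝓟 {p | p.2 ∈ (M p.1).box σ δ}

lemma eventually_shrinkingBoxes (hd : ∀ n i, 0 < (M n).d i) {P : ℕ × Param s → Prop} :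
    (∀ᶠ p in shrinkingBoxes M σ, P p) ↔
      ∃ δ > 0, ∀ᶠ n in atTop, ∀ θ ∈ (M n).box σ δ, P (n, θ) := by
  have hdir : DirectedOn ((fun δ => {p : ℕ × Param s | p.2 ∈ (M p.1).box σ δ}) ⁻¹'o (· ≥ ·))
      (Set.Ioi 0) := fun δ hδ δ' hδ' => ⟨min δ δ', Set.mem_Ioi.2 (lt_min hδ hδ'),
    fun p hp => (M p.1).box_mono (hd p.1) (min_le_left _ _) hp,
    fun p hp => (M p.1).box_mono (hd p.1) (min_le_right _ _) hp⟩
  rw [shrinkingBoxes, ((basis_sets atTop).comap Prod.fst |>.inf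
    (hasBasis_biInf_principal hdir ⟨1, Set.mem_Ioi.2 one_pos⟩)).eventually_iff]
  constructor
  · rintro ⟨⟨t, δ⟩, ⟨ht, hδ⟩, h⟩
    exact ⟨δ, hδ, mem_of_superset ht fun n hn θ hθ => h ⟨hn, hθ⟩⟩
  · rintro ⟨δ, hδ, h⟩
    exact ⟨⟨_, δ⟩, ⟨h, hδ⟩, fun p hp => hp.1 p.2 hp.2⟩

lemma tendsto_fst_shrinkingBoxes (M : ℕ → Experiment.{u, v} s) (σ : Param s) :
    Tendsto Prod.fst (shrinkingBoxes M σ) atTop :=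
  tendsto_comap.mono_left inf_le_left

lemma tendsto_prodMk_shrinkingBoxes (hd : ∀ n i, 0 < (M n).d i) :
    Tendsto (fun n => (n, σ)) atTop (shrinkingBoxes M σ) := fun _ hP => by
  obtain ⟨δ, hδ, h⟩ := (eventually_shrinkingBoxes hd).1 hP
  exact h.mono fun n hn => hn σ ((M n).self_mem_box (hd n) hδ.le)

lemma VanishesUniformly.tendsto_of_abs_le (hd : ∀ n i, 0 < (M n).d i)
    {f e : ℕ → Param s → ℝ} (h : VanishesUniformly M σ e) (hle : ∀ n θ, |f n θ| ≤ e n θ) :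
    Tendsto (fun p : ℕ × Param s => f p.1 p.2) (shrinkingBoxes M σ) (𝓝 0) := by
  refine Metric.tendsto_nhds.2 fun ε hε => (eventually_shrinkingBoxes hd).2 ?_
  obtain ⟨δ, hδ, h⟩ := h (ε / 2) (half_pos hε)
  refine ⟨δ, hδ, Eventually.of_forall fun n θ hθ => ?_⟩
  rw [Real.dist_0_eq_abs]
  linarith [hle n θ, h n θ hθ]

/-- The functions `f n` are bounded at `σ` and continuous at `σ`, both uniformly in large `n`;
neighbourhoods of `σ` are the boxes `S_δ(σ)`. -/
structure Tame (M : ℕ → Experiment.{u, v} s) (σ : Param s) (f : ℕ → Param s → ℝ) : Prop where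
  bounded : (fun n => f n σ) =O[atTop] fun _ => (1 : ℝ)
  tendsto : Tendsto (fun p : ℕ × Param s => f p.1 p.2 - f p.1 σ) (shrinkingBoxes M σ) (𝓝 0)

namespace Tame

variable {f f' : ℕ → Param s → ℝ}

lemma const {w : ℕ → ℝ} (hw : w =O[atTop] fun _ => (1 : ℝ)) : Tame M σ fun n _ => w n :=
  ⟨hw, by simp only [sub_self, tendsto_const_nhds]⟩

lemma of_abs_le {w : ℕ → ℝ} {K : ℝ} (hw : ∀ n, |w n| ≤ K) : Tame M σ fun n _ => w n :=
  .const (isBigO_of_le' (c := K) _ fun n => by simpa using hw n)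

lemma isBigO_center (hf : Tame M σ f) :
    (fun p : ℕ × Param s => f p.1 σ) =O[shrinkingBoxes M σ] fun _ => (1 : ℝ) :=
  hf.bounded.comp_tendsto (tendsto_fst_shrinkingBoxes M σ)

lemma add (hf : Tame M σ f) (hf' : Tame M σ f') : Tame M σ fun n θ => f n θ + f' n θ :=
  ⟨hf.bounded.add hf'.bounded, by
    simpa only [add_sub_add_comm, add_zero] using hf.tendsto.add hf'.tendsto⟩

lemma mul (hf : Tame M σ f) (hf' : Tame M σ f') : Tame M σ fun n θ => f n θ * f' n θ := by
  refine ⟨by simpa only [mul_one] using hf.bounded.mul hf'.bounded, ?_⟩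
  have hr := (isLittleO_one_iff ℝ).2 hf.tendsto
  have hr' := (isLittleO_one_iff ℝ).2 hf'.tendsto
  have hsum := ((hr.mul hr').add (hr.mul_isBigO hf'.isBigO_center)).add
    (hf.isBigO_center.mul_isLittleO hr')
  simp only [mul_one] at hsum
  exact ((isLittleO_one_iff ℝ).1 hsum).congr fun p => by ring

lemma const_mul (c : ℝ) (hf : Tame M σ f) : Tame M σ fun n θ => c * f n θ :=
  (of_abs_le (w := fun _ => c) fun _ => le_rfl).mul hf

lemma sum {ι : Type*} [Fintype ι] {f : ι → ℕ → Param s → ℝ} (hf : ∀ i, Tame M σ (f i)) :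
    Tame M σ fun n θ => ∑ i, f i n θ := by
  refine ⟨.fun_sum fun i _ => (hf i).bounded, ?_⟩
  simpa only [← Finset.sum_sub_distrib, Finset.sum_const_zero] using
    tendsto_finsetSum Finset.univ fun i _ => (hf i).tendsto

lemma congr' (hd : ∀ n i, 0 < (M n).d i) (hf' : Tame M σ f')
    (h : ∀ᶠ p in shrinkingBoxes M σ, f p.1 p.2 = f' p.1 p.2) : Tame M σ f := by
  have hσ : ∀ᶠ n in atTop, f n σ = f' n σ := (tendsto_prodMk_shrinkingBoxes hd).eventually h
  refine ⟨hf'.bounded.congr' (hσ.mono fun _ => Eq.symm) .rfl, hf'.tendsto.congr' ?_⟩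
  filter_upwards [h, (tendsto_fst_shrinkingBoxes M σ).eventually hσ] with p hp hpσ
  rw [hp, hpσ]

end Tame

section Inverse

variable {ι : Type*} [Fintype ι] {W : ℕ → Param s → Matrix ι ι ℝ} {m : ℝ}

lemma eventually_isNegDefBy_half
    (hW : ∀ i j, Tendsto (fun p : ℕ × Param s => W p.1 p.2 i j - W p.1 σ i j)
      (shrinkingBoxes M σ) (𝓝 0))
    (hm : 0 < m) (hneg : ∀ᶠ n in atTop, IsNegDefBy m (W n σ)) :
    ∀ᶠ p in shrinkingBoxes M σ, IsNegDefBy (m / 2) (W p.1 p.2) := by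
  obtain ⟨ε, hε, hcard⟩ : ∃ ε > 0, Fintype.card ι * ε ≤ m / 2 := by
    refine ⟨m / 2 / (Fintype.card ι + 1), by positivity, ?_⟩
    rw [mul_div_assoc', div_le_iff₀ (by positivity)]
    nlinarith
  have hclose : ∀ᶠ p in shrinkingBoxes M σ, ∀ i j, |W p.1 p.2 i j - W p.1 σ i j| ≤ ε :=
    eventually_all.2 fun i => eventually_all.2 fun j =>
      ((hW i j).abs.eventually_le_const (by rwa [abs_zero]))
  filter_upwards [hclose, (tendsto_fst_shrinkingBoxes M σ).eventually hneg] with p hp hpσ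
  exact hpσ.of_close hp hε.le hcard

lemma tame_inv [DecidableEq ι] (hd : ∀ n i, 0 < (M n).d i)
    (hW : ∀ i j, Tendsto (fun p : ℕ × Param s => W p.1 p.2 i j - W p.1 σ i j)
      (shrinkingBoxes M σ) (𝓝 0))
    (hm : 0 < m) (hneg : ∀ᶠ n in atTop, IsNegDefBy m (W n σ)) (i j : ι) :
    Tame M σ fun n θ => (W n θ)⁻¹ i j := by
  have hhalf := eventually_isNegDefBy_half hW hm hneg
  have hm2 := half_pos hm
  have hinv (i j : ι) : (fun p : ℕ × Param s => (W p.1 p.2)⁻¹ i j) =O[shrinkingBoxes M σ]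
      fun _ => (1 : ℝ) :=
    .of_bound (1 / (m / 2)) (hhalf.mono fun p hp => by simpa using hp.abs_inv_apply_le hm2 i j)
  have hinvσ (i j : ι) : (fun n => (W n σ)⁻¹ i j) =O[atTop] fun _ => (1 : ℝ) :=
    (hinv i j).comp_tendsto (tendsto_prodMk_shrinkingBoxes hd)
  refine ⟨hinvσ i j, ?_⟩
  have hlim : (fun p : ℕ × Param s => -∑ l, ∑ k, (W p.1 p.2)⁻¹ i k *
      (W p.1 p.2 k l - W p.1 σ k l) * (W p.1 σ)⁻¹ l j) =o[shrinkingBoxes M σ]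
      fun _ => (1 : ℝ) := by
    refine (IsLittleO.fun_sum fun l _ => .fun_sum fun k _ => ?_).neg_left
    simpa only [mul_one, Function.comp_def] using
      ((hinv i k).mul_isLittleO ((isLittleO_one_iff ℝ).2 (hW k l))).mul_isBigO
        ((hinvσ l j).comp_tendsto (tendsto_fst_shrinkingBoxes M σ))
  refine ((isLittleO_one_iff ℝ).1 hlim).congr' ?_
  filter_upwards [hhalf, (tendsto_fst_shrinkingBoxes M σ).eventually hneg] with p hp hpσ
  have hres : (W p.1 p.2)⁻¹ - (W p.1 σ)⁻¹ =
      -((W p.1 p.2)⁻¹ * (W p.1 p.2 - W p.1 σ) * (W p.1 σ)⁻¹) := by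
    rw [Matrix.mul_sub, Matrix.sub_mul, Matrix.nonsing_inv_mul _ (hp.isUnit_det hm2),
      Matrix.one_mul, Matrix.mul_assoc, Matrix.mul_nonsing_inv _ (hpσ.isUnit_det hm),
      Matrix.mul_one, neg_sub]
  rw [← Matrix.sub_apply, hres]
  simp only [Matrix.neg_apply, Matrix.mul_apply, Matrix.sub_apply, Finset.sum_mul]

end Inverse

end Tame

/-- The terms of second order in the expansion of a map at a zero, for the deviation `G` of
its derivative from the leading part, and its second derivative `T`. -/
noncomputable def secondOrder {ι : Type*} [Fintype ι] (G : Matrix ι ι ℝ) (T : ι → ι → ι → ℝ)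
    (h : ι → ℝ) : ι → ℝ :=
  fun i => (∑ j, G i j * h j) + 1 / 2 * ∑ j, ∑ k, T i j k * h j * h k

namespace Experiment

section Normalization

variable {s : ℕ} {M : Experiment.{u, v} s} {θ : Param s}

/-- The normalized score `D⁻¹ a`. -/
noncomputable def nscore (M : Experiment.{u, v} s) (θ : Param s) (y : M.𝒴) :
    Fin s → ℝ := fun i => M.lam1 i θ y

/-- The normalized centred Hessian `D⁻¹ (F - A) D⁻¹`. -/
noncomputable def nhess (M : Experiment.{u, v} s) (θ : Param s) (y : M.𝒴) :
    Matrix (Fin s) (Fin s) ℝ :=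
  Matrix.of fun i j => (M.F θ y i j - M.A θ i j) / (M.d i * M.d j)

/-- The third derivatives of `l`, normalized by `dᵢ dⱼ dₖ`. -/
noncomputable def nthird (M : Experiment.{u, v} s) (θ : Param s) (y : M.𝒴) (i j k : Fin s) : ℝ :=
  M.l3 i j k θ y / (M.d i * M.d j * M.d k)

/-- The normalized scoring step `-D A⁻¹ a = -Q⁻¹ D⁻¹ a`, the first approximation
of `D (σ̂ - θ)`. -/
noncomputable def step (M : Experiment.{u, v} s) (θ : Param s) (y : M.𝒴) : Fin s → ℝ :=
  -((M.Q θ)⁻¹ *ᵥ M.nscore θ y)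

lemma inv_A_mulVec_apply (hd : ∀ i, 0 < M.d i) (w : Fin s → ℝ) (p : Fin s) :
    ((M.A θ)⁻¹ *ᵥ w) p = ((M.Q θ)⁻¹ *ᵥ fun i => w i / M.d i) p / M.d p := by
  simp only [Matrix.mulVec, dotProduct, inv_A_apply hd, Finset.sum_div]
  exact Finset.sum_congr rfl fun i _ => by ring

lemma dotProduct_inv_A_mulVec (hd : ∀ i, 0 < M.d i) (b w : Fin s → ℝ) :
    b ⬝ᵥ ((M.A θ)⁻¹ *ᵥ w) = ∑ p, b p / M.d p * ((M.Q θ)⁻¹ *ᵥ fun i => w i / M.d i) p := by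
  simp only [dotProduct, inv_A_mulVec_apply hd]
  exact Finset.sum_congr rfl fun p _ => by ring

lemma inv_A_mulVec_a (hd : ∀ i, 0 < M.d i) (y : M.𝒴) :
    (M.A θ)⁻¹ *ᵥ M.a θ y = fun p => -(M.step θ y p / M.d p) := by
  funext p
  rw [inv_A_mulVec_apply hd, step, Pi.neg_apply, neg_div, neg_neg]
  rfl

lemma a_vecMul_inv_A (hA : (M.A θ).IsSymm) (y : M.𝒴) :
    M.a θ y ᵥ* (M.A θ)⁻¹ = (M.A θ)⁻¹ *ᵥ M.a θ y := by
  rw [← Matrix.mulVec_transpose, Matrix.transpose_nonsing_inv, hA.eq]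

lemma F_mulVec_inv_A_mulVec_a (hd : ∀ i, 0 < M.d i) (hA : IsUnit (M.A θ).det) (y : M.𝒴)
    (i : Fin s) :
    (M.F θ y *ᵥ ((M.A θ)⁻¹ *ᵥ M.a θ y)) i =
      M.d i * (M.nscore θ y i - ∑ j, M.nhess θ y i j * M.step θ y j) := by
  have hcancel : M.A θ *ᵥ ((M.A θ)⁻¹ *ᵥ M.a θ y) = M.a θ y := by
    rw [Matrix.mulVec_mulVec, Matrix.mul_nonsing_inv _ hA, Matrix.one_mulVec]
  have hcentred : ((M.F θ y - M.A θ) *ᵥ ((M.A θ)⁻¹ *ᵥ M.a θ y)) i =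
      -(M.d i * ∑ j, M.nhess θ y i j * M.step θ y j) := by
    rw [inv_A_mulVec_a hd]
    simp only [Matrix.mulVec, dotProduct, nhess, Matrix.of_apply, Matrix.sub_apply,
      Finset.mul_sum, ← Finset.sum_neg_distrib]
    refine Finset.sum_congr rfl fun j _ => ?_
    have := (hd i).ne'
    have := (hd j).ne'
    field_simp
  have hscore : M.a θ y i = M.d i * M.nscore θ y i := (mul_div_cancel₀ _ (hd i).ne').symm
  rw [← add_sub_cancel (M.A θ) (M.F θ y), Matrix.add_mulVec, Pi.add_apply, hcancel, hcentred,
    hscore]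
  ring

lemma C_mulVec_inv_A_mulVec_a (hd : ∀ i, 0 < M.d i) (hA : (M.A θ).IsSymm) (y : M.𝒴) (i : Fin s) :
    (M.C θ y *ᵥ ((M.A θ)⁻¹ *ᵥ M.a θ y)) i =
      M.d i * ∑ j, ∑ k, M.nthird θ y i j k * M.step θ y j * M.step θ y k := by
  have hC : (M.C θ y *ᵥ ((M.A θ)⁻¹ *ᵥ M.a θ y)) i =
      ((M.A θ)⁻¹ *ᵥ M.a θ y) ᵥ* M.H i θ y ⬝ᵥ ((M.A θ)⁻¹ *ᵥ M.a θ y) := by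
    rw [← a_vecMul_inv_A hA]
    rfl
  rw [hC, inv_A_mulVec_a hd]
  simp only [Matrix.vecMul, dotProduct, Finset.sum_mul, Finset.mul_sum,
    H, Matrix.of_apply, nthird]
  rw [Finset.sum_comm]
  refine Finset.sum_congr rfl fun j _ => Finset.sum_congr rfl fun k _ => ?_
  have := (hd i).ne'
  have := (hd j).ne'
  have := (hd k).ne'
  field_simp

lemma a_dotProduct_inv_A_mulVec_a (hd : ∀ i, 0 < M.d i) (hA : (M.A θ).IsSymm)
    (B : Matrix (Fin s) (Fin s) ℝ) (y : M.𝒴) :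
    M.a θ y ⬝ᵥ (((M.A θ)⁻¹ * B * (M.A θ)⁻¹) *ᵥ M.a θ y) =
      ∑ p, ∑ q, B p q / (M.d p * M.d q) * M.step θ y p * M.step θ y q := by
  rw [← Matrix.mulVec_mulVec, ← Matrix.mulVec_mulVec, Matrix.dotProduct_mulVec, a_vecMul_inv_A hA,
    inv_A_mulVec_a hd]
  simp only [Matrix.mulVec, dotProduct, Finset.mul_sum]
  refine Finset.sum_congr rfl fun p _ => Finset.sum_congr rfl fun q _ => ?_
  have := (hd p).ne'
  have := (hd q).ne'
  field_simp

/-- The terms of the expansion of `η (σ̂) - η (σ)` up to second order. -/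
noncomputable def leading (M : Experiment.{u, v} s) (η : Param s → ℝ) (θ : Param s) (y : M.𝒴) : ℝ :=
  -2 * (gradVec η θ ⬝ᵥ ((M.A θ)⁻¹ *ᵥ M.a θ y)) +
  gradVec η θ ⬝ᵥ ((M.A θ)⁻¹ *ᵥ (M.F θ y *ᵥ ((M.A θ)⁻¹ *ᵥ M.a θ y))) +
  (1 / 2) * (M.a θ y ⬝ᵥ (((M.A θ)⁻¹ * hessMat η θ * (M.A θ)⁻¹) *ᵥ M.a θ y)) +
  -(1 / 2) * (gradVec η θ ⬝ᵥ ((M.A θ)⁻¹ *ᵥ (M.C θ y *ᵥ ((M.A θ)⁻¹ *ᵥ M.a θ y))))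

lemma leading_eq (hd : ∀ i, 0 < M.d i) (hA : IsUnit (M.A θ).det) (hsymm : (M.A θ).IsSymm)
    (η : Param s → ℝ) (y : M.𝒴) :
    M.leading η θ y =
      ∑ p, gradVec η θ p / M.d p *
        (M.step θ y - (M.Q θ)⁻¹ *ᵥ
          secondOrder (M.nhess θ y) (M.nthird θ y) (M.step θ y)) p
      + 1 / 2 * ∑ p, ∑ q, hessMat η θ p q / (M.d p * M.d q) * M.step θ y p * M.step θ y q := by
  set c : Fin s → ℝ := fun p => gradVec η θ p / M.d p
  have hlin (w : Fin s → ℝ) :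
      gradVec η θ ⬝ᵥ ((M.A θ)⁻¹ *ᵥ w) = c ⬝ᵥ ((M.Q θ)⁻¹ *ᵥ fun i => w i / M.d i) :=
    dotProduct_inv_A_mulVec hd _ w
  have hF : (fun i => (M.F θ y *ᵥ ((M.A θ)⁻¹ *ᵥ M.a θ y)) i / M.d i) =
      M.nscore θ y - M.nhess θ y *ᵥ M.step θ y := by
    funext i
    rw [F_mulVec_inv_A_mulVec_a hd hA, mul_div_cancel_left₀ _ (hd i).ne']
    rfl
  have hC : (fun i => (M.C θ y *ᵥ ((M.A θ)⁻¹ *ᵥ M.a θ y)) i / M.d i) =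
      fun i => ∑ j, ∑ k, M.nthird θ y i j k * M.step θ y j * M.step θ y k := by
    funext i
    rw [C_mulVec_inv_A_mulVec_a hd hsymm, mul_div_cancel_left₀ _ (hd i).ne']
  have hsecond : secondOrder (M.nhess θ y) (M.nthird θ y) (M.step θ y) =
      M.nhess θ y *ᵥ M.step θ y +
        (1 / 2 : ℝ) • fun i => ∑ j, ∑ k, M.nthird θ y i j k * M.step θ y j * M.step θ y k :=
    rfl
  have hstep : c ⬝ᵥ M.step θ y = -(c ⬝ᵥ ((M.Q θ)⁻¹ *ᵥ M.nscore θ y)) := dotProduct_neg _ _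
  have hscore : (fun i => M.a θ y i / M.d i) = M.nscore θ y := rfl
  change _ = c ⬝ᵥ (M.step θ y - (M.Q θ)⁻¹ *ᵥ secondOrder (M.nhess θ y) (M.nthird θ y)
    (M.step θ y)) + _
  rw [leading, a_dotProduct_inv_A_mulVec_a hd hsymm, hlin, hlin, hlin, hF, hC, hsecond,
    Matrix.mulVec_add, Matrix.mulVec_sub, Matrix.mulVec_smul, dotProduct_sub, dotProduct_sub,
    dotProduct_add, dotProduct_smul, smul_eq_mul, hstep, hscore]
  ring

end Normalization

section Mean

variable {s : ℕ} {M : Experiment.{u, v} s} {θ : Param s}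

/-- The expectation at `θ` of a function of the data exists and equals `c`. -/
def HasMean (M : Experiment.{u, v} s) (θ : Param s) (f : M.𝒴 → ℝ) (c : ℝ) : Prop :=
  M.HasExpect θ f ∧ M.expect θ f = c

lemma HasExpect.hasMean {f : M.𝒴 → ℝ} (h : M.HasExpect θ f) : M.HasMean θ f (M.expect θ f) :=
  ⟨h, rfl⟩

namespace HasMean

variable {f f' : M.𝒴 → ℝ} {c c' : ℝ}

lemma const_mul (r : ℝ) (h : M.HasMean θ f c) : M.HasMean θ (fun y => r * f y) (r * c) :=
  ⟨h.1.const_mul r, (integral_const_mul r _).trans (congrArg _ h.2)⟩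

lemma add (h : M.HasMean θ f c) (h' : M.HasMean θ f' c') :
    M.HasMean θ (fun y => f y + f' y) (c + c') :=
  ⟨h.1.add h'.1, (integral_add h.1 h'.1).trans (congrArg₂ _ h.2 h'.2)⟩

lemma const (c : ℝ) : M.HasMean θ (fun _ => c) c :=
  ⟨integrable_const c, by simp only [expect, integral_const, probReal_univ, one_smul]⟩

lemma sub (h : M.HasMean θ f c) (h' : M.HasMean θ f' c') :
    M.HasMean θ (fun y => f y - f' y) (c - c') :=
  ⟨h.1.sub h'.1, (integral_sub h.1 h'.1).trans (congrArg₂ _ h.2 h'.2)⟩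

lemma sum {ι : Type*} [Fintype ι] {f : ι → M.𝒴 → ℝ} {c : ι → ℝ}
    (h : ∀ i, M.HasMean θ (f i) (c i)) : M.HasMean θ (fun y => ∑ i, f i y) (∑ i, c i) :=
  ⟨integrable_finsetSum _ fun i _ => (h i).1,
    (integral_finsetSum _ fun i _ => (h i).1).trans (Finset.sum_congr rfl fun i _ => (h i).2)⟩

lemma dotProduct_mulVec (b : Fin s → ℝ) (B : Matrix (Fin s) (Fin s) ℝ) {w : M.𝒴 → Fin s → ℝ}
    {c : Fin s → ℝ} (h : ∀ i, M.HasMean θ (fun y => w y i) (c i)) :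
    M.HasMean θ (fun y => b ⬝ᵥ (B *ᵥ w y)) (b ⬝ᵥ (B *ᵥ c)) :=
  sum fun p => (sum fun i => (h i).const_mul (B p i)).const_mul (b p)

lemma mul_step {c : Fin s → ℝ} (h : ∀ k, M.HasMean θ (fun y => f y * M.lam1 k θ y) (c k))
    (j : Fin s) : M.HasMean θ (fun y => f y * M.step θ y j) (-((M.Q θ)⁻¹ *ᵥ c) j) := by
  convert (sum fun k => (h k).const_mul ((M.Q θ)⁻¹ j k)).const_mul (-1) using 1
  · funext y
    simp only [step, Pi.neg_apply, Matrix.mulVec, dotProduct, nscore, neg_mul, one_mul, mul_neg,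
      Finset.mul_sum, Finset.sum_neg_distrib, mul_left_comm]
  · rw [neg_one_mul]
    rfl

end HasMean

lemma nhess_apply (hd : ∀ i, 0 < M.d i) (y : M.𝒴) (i j : Fin s) :
    M.nhess θ y i j = (√(M.d i) * √(M.d j))⁻¹ * M.lam2 i j θ y := by
  have hi := Real.mul_self_sqrt (hd i).le
  have hj := Real.mul_self_sqrt (hd j).le
  rw [nhess, Matrix.of_apply, lam2, inv_mul_eq_div, div_div, mul_mul_mul_comm, hi, hj]

variable (hE : M.ExpectationsExist θ)
include hE

lemma ExpectationsExist.hasMean_step_mul_step (p q : Fin s) :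
    M.HasMean θ (fun y => M.step θ y p * M.step θ y q)
      (((M.Q θ)⁻¹ *ᵥ fun l => ((M.Q θ)⁻¹ *ᵥ M.U1 θ l) p) q) := by
  have hstep (l : Fin s) : M.HasMean θ (fun y => M.step θ y p * M.lam1 l θ y)
      (-((M.Q θ)⁻¹ *ᵥ M.U1 θ l) p) := by
    simpa only [mul_comm] using
      HasMean.mul_step (f := M.lam1 l θ) (c := M.U1 θ l) (fun k => (hE.2.2.1 l k).hasMean) p
  convert HasMean.mul_step hstep q using 1
  rw [← Pi.neg_def, Matrix.mulVec_neg, Pi.neg_apply, neg_neg]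

lemma ExpectationsExist.hasMean_lam2_mul_step (i j k : Fin s) :
    M.HasMean θ (fun y => M.lam2 i j θ y * M.step θ y k) (-((M.Q θ)⁻¹ *ᵥ M.U2 θ i j) k) :=
  HasMean.mul_step (fun l => (hE.2.2.2.1 i j l).hasMean) k

lemma ExpectationsExist.hasMean_lam3_mul_step_mul_step (i j k p q : Fin s) :
    M.HasMean θ (fun y => M.lam3 i j k θ y * M.step θ y p * M.step θ y q)
      (((M.Q θ)⁻¹ *ᵥ fun l => ((M.Q θ)⁻¹ *ᵥ M.U3 θ i j l k) p) q) := by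
  have hstep (l : Fin s) : M.HasMean θ (fun y => M.lam3 i j k θ y * M.step θ y p * M.lam1 l θ y)
      (-((M.Q θ)⁻¹ *ᵥ M.U3 θ i j l k) p) := by
    simpa only [mul_right_comm] using HasMean.mul_step
      (f := fun y => M.lam3 i j k θ y * M.lam1 l θ y) (c := M.U3 θ i j l k)
      (fun m => (hE.2.2.2.2 i j l k m).hasMean) p
  convert HasMean.mul_step hstep q using 1
  rw [← Pi.neg_def, Matrix.mulVec_neg, Pi.neg_apply, neg_neg]

lemma ExpectationsExist.hasMean_F_mulVec (hd : ∀ i, 0 < M.d i) (hA : IsUnit (M.A θ).det)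
    (i : Fin s) :
    M.HasMean θ (fun y => (M.F θ y *ᵥ ((M.A θ)⁻¹ *ᵥ M.a θ y)) i)
      (M.Ea θ i + M.d i * ∑ j, (√(M.d i) * √(M.d j))⁻¹ * ((M.Q θ)⁻¹ *ᵥ M.U2 θ i j) j) := by
  convert (hE.1 i).hasMean.add ((HasMean.sum fun j => (hE.hasMean_lam2_mul_step i j j).const_mul
    (-(√(M.d i) * √(M.d j))⁻¹)).const_mul (M.d i)) using 1
  · funext y
    have hscore : M.a θ y i = M.d i * M.nscore θ y i := (mul_div_cancel₀ _ (hd i).ne').symm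
    simp only [F_mulVec_inv_A_mulVec_a hd hA, nhess_apply hd, neg_mul, Finset.sum_neg_distrib,
      mul_assoc, hscore]
    ring
  · simp only [neg_mul_neg]
    rfl

lemma ExpectationsExist.hasMean_C_mulVec (hd : ∀ i, 0 < M.d i) (hA : (M.A θ).IsSymm) (i : Fin s) :
    M.HasMean θ (fun y => (M.C θ y *ᵥ ((M.A θ)⁻¹ *ᵥ M.a θ y)) i)
      (∑ j, ∑ k, ((M.Q θ)⁻¹ *ᵥ fun l => ((M.Q θ)⁻¹ *ᵥ M.U3 θ i j l k) j) k) := by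
  convert HasMean.sum fun j => HasMean.sum fun k => hE.hasMean_lam3_mul_step_mul_step i j k j k
    using 1
  funext y
  simp only [C_mulVec_inv_A_mulVec_a hd hA, Finset.mul_sum]
  refine Finset.sum_congr rfl fun j _ => Finset.sum_congr rfl fun k _ => ?_
  have := (hd i).ne'
  simp only [nthird, lam3, H, Matrix.of_apply]
  field_simp

lemma ExpectationsExist.hasMean_a_dotProduct (hd : ∀ i, 0 < M.d i) (hA : (M.A θ).IsSymm)
    (B : Matrix (Fin s) (Fin s) ℝ) :
    M.HasMean θ (fun y => M.a θ y ⬝ᵥ (((M.A θ)⁻¹ * B * (M.A θ)⁻¹) *ᵥ M.a θ y))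
      (∑ p, ∑ q, B p q / (M.d p * M.d q) *
        ((M.Q θ)⁻¹ *ᵥ fun l => ((M.Q θ)⁻¹ *ᵥ M.U1 θ l) p) q) := by
  convert HasMean.sum fun p => HasMean.sum fun q =>
    (hE.hasMean_step_mul_step p q).const_mul (B p q / (M.d p * M.d q)) using 1
  funext y
  rw [a_dotProduct_inv_A_mulVec_a hd hA]
  simp only [mul_assoc]

/-- The sum `∑ Δⱼ` of the correction terms. -/
noncomputable def bias (M : Experiment.{u, v} s) (η : Param s → ℝ) (θ : Param s) : ℝ :=
  M.Delta0 η θ + M.Delta1 η θ + M.Delta2 η θ + M.Delta3 η θ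

lemma ExpectationsExist.hasMean_leading (hd : ∀ i, 0 < M.d i) (hA : IsUnit (M.A θ).det)
    (hsymm : (M.A θ).IsSymm) (η : Param s → ℝ) : M.HasMean θ (M.leading η θ) (M.bias η θ) :=
  have h₀ := HasMean.dotProduct_mulVec (gradVec η θ) (M.A θ)⁻¹ fun i => (hE.1 i).hasMean
  have h₁ := HasMean.dotProduct_mulVec (gradVec η θ) (M.A θ)⁻¹
    fun i => (hE.hasMean_F_mulVec hd hA i).1.hasMean
  have h₂ := (hE.hasMean_a_dotProduct hd hsymm (hessMat η θ)).1.hasMean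
  have h₃ := HasMean.dotProduct_mulVec (gradVec η θ) (M.A θ)⁻¹
    fun i => (hE.hasMean_C_mulVec hd hsymm i).1.hasMean
  (((h₀.const_mul (-2)).add h₁).add (h₂.const_mul (1 / 2))).add (h₃.const_mul (-(1 / 2)))

end Mean

end Experiment

section TameBias

variable {s : ℕ} {M : ℕ → Experiment.{u, v} s} {σ : Param s}

/-- The moments that enter the correction terms `Δⱼ` are defined and continuous near `σ`, uniformly
in large `n`. -/
structure TameMoments (M : ℕ → Experiment.{u, v} s) (σ : Param s) : Prop where
  isUnit_det_A : ∀ᶠ p in shrinkingBoxes M σ, IsUnit ((M p.1).A p.2).det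
  isSymm_A : ∀ᶠ p in shrinkingBoxes M σ, ((M p.1).A p.2).IsSymm
  expectationsExist : ∀ᶠ p in shrinkingBoxes M σ, (M p.1).ExpectationsExist p.2
  inv_Q : ∀ i j, Tame M σ fun n θ => ((M n).Q θ)⁻¹ i j
  Ea : ∀ i, Tame M σ fun n θ => (M n).Ea θ i
  U1 : ∀ i l, Tame M σ fun n θ => (M n).U1 θ i l
  U2 : ∀ j k l, Tame M σ fun n θ => (M n).U2 θ j k l
  U3 : ∀ j k l m q, Tame M σ fun n θ => (M n).U3 θ j k l m q

lemma tame_dstar_div (hd : ∀ n i, 0 < (M n).d i) (i : Fin s) :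
    Tame M σ fun n _ => (M n).dstar / (M n).d i :=
  .of_abs_le (K := 1) fun n => by
    rw [abs_of_nonneg (div_nonneg (dstar_nonneg (hd n)) (hd n i).le)]
    exact div_le_one_of_le₀ ((M n).dstar_le i) (hd n i).le

lemma tame_dstar_mul_inv_sqrt (hd : ∀ n i, 0 < (M n).d i) (i j : Fin s) :
    Tame M σ fun n _ => (M n).dstar * (√((M n).d i) * √((M n).d j))⁻¹ :=
  .of_abs_le (K := 1) fun n => by
    have hd0 := dstar_nonneg (hd n)
    rw [abs_of_nonneg (by positivity), ← div_eq_mul_inv]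
    refine div_le_one_of_le₀ ?_ (by positivity)
    calc (M n).dstar = √(M n).dstar * √(M n).dstar := (Real.mul_self_sqrt hd0).symm
      _ ≤ √((M n).d i) * √((M n).d j) := by gcongr <;> exact (M n).dstar_le _

lemma Tame.mulVec {ι κ : Type*} [Fintype κ] {W : ℕ → Param s → Matrix ι κ ℝ}
    {w : ℕ → Param s → κ → ℝ} (hW : ∀ i j, Tame M σ fun n θ => W n θ i j)
    (hw : ∀ j, Tame M σ fun n θ => w n θ j) (i : ι) : Tame M σ fun n θ => (W n θ *ᵥ w n θ) i :=
  .sum fun j => (hW i j).mul (hw j)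

variable {b w : ℕ → Param s → Fin s → ℝ}

lemma Tame.dstar_sq_mul_dotProduct_inv_A (hd : ∀ n i, 0 < (M n).d i)
    (hW : ∀ i j, Tame M σ fun n θ => ((M n).Q θ)⁻¹ i j)
    (hb : ∀ i, Tame M σ fun n θ => b n θ i)
    (hw : ∀ i, Tame M σ fun n θ => (M n).dstar * (w n θ i / (M n).d i)) :
    Tame M σ fun n θ => (M n).dstar ^ 2 * (b n θ ⬝ᵥ (((M n).A θ)⁻¹ *ᵥ w n θ)) := by
  have h := Tame.sum fun p => ((hb p).mul (tame_dstar_div hd p)).mul (Tame.mulVec hW hw p)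
  convert h using 3 with n θ
  rw [dotProduct_inv_A_mulVec (hd n), Finset.mul_sum]
  refine Finset.sum_congr rfl fun p _ => ?_
  have hsmul : (fun i => (M n).dstar * (w n θ i / (M n).d i)) =
      (M n).dstar • fun i => w n θ i / (M n).d i := rfl
  rw [hsmul, Matrix.mulVec_smul, Pi.smul_apply, smul_eq_mul]
  ring

namespace TameMoments

variable {η : ℕ → Param s → ℝ}

lemma dstar_sq_mul_Delta0 (h : TameMoments M σ) (hd : ∀ n i, 0 < (M n).d i)
    (hb : ∀ i, Tame M σ fun n θ => gradVec (η n) θ i) :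
    Tame M σ fun n θ => (M n).dstar ^ 2 * (M n).Delta0 (η n) θ := by
  have hEa (i : Fin s) : Tame M σ fun n θ => (M n).dstar * ((M n).Ea θ i / (M n).d i) := by
    simpa only [div_mul_eq_mul_div, mul_div_assoc] using (tame_dstar_div hd i).mul (h.Ea i)
  simpa only [Delta0, mul_left_comm] using
    (Tame.dstar_sq_mul_dotProduct_inv_A hd h.inv_Q hb hEa).const_mul (-2)

lemma dstar_sq_mul_Delta1 (h : TameMoments M σ) (hd : ∀ n i, 0 < (M n).d i)
    (hb : ∀ i, Tame M σ fun n θ => gradVec (η n) θ i) :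
    Tame M σ fun n θ => (M n).dstar ^ 2 * (M n).Delta1 (η n) θ := by
  refine Tame.dstar_sq_mul_dotProduct_inv_A hd h.inv_Q hb fun i => ?_
  have hmean := ((tame_dstar_div hd i).mul (h.Ea i)).add (Tame.sum fun j =>
    (tame_dstar_mul_inv_sqrt hd i j).mul (Tame.mulVec h.inv_Q (h.U2 i j) j))
  refine hmean.congr' hd ?_
  filter_upwards [h.isUnit_det_A, h.expectationsExist] with p hA hE
  have := (hd p.1 i).ne'
  rw [(hE.hasMean_F_mulVec (hd p.1) hA i).2, add_div, mul_div_cancel_left₀ _ this, mul_add,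
    Finset.mul_sum]
  simp only [mul_assoc, div_mul_eq_mul_div, mul_div_assoc]

lemma dstar_sq_mul_Delta2 (h : TameMoments M σ) (hd : ∀ n i, 0 < (M n).d i)
    (hB : ∀ i j, Tame M σ fun n θ => hessMat (η n) θ i j) :
    Tame M σ fun n θ => (M n).dstar ^ 2 * (M n).Delta2 (η n) θ := by
  have hmean := (Tame.sum fun p => Tame.sum fun q =>
    (((tame_dstar_div hd p).mul (tame_dstar_div hd q)).mul (hB p q)).mul
      (Tame.mulVec h.inv_Q (fun l => Tame.mulVec h.inv_Q (h.U1 l) p) q)).const_mul (1 / 2)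
  refine hmean.congr' hd ?_
  filter_upwards [h.isSymm_A, h.expectationsExist] with p hA hE
  rw [Delta2, (hE.hasMean_a_dotProduct (hd p.1) hA _).2, mul_left_comm, Finset.mul_sum]
  simp only [Finset.mul_sum]
  exact Finset.sum_congr rfl fun k _ => Finset.sum_congr rfl fun l _ => by ring

lemma dstar_sq_mul_Delta3 (h : TameMoments M σ) (hd : ∀ n i, 0 < (M n).d i)
    (hb : ∀ i, Tame M σ fun n θ => gradVec (η n) θ i) :
    Tame M σ fun n θ => (M n).dstar ^ 2 * (M n).Delta3 (η n) θ := by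
  have hmean (i : Fin s) : Tame M σ fun n θ => (M n).dstar *
      ((M n).expect θ (fun y => ((M n).C θ y *ᵥ (((M n).A θ)⁻¹ *ᵥ (M n).a θ y)) i) /
        (M n).d i) := by
    refine ((tame_dstar_div hd i).mul (Tame.sum fun j => Tame.sum fun k =>
      Tame.mulVec h.inv_Q (fun l => Tame.mulVec h.inv_Q (h.U3 i j l k) j) k)).congr' hd ?_
    filter_upwards [h.isSymm_A, h.expectationsExist] with p hA hE
    rw [(hE.hasMean_C_mulVec (hd p.1) hA i).2, div_mul_eq_mul_div, mul_div_assoc]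
  simpa only [Delta3, mul_left_comm] using
    (Tame.dstar_sq_mul_dotProduct_inv_A hd h.inv_Q hb hmean).const_mul (-(1 / 2))

lemma dstar_sq_mul_bias (h : TameMoments M σ) (hd : ∀ n i, 0 < (M n).d i)
    (hb : ∀ i, Tame M σ fun n θ => gradVec (η n) θ i)
    (hB : ∀ i j, Tame M σ fun n θ => hessMat (η n) θ i j) :
    Tame M σ fun n θ => (M n).dstar ^ 2 * (M n).bias (η n) θ := by
  simpa only [bias, mul_add] using (((h.dstar_sq_mul_Delta0 hd hb).add
    (h.dstar_sq_mul_Delta1 hd hb)).add (h.dstar_sq_mul_Delta2 hd hB)).add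
    (h.dstar_sq_mul_Delta3 hd hb)

end TameMoments

end TameBias

section BoundedOnBoxes

variable {s : ℕ}

lemma Experiment.abs_sub_le_of_abs_pderiv_le {M : Experiment.{u, v} s} {σ : Param s}
    (hd : ∀ i, 0 < M.d i) {U : Set (Param s)} (hU : IsOpen U) {r K : ℝ} (hr : 0 ≤ r)
    (hbox : M.box σ r ⊆ U) {f : Param s → ℝ} (hf : DifferentiableOn ℝ f U)
    (hK : ∀ i, ∀ θ ∈ M.box σ r, |pderiv i f θ| * M.dstar ≤ K * M.d i) {θ : Param s}
    (hθ : θ ∈ M.box σ r) : |f θ - f σ| ≤ s * (r * K) := by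
  have hseg (t : ℝ) (ht : t ∈ Set.Icc (0 : ℝ) 1) : σ + t • (θ - σ) ∈ M.box σ r :=
    M.segment_mem_box (M.self_mem_box hd hr) hθ ht
  have hsum (t : ℝ) (ht : t ∈ Set.Icc (0 : ℝ) 1) :
      |∑ i, (θ - σ) i * pderiv i f (σ + t • (θ - σ))| ≤ ∑ _i : Fin s, r * K :=
    (Finset.abs_sum_le_sum_abs _ _).trans <| Finset.sum_le_sum fun i _ => by
      have hdi := hd i
      calc |(θ - σ) i * pderiv i f (σ + t • (θ - σ))|
          ≤ r * M.dstar / M.d i * |pderiv i f (σ + t • (θ - σ))| := by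
            rw [abs_mul]
            exact mul_le_mul_of_nonneg_right (hθ i) (abs_nonneg _)
        _ = r * ((|pderiv i f (σ + t • (θ - σ))| * M.dstar) / M.d i) := by ring
        _ ≤ r * K := by
            gcongr
            exact (div_le_iff₀ hdi).2 (hK i _ (hseg t ht))
  simpa using abs_sub_le_of_abs_sum_pderiv_le hU hf σ (θ - σ) (fun t ht => hbox (hseg t ht)) hsum

variable {M : ℕ → Experiment.{u, v} s} {σ : Param s} {δ : ℝ}

/-- The functions `f n` are bounded on the boxes `S_δ(σ)`, uniformly in `n`. -/
def BoundedOnBoxes (M : ℕ → Experiment.{u, v} s) (σ : Param s) (δ : ℝ)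
    (f : ℕ → Param s → ℝ) : Prop :=
  ∃ K : ℝ, ∀ n, ∀ θ ∈ (M n).box σ δ, |f n θ| ≤ K

lemma BoundedOnBoxes.exists_forall {ι : Type*} [Finite ι] {f : ι → ℕ → Param s → ℝ}
    (h : ∀ i, BoundedOnBoxes M σ δ (f i)) :
    ∃ K : ℝ, ∀ i n, ∀ θ ∈ (M n).box σ δ, |f i n θ| ≤ K := by
  choose K hK using h
  obtain ⟨B, hB⟩ := (Set.finite_range K).bddAbove
  exact ⟨B, fun i n θ hθ => (hK i n θ hθ).trans (hB (Set.mem_range_self i))⟩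

section OfPDeriv

variable {U : Set (Param s)} {f : ℕ → Param s → ℝ}

lemma BoundedOnBoxes.of_pderiv (hd : ∀ n i, 0 < (M n).d i) (hU : IsOpen U) (hδ : 0 ≤ δ)
    (hbox : ∀ n, (M n).box σ δ ⊆ U) (hf : ∀ n, DifferentiableOn ℝ (f n) U)
    (hσ : ∃ L, ∀ n, |f n σ| ≤ L) (h : ∀ i, BoundedOnBoxes M σ δ fun n => pderiv i (f n)) :
    BoundedOnBoxes M σ δ f := by
  obtain ⟨L, hL⟩ := hσ
  obtain ⟨K, hK⟩ := BoundedOnBoxes.exists_forall h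
  refine ⟨L + s * (δ * K), fun n θ hθ => ?_⟩
  have := abs_sub_le_of_abs_pderiv_le (hd n) hU hδ (hbox n) (hf n)
    (fun i θ hθ => abs_mul_dstar_le (hd n) (hK i n θ hθ) i) hθ
  linarith [hL n, abs_sub_abs_le_abs_sub (f n θ) (f n σ)]

lemma Tame.of_pderiv (hd : ∀ n i, 0 < (M n).d i) (hU : IsOpen U) (hδ : 0 < δ)
    (hbox : ∀ n, (M n).box σ δ ⊆ U) (hf : ∀ n, DifferentiableOn ℝ (f n) U)
    (hσ : ∃ L, ∀ n, |f n σ| ≤ L) (h : ∀ i, BoundedOnBoxes M σ δ fun n => pderiv i (f n)) :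
    Tame M σ f := by
  obtain ⟨L, hL⟩ := hσ
  obtain ⟨K, hK⟩ := BoundedOnBoxes.exists_forall h
  refine ⟨isBigO_of_le' (c := L) _ fun n => by simpa using hL n,
    Metric.tendsto_nhds.2 fun ε hε => (eventually_shrinkingBoxes hd).2 ?_⟩
  have hsmall : ∀ᶠ r in 𝓝[>] (0 : ℝ), s * (r * K) < ε := by
    have hlim : Tendsto (fun r : ℝ => s * (r * K)) (𝓝 0) (𝓝 0) :=
      Continuous.tendsto' (by fun_prop) _ _ (by ring)
    exact (hlim.mono_left nhdsWithin_le_nhds).eventually_lt_const hε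
  obtain ⟨r, hr, hrpos, hrδ⟩ := (hsmall.and (Ioo_mem_nhdsGT hδ)).exists
  refine ⟨r, hrpos, Eventually.of_forall fun n θ hθ => ?_⟩
  have hsub := (M n).box_mono (σ := σ) (hd n) hrδ.le
  rw [Real.dist_0_eq_abs]
  exact (abs_sub_le_of_abs_pderiv_le (hd n) hU hrpos.le (hsub.trans (hbox n)) (hf n)
    (fun i τ hτ => abs_mul_dstar_le (hd n) (hK i n τ (hsub hτ)) i) hθ).trans_lt hr

end OfPDeriv

/-- On the box `S_δ(σ)`, the function `η` and its partial derivatives up to order three are bounded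
by `K`. -/
structure Experiment.SmoothBound (M : Experiment.{u, v} s) (σ : Param s) (δ : ℝ) (η : Param s → ℝ)
    (K : ℝ) : Prop where
  zero_le : ∀ θ ∈ M.box σ δ, |η θ| ≤ K
  one_le : ∀ i, ∀ θ ∈ M.box σ δ, |pderiv i η θ| ≤ K
  two_le : ∀ i j, ∀ θ ∈ M.box σ δ, |pderiv i (pderiv j η) θ| ≤ K
  three_le : ∀ i j k, ∀ θ ∈ M.box σ δ, |pderiv i (pderiv j (pderiv k η)) θ| ≤ K

section Eta

variable {U : Set (Param s)} {η : ℕ → Param s → ℝ}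

lemma exists_smoothBound (hd : ∀ n i, 0 < (M n).d i) (hU : IsOpen U) (hδ : 0 ≤ δ)
    (hbox : ∀ n, (M n).box σ δ ⊆ U) (hη : ∀ n, ContDiffOn ℝ 3 (η n) U)
    (hη0 : ∃ K : ℝ, ∀ n, |η n σ| ≤ K)
    (hη1 : ∃ K : ℝ, ∀ n, vecNorm (gradVec (η n) σ) ≤ K)
    (hη2 : ∃ K : ℝ, ∀ n, specNorm (hessMat (η n) σ) ≤ K)
    (hη3 : ∀ i j k, BoundedOnBoxes M σ δ fun n => pderiv i (pderiv j (pderiv k (η n)))) :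
    ∃ K, ∀ n, (M n).SmoothBound σ δ (η n) K := by
  have h1diff (n : ℕ) (i : Fin s) : ContDiffOn ℝ 2 (pderiv i (η n)) U :=
    contDiffOn_pderiv hU (hη n) (by norm_num) i
  have h2diff (n : ℕ) (i j : Fin s) : ContDiffOn ℝ 1 (pderiv i (pderiv j (η n))) U :=
    contDiffOn_pderiv hU (h1diff n j) (by norm_num) i
  have hη2' (i j : Fin s) : BoundedOnBoxes M σ δ fun n => pderiv i (pderiv j (η n)) :=
    .of_pderiv hd hU hδ hbox (fun n => (h2diff n i j).differentiableOn (by norm_num))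
      (hη2.imp fun K hK n => (abs_apply_le_specNorm (hessMat (η n) σ) i j).trans (hK n))
      fun k => hη3 k i j
  have hη1' (i : Fin s) : BoundedOnBoxes M σ δ fun n => pderiv i (η n) :=
    .of_pderiv hd hU hδ hbox (fun n => (h1diff n i).differentiableOn (by norm_num))
      (hη1.imp fun K hK n => (abs_apply_le_vecNorm (gradVec (η n) σ) i).trans (hK n))
      fun j => hη2' j i
  obtain ⟨K₀, h0⟩ : BoundedOnBoxes M σ δ η :=
    .of_pderiv hd hU hδ hbox (fun n => (hη n).differentiableOn (by norm_num)) hη0 hη1'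
  obtain ⟨K₁, h1⟩ := BoundedOnBoxes.exists_forall hη1'
  obtain ⟨K₂, h2⟩ := BoundedOnBoxes.exists_forall fun p : Fin s × Fin s => hη2' p.1 p.2
  obtain ⟨K₃, h3⟩ := BoundedOnBoxes.exists_forall
    fun p : Fin s × Fin s × Fin s => hη3 p.1 p.2.1 p.2.2
  refine ⟨max (max K₀ K₁) (max K₂ K₃), fun n => ⟨fun θ hθ => ?_, fun i θ hθ => ?_,
    fun i j θ hθ => ?_, fun i j k θ hθ => ?_⟩⟩
  · exact (h0 n θ hθ).trans (by simp)
  · exact (h1 i n θ hθ).trans (by simp)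
  · exact (h2 (i, j) n θ hθ).trans (by simp)
  · exact (h3 (i, j, k) n θ hθ).trans (by simp)

variable {K : ℝ}

lemma tame_grad (h : ∀ n, (M n).SmoothBound σ δ (η n) K) (hd : ∀ n i, 0 < (M n).d i) (hU : IsOpen U)
    (hδ : 0 < δ) (hbox : ∀ n, (M n).box σ δ ⊆ U) (hη : ∀ n, ContDiffOn ℝ 3 (η n) U)
    (i : Fin s) : Tame M σ fun n θ => gradVec (η n) θ i :=
  .of_pderiv hd hU hδ hbox
    (fun n => (contDiffOn_pderiv (m := 2) hU (hη n) (by norm_num) i).differentiableOn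
      (by norm_num))
    ⟨K, fun n => (h n).one_le i σ ((M n).self_mem_box (hd n) hδ.le)⟩
    fun j => ⟨K, fun n => (h n).two_le j i⟩

lemma tame_hess (h : ∀ n, (M n).SmoothBound σ δ (η n) K) (hd : ∀ n i, 0 < (M n).d i) (hU : IsOpen U)
    (hδ : 0 < δ) (hbox : ∀ n, (M n).box σ δ ⊆ U) (hη : ∀ n, ContDiffOn ℝ 3 (η n) U)
    (i j : Fin s) : Tame M σ fun n θ => hessMat (η n) θ i j :=
  .of_pderiv hd hU hδ hbox
    (fun n => (contDiffOn_pderiv (m := 1) hU (contDiffOn_pderiv (m := 2) hU (hη n) (by norm_num) j)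
      (by norm_num) i).differentiableOn (by norm_num))
    ⟨K, fun n => (h n).two_le i j σ ((M n).self_mem_box (hd n) hδ.le)⟩
    fun k => ⟨K, fun n => (h n).three_le k i j⟩

end Eta

end BoundedOnBoxes

section EnvelopeExpectation

variable {s : ℕ}

namespace Experiment.Dominates

variable {M : Experiment.{u, v} s} {σ : Param s} {δ x : ℝ} {y : M.𝒴}

lemma lam1_le (h : M.Dominates σ δ y x) (hd : ∀ i, 0 < M.d i) (i : Fin s) :
    |M.lam1 i σ y| ≤ x := by
  rw [lam1, abs_div, abs_of_pos (hd i), div_le_iff₀ (hd i)]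
  exact h.a_le i

lemma lam2_le (h : M.Dominates σ δ y x) (hd : ∀ i, 0 < M.d i) (i j : Fin s) :
    |M.lam2 i j σ y| ≤ x := by
  have hpos : 0 < √(M.d i) * √(M.d j) := mul_pos (Real.sqrt_pos.2 (hd i)) (Real.sqrt_pos.2 (hd j))
  rw [lam2, abs_div, abs_of_pos hpos, div_le_iff₀ hpos]
  exact h.F_le i j

lemma lam3_le (h : M.Dominates σ δ y x) (hd : ∀ i, 0 < M.d i) (i j k : Fin s) :
    |M.lam3 i j k σ y| ≤ x := by
  have hpos : 0 < M.d j * M.d k := mul_pos (hd j) (hd k)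
  rw [lam3, abs_div, abs_of_pos hpos, div_le_iff₀ hpos]
  exact h.l3_self_le i j k

end Experiment.Dominates

variable {M : ℕ → Experiment.{u, v} s} {σ : Param s} {δ g : ℝ}

lemma Experiment.isBigO_expect_of_dominates (hd : ∀ n i, 0 < (M n).d i)
    (hdstar : ∀ᶠ n in atTop, 0 < (M n).dstar)
    (hX : MeasurableMomentsBounded M σ g fun n => (M n).envelope σ δ) {p : ℕ} (hg : 0 < g)
    (hp : p ≤ g) {f : ∀ n, (M n).𝒴 → ℝ}
    (h : ∀ n y x, (M n).Dominates σ δ y x → |f n y| ≤ x ^ p) :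
    (fun n => (M n).expect σ (f n)) =O[atTop] fun _ => (1 : ℝ) := by
  obtain ⟨K, hK⟩ := hX.2
  refine .of_bound K ?_
  filter_upwards [hdstar] with n hn
  have hle (y : (M n).𝒴) : ‖f n y‖ₑ ≤ (M n).envelope σ δ y ^ g := by
    by_cases htop : (M n).envelope σ δ y = ∞
    · rw [htop, ENNReal.top_rpow_of_pos hg]
      exact le_top
    have hdom := dominates_envelope (hd n) hn htop
    have hpow := h n y _ hdom
    rw [← Real.rpow_natCast] at hpow
    rw [Real.enorm_eq_ofReal_abs, ← ENNReal.ofReal_toReal htop,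
      ENNReal.ofReal_rpow_of_nonneg ENNReal.toReal_nonneg hg.le]
    exact ENNReal.ofReal_le_ofReal
      (hpow.trans (Real.rpow_le_rpow_of_exponent_le hdom.one_le hp))
  rw [norm_one, mul_one, ← toReal_enorm]
  exact ENNReal.toReal_le_coe_of_le_coe ((enorm_integral_le_lintegral_enorm _).trans
    ((lintegral_mono fun ω => hle _).trans (hK n)))

end EnvelopeExpectation

section TameMoments

variable {s : ℕ} {M : ℕ → Experiment.{u, v} s} {σ : Param s} {U : Set (Param s)} {δ g m : ℝ}

lemma eventually_isNegDefBy_Q (hd : ∀ n i, 0 < (M n).d i) (hsymm : ∀ n, ((M n).A σ).IsSymm)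
    (hlam : limsup (fun n => ((lambdaMax ((M n).Q σ) : ℝ) : EReal)) atTop < 0) :
    ∃ m > 0, ∀ᶠ n in atTop, IsNegDefBy m ((M n).Q σ) := by
  obtain ⟨r, hr, hr0⟩ := EReal.lt_iff_exists_real_btwn.1 hlam
  refine ⟨-r, neg_pos.2 (EReal.coe_lt_coe_iff.1 hr0), ?_⟩
  filter_upwards [eventually_lt_of_limsup_lt hr] with n hn
  refine isNegDefBy_of_lambdaMax_le ((M n).Q_isSymm (hd n) (hsymm n)) ?_
  rw [neg_neg]
  exact (EReal.coe_lt_coe_iff.1 hn).le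

lemma Tame.of_vanishesUniformly (hd : ∀ n i, 0 < (M n).d i) {f e : ℕ → Param s → ℝ}
    (hf : (fun n => f n σ) =O[atTop] fun _ => (1 : ℝ)) (h : VanishesUniformly M σ e)
    (hle : ∀ n θ, |f n θ - f n σ| ≤ e n θ) : Tame M σ f :=
  ⟨hf, h.tendsto_of_abs_le (f := fun n θ => f n θ - f n σ) hd hle⟩

section MomentMatrices

variable (hd : ∀ n i, 0 < (M n).d i) (hdstar : ∀ᶠ n in atTop, 0 < (M n).dstar)
  (hX : MeasurableMomentsBounded M σ g fun n => (M n).envelope σ δ)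
include hd hdstar hX

lemma tame_U1 (hg : 2 ≤ g)
    (hU : VanishesUniformly M σ fun n θ => specNorm ((M n).U1 θ - (M n).U1 σ)) (i l : Fin s) :
    Tame M σ fun n θ => (M n).U1 θ i l := by
  refine .of_vanishesUniformly hd (isBigO_expect_of_dominates (p := 2) hd hdstar hX
    (f := fun n y => (M n).lam1 i σ y * (M n).lam1 l σ y)
    (by linarith) (by exact_mod_cast hg) fun n y x h => ?_) hU
    fun n θ => abs_apply_le_specNorm ((M n).U1 θ - (M n).U1 σ) i l
  have := h.one_le
  rw [abs_mul, sq]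
  gcongr <;> exact h.lam1_le (hd n) _

lemma tame_U2 (hg : 2 ≤ g) (hU : VanishesUniformly M σ fun n θ => ‖(M n).U2 θ - (M n).U2 σ‖)
    (j k l : Fin s) : Tame M σ fun n θ => (M n).U2 θ j k l := by
  refine .of_vanishesUniformly hd (isBigO_expect_of_dominates (p := 2) hd hdstar hX
    (f := fun n y => (M n).lam2 j k σ y * (M n).lam1 l σ y)
    (by linarith) (by exact_mod_cast hg) fun n y x h => ?_) hU
    fun n θ => (norm_le_pi_norm (((M n).U2 θ - (M n).U2 σ) j k) l).trans <|
      (norm_le_pi_norm (((M n).U2 θ - (M n).U2 σ) j) k).trans (norm_le_pi_norm _ j)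
  have := h.one_le
  rw [abs_mul, sq]
  gcongr
  exacts [h.lam2_le (hd n) _ _, h.lam1_le (hd n) _]

lemma tame_U3 (hg : 3 ≤ g) (hU : VanishesUniformly M σ fun n θ => ‖(M n).U3 θ - (M n).U3 σ‖)
    (j k l p q : Fin s) : Tame M σ fun n θ => (M n).U3 θ j k l p q := by
  refine .of_vanishesUniformly hd (isBigO_expect_of_dominates (p := 3) hd hdstar hX
    (f := fun n y => (M n).lam3 j k p σ y * (M n).lam1 l σ y * (M n).lam1 q σ y)
    (by linarith) (by exact_mod_cast hg) fun n y x h => ?_) hU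
    fun n θ => (norm_le_pi_norm (((M n).U3 θ - (M n).U3 σ) j k l p) q).trans <|
      (norm_le_pi_norm (((M n).U3 θ - (M n).U3 σ) j k l) p).trans <|
      (norm_le_pi_norm (((M n).U3 θ - (M n).U3 σ) j k) l).trans <|
      (norm_le_pi_norm (((M n).U3 θ - (M n).U3 σ) j) k).trans (norm_le_pi_norm _ j)
  have := h.one_le
  rw [abs_mul, abs_mul, pow_succ, sq]
  gcongr
  exacts [h.lam3_le (hd n) _ _ _, h.lam1_le (hd n) _, h.lam1_le (hd n) _]

end MomentMatrices

lemma tameMoments (hd : ∀ n i, 0 < (M n).d i) (hdstar : ∀ᶠ n in atTop, 0 < (M n).dstar)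
    (hδ : 0 < δ) (hbox : ∀ n, (M n).box σ δ ⊆ U) (hreg : ∀ n, (M n).RegularOn U)
    (hg : 3 ≤ g) (hX : MeasurableMomentsBounded M σ g fun n => (M n).envelope σ δ)
    (hm : 0 < m) (hneg : ∀ᶠ n in atTop, IsNegDefBy m ((M n).Q σ))
    (hexp : ∀ n, ∀ θ ∈ (M n).box σ δ, (M n).ExpectationsExist θ)
    (hQ : VanishesUniformly M σ fun n θ => specNorm ((M n).Q θ - (M n).Q σ))
    (hU1 : VanishesUniformly M σ fun n θ => specNorm ((M n).U1 θ - (M n).U1 σ))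
    (hU2 : VanishesUniformly M σ fun n θ => ‖(M n).U2 θ - (M n).U2 σ‖)
    (hU3 : VanishesUniformly M σ fun n θ => ‖(M n).U3 θ - (M n).U3 σ‖)
    (hEa : ∃ K : ℝ, ∀ n, vecNorm ((M n).Ea σ) ≤ K)
    (hEa' : VanishesUniformly M σ fun n θ => vecNorm ((M n).Ea θ - (M n).Ea σ)) :
    TameMoments M σ := by
  have hQ' (i j : Fin s) : Tendsto (fun p : ℕ × Param s => (M p.1).Q p.2 i j - (M p.1).Q σ i j)
      (shrinkingBoxes M σ) (𝓝 0) :=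
    hQ.tendsto_of_abs_le (f := fun n θ => (M n).Q θ i j - (M n).Q σ i j) hd
      fun n θ => abs_apply_le_specNorm ((M n).Q θ - (M n).Q σ) i j
  have hmem : ∀ᶠ p in shrinkingBoxes M σ, p.2 ∈ (M p.1).box σ δ :=
    (eventually_shrinkingBoxes hd).2 ⟨δ, hδ, Eventually.of_forall fun _ _ hθ => hθ⟩
  refine ⟨?_, ?_, ?_, tame_inv hd hQ' hm hneg, fun i => ?_, fun i l => ?_, fun j k l => ?_,
    fun j k l p q => ?_⟩
  · filter_upwards [eventually_isNegDefBy_half hQ' hm hneg] with p hp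
    exact isUnit_det_A (hp.isUnit_det (half_pos hm))
  · exact hmem.mono fun p hp => (hreg p.1).A_isSymm (hbox p.1 hp)
  · exact hmem.mono fun p hp => hexp p.1 p.2 hp
  · obtain ⟨K, hK⟩ := hEa
    refine .of_vanishesUniformly hd (isBigO_of_le' (c := K) _ fun n => ?_) hEa'
      fun n θ => abs_apply_le_vecNorm ((M n).Ea θ - (M n).Ea σ) i
    simpa using (abs_apply_le_vecNorm _ i).trans (hK n)
  · exact tame_U1 hd hdstar hX (by linarith) hU1 i l
  · exact tame_U2 hd hdstar hX (by linarith) hU2 j k l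
  · exact tame_U3 hd hdstar hX hg hU3 j k l p q

end TameMoments

section RootExpansion

variable {ι : Type*} [Fintype ι]

lemma abs_sum_mul_le {w h : ι → ℝ} {c : ℝ} (hw : ∀ i, |w i| ≤ c) :
    |∑ i, w i * h i| ≤ c * ∑ i, |h i| := by
  rw [Finset.mul_sum]
  refine (Finset.abs_sum_le_sum_abs _ _).trans (Finset.sum_le_sum fun i _ => ?_)
  rw [abs_mul]
  exact mul_le_mul_of_nonneg_right (hw i) (abs_nonneg _)

lemma abs_sum_sum_mul_le {w : ι → ι → ℝ} {h k : ι → ℝ} {c : ℝ} (hw : ∀ i j, |w i j| ≤ c) :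
    |∑ i, ∑ j, w i j * h i * k j| ≤ c * ((∑ i, |h i|) * ∑ j, |k j|) := by
  rw [Finset.sum_mul_sum, Finset.mul_sum]
  refine (Finset.abs_sum_le_sum_abs _ _).trans (Finset.sum_le_sum fun i _ => ?_)
  rw [Finset.mul_sum]
  refine (Finset.abs_sum_le_sum_abs _ _).trans (Finset.sum_le_sum fun j _ => ?_)
  rw [abs_mul, abs_mul, mul_assoc]
  exact mul_le_mul_of_nonneg_right (hw i j) (by positivity)

lemma abs_sum_sum_mul_sub_le {w : ι → ι → ℝ} {h k : ι → ℝ} {c : ℝ} (hw : ∀ i j, |w i j| ≤ c) :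
    |∑ i, ∑ j, w i j * h i * h j - ∑ i, ∑ j, w i j * k i * k j| ≤
      c * ((∑ i, |(h - k) i|) * (∑ i, |h i| + ∑ i, |k i|)) := by
  have hsplit : ∑ i, ∑ j, w i j * h i * h j - ∑ i, ∑ j, w i j * k i * k j =
      ∑ i, ∑ j, w i j * h i * (h - k) j + ∑ i, ∑ j, w i j * (h - k) i * k j := by
    simp only [← Finset.sum_sub_distrib, ← Finset.sum_add_distrib, Pi.sub_apply]
    exact Finset.sum_congr rfl fun i _ => Finset.sum_congr rfl fun j _ => by ring
  rw [hsplit]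
  refine (abs_add_le _ _).trans ((add_le_add (abs_sum_sum_mul_le hw)
    (abs_sum_sum_mul_le hw)).trans_eq ?_)
  ring

lemma sum_abs_mulVec_le {W : Matrix ι ι ℝ} {e : ι → ℝ} {κ c : ℝ} (hW : ∀ i j, |W i j| ≤ κ)
    (hκ : 0 ≤ κ) (he : ∀ i, |e i| ≤ c) :
    ∑ p, |(W *ᵥ e) p| ≤ (Fintype.card ι : ℝ) ^ 2 * κ * c := by
  have hsum : ∑ i, |e i| ≤ Fintype.card ι * c :=
    (Finset.sum_le_card_nsmul _ _ _ fun i _ => he i).trans_eq (by simp)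
  calc ∑ p, |(W *ᵥ e) p|
      ≤ Finset.univ.card • (κ * (Fintype.card ι * c)) :=
        Finset.sum_le_card_nsmul _ _ _ fun p _ =>
          (abs_sum_mul_le (hW p)).trans (mul_le_mul_of_nonneg_left hsum hκ)
    _ = (Fintype.card ι : ℝ) ^ 2 * κ * c := by
        rw [Finset.card_univ, nsmul_eq_mul]
        ring

variable {W G : Matrix ι ι ℝ} {T : ι → ι → ι → ℝ} {h k α R : ι → ℝ} {c κ x d : ℝ}

lemma abs_secondOrder_le (hc : 0 ≤ c) (hG : ∀ i j, |G i j| ≤ c) (hT : ∀ i j k, |T i j k| ≤ c)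
    (i : ι) : |secondOrder G T h i| ≤ c * (∑ j, |h j| + (∑ j, |h j|) ^ 2) := by
  have hlin := abs_sum_mul_le (h := h) (hG i)
  have hquad := abs_sum_sum_mul_le (h := h) (k := h) (hT i)
  have hnonneg : 0 ≤ c * ((∑ j, |h j|) * ∑ j, |h j|) := mul_nonneg hc (mul_self_nonneg _)
  refine (abs_add_le _ _).trans ?_
  rw [abs_mul, abs_of_pos (by norm_num : (0 : ℝ) < 1 / 2)]
  linarith

lemma abs_secondOrder_sub_le (hc : 0 ≤ c) (hG : ∀ i j, |G i j| ≤ c) (hT : ∀ i j k, |T i j k| ≤ c)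
    (i : ι) : |secondOrder G T h i - secondOrder G T k i| ≤
      c * ((∑ j, |(h - k) j|) * (1 + (∑ j, |h j| + ∑ j, |k j|))) := by
  have hlin := abs_sum_mul_le (h := h - k) (hG i)
  have hquad := abs_sum_sum_mul_sub_le (h := h) (k := k) (hT i)
  have hnonneg : 0 ≤ c * ((∑ j, |(h - k) j|) * (∑ j, |h j| + ∑ j, |k j|)) := by positivity
  have hsplit : secondOrder G T h i - secondOrder G T k i = ∑ j, G i j * (h - k) j +
      1 / 2 * (∑ i', ∑ j, T i i' j * h i' * h j - ∑ i', ∑ j, T i i' j * k i' * k j) := by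
    simp only [secondOrder, Pi.sub_apply, mul_sub, Finset.sum_sub_distrib]
    ring
  rw [hsplit]
  refine (abs_add_le _ _).trans ?_
  rw [abs_mul, abs_of_pos (by norm_num : (0 : ℝ) < 1 / 2)]
  linarith

/-- The coefficients of the equation `α + W⁻¹ h + G h + ½ T[h, h] = 0` for `h`: the constant term
is of order `x`, and the perturbations `G` and `T` are of order `x / d`. -/
structure PerturbationBound (W G : Matrix ι ι ℝ) (T : ι → ι → ι → ℝ) (α : ι → ℝ) (κ x d : ℝ) :
    Prop where
  one_le_x : 1 ≤ x
  one_le_d : 1 ≤ d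
  nonneg : 0 ≤ κ
  W_le : ∀ i j, |W i j| ≤ κ
  α_le : ∀ i, |α i| ≤ x
  G_le : ∀ i j, |G i j| ≤ x / d
  T_le : ∀ i j k, |T i j k| ≤ x / d

namespace PerturbationBound

lemma sum_abs_mulVec_le (H : PerturbationBound W G T α κ x d) {e : ι → ℝ} (he : ∀ i, |e i| ≤ c) :
    ∑ p, |(W *ᵥ e) p| ≤ (Fintype.card ι : ℝ) ^ 2 * κ * c :=
  _root_.sum_abs_mulVec_le H.W_le H.nonneg he

lemma secondOrder_le (H : PerturbationBound W G T α κ x d) (i : ι) :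
    |secondOrder G T h i| ≤ x / d * (∑ j, |h j| + (∑ j, |h j|) ^ 2) :=
  abs_secondOrder_le (div_nonneg (by linarith [H.one_le_x]) (by linarith [H.one_le_d]))
    H.G_le H.T_le i

lemma sum_abs_first_le (H : PerturbationBound W G T α κ x d) :
    ∑ j, |(-(W *ᵥ α)) j| ≤ (Fintype.card ι : ℝ) ^ 2 * κ * x := by
  simpa only [Pi.neg_apply, abs_neg] using H.sum_abs_mulVec_le H.α_le

lemma sum_abs_second_le (H : PerturbationBound W G T α κ x d) {B : ℝ}
    (hB : B = (Fintype.card ι : ℝ) ^ 2 * κ) :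
    ∑ j, |(-(W *ᵥ α) - W *ᵥ secondOrder G T (-(W *ᵥ α))) j| ≤
      (B + B * (B + B ^ 2)) * x ^ 3 := by
  have hx := H.one_le_x
  have hB0 : 0 ≤ B := by rw [hB]; have := H.nonneg; positivity
  have hfirst : ∑ j, |(-(W *ᵥ α)) j| ≤ B * x := hB ▸ H.sum_abs_first_le
  have hsecond : ∑ j, |(W *ᵥ secondOrder G T (-(W *ᵥ α))) j| ≤ B * ((B + B ^ 2) * x ^ 3) := by
    refine (H.sum_abs_mulVec_le fun i => (H.secondOrder_le i).trans ?_).trans_eq (by rw [hB])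
    rw [← hB]
    calc x / d * (∑ j, |(-(W *ᵥ α)) j| + (∑ j, |(-(W *ᵥ α)) j|) ^ 2)
        ≤ x * (B * x + (B * x) ^ 2) := by
          gcongr
          exact div_le_self (by linarith) H.one_le_d
      _ = B * x ^ 2 + B ^ 2 * x ^ 3 := by ring
      _ ≤ B * x ^ 3 + B ^ 2 * x ^ 3 := by
          gcongr B * ?_ + B ^ 2 * x ^ 3
          exact pow_le_pow_right₀ hx (by norm_num)
      _ = (B + B ^ 2) * x ^ 3 := by ring
  calc ∑ j, |(-(W *ᵥ α) - W *ᵥ secondOrder G T (-(W *ᵥ α))) j|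
      ≤ ∑ j, (|(-(W *ᵥ α)) j| + |(W *ᵥ secondOrder G T (-(W *ᵥ α))) j|) :=
        Finset.sum_le_sum fun j _ => abs_sub _ _
    _ ≤ B * x + B * ((B + B ^ 2) * x ^ 3) :=
        Finset.sum_add_distrib.trans_le (add_le_add hfirst hsecond)
    _ ≤ B * x ^ 3 + B * ((B + B ^ 2) * x ^ 3) := by
        gcongr
        exact le_self_pow₀ hx three_ne_zero
    _ = (B + B * (B + B ^ 2)) * x ^ 3 := by ring

end PerturbationBound

/-- `h` is a root of `α + W⁻¹ h + G h + ½ T[h, h] + R = 0`, written as a fixed point equation,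
where the remainder `R` is of the order of a third-order term in `h` with coefficient `x / d²`. -/
structure IsPerturbedRoot (W G : Matrix ι ι ℝ) (T : ι → ι → ι → ℝ) (α R : ι → ℝ) (κ x d : ℝ)
    (h : ι → ℝ) : Prop extends PerturbationBound W G T α κ x d where
  R_le : ∀ i, |R i| ≤ x / d ^ 2 * (∑ j, |h j|) ^ 3
  eq : h = -(W *ᵥ (α + secondOrder G T h + R))

namespace IsPerturbedRoot

-- The smallness conditions make the perturbation terms at most half of `∑ |h j|`, so that they
-- can be absorbed in the left-hand side.
lemma sum_abs_le (H : IsPerturbedRoot W G T α R κ x d h)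
    (hsmall : 4 * ((Fintype.card ι : ℝ) ^ 2 * κ) * (x * (1 + ∑ j, |h j|)) ≤ d)
    (hsmall' : 4 * ((Fintype.card ι : ℝ) ^ 2 * κ) * (x * (∑ j, |h j|) ^ 2) ≤ d ^ 2) :
    ∑ j, |h j| ≤ 2 * ((Fintype.card ι : ℝ) ^ 2 * κ) * x := by
  have hd := H.one_le_d
  set N := ∑ j, |h j|
  set B := (Fintype.card ι : ℝ) ^ 2 * κ
  have : 0 ≤ N := Finset.sum_nonneg fun _ _ => abs_nonneg _
  have hfix : N = ∑ p, |(W *ᵥ (α + secondOrder G T h + R)) p| :=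
    Finset.sum_congr rfl fun p _ => by rw [congr_fun H.eq p, Pi.neg_apply, abs_neg]
  have hquad : 4 * B * (x * (1 + N)) / d * N ≤ 1 * N := by
    gcongr
    exact div_le_one_of_le₀ hsmall (by linarith)
  have hcubic : 4 * B * (x * N ^ 2) / d ^ 2 * N ≤ 1 * N := by
    gcongr
    exact div_le_one_of_le₀ hsmall' (by positivity)
  have hbound : N ≤ B * (x + x / d * (N + N ^ 2) + x / d ^ 2 * N ^ 3) :=
    hfix.trans_le <| H.sum_abs_mulVec_le fun i => (abs_add_three _ _ _).trans <|
      add_le_add (add_le_add (H.α_le i) (H.secondOrder_le i)) (H.R_le i)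
  have hsplit : B * (x + x / d * (N + N ^ 2) + x / d ^ 2 * N ^ 3) =
      B * x + (4 * B * (x * (1 + N)) / d * N + 4 * B * (x * N ^ 2) / d ^ 2 * N) / 4 := by
    ring
  linarith

lemma R_le_pow (H : IsPerturbedRoot W G T α R κ x d h) (hN : ∑ j, |h j| ≤ c * x) (i : ι) :
    |R i| ≤ c ^ 3 * (x ^ 4 / d ^ 2) := by
  have := H.one_le_x
  refine (H.R_le i).trans ?_
  calc x / d ^ 2 * (∑ j, |h j|) ^ 3 ≤ x / d ^ 2 * (c * x) ^ 3 := by gcongr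
    _ = c ^ 3 * (x ^ 4 / d ^ 2) := by ring

lemma sub_first_eq (H : IsPerturbedRoot W G T α R κ x d h) :
    h - -(W *ᵥ α) = -(W *ᵥ (secondOrder G T h + R)) := by
  conv_lhs => rw [H.eq]
  rw [add_assoc, Matrix.mulVec_add]
  abel

lemma sum_abs_sub_first_le (H : IsPerturbedRoot W G T α R κ x d h) (hc : 0 ≤ c)
    (hN : ∑ j, |h j| ≤ c * x) :
    ∑ j, |(h - -(W *ᵥ α)) j| ≤
      (Fintype.card ι : ℝ) ^ 2 * κ * ((c + c ^ 2 + c ^ 3) * (x ^ 4 / d)) := by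
  have hx := H.one_le_x
  have hd := H.one_le_d
  simp only [H.sub_first_eq, Pi.neg_apply, abs_neg]
  refine H.sum_abs_mulVec_le fun i => (abs_add_le _ _).trans ?_
  have hsecond : |secondOrder G T h i| ≤ (c + c ^ 2) * (x ^ 4 / d) :=
    calc |secondOrder G T h i| ≤ x / d * (c * x + (c * x) ^ 2) :=
          (H.secondOrder_le i).trans (by gcongr)
      _ = (c * x ^ 2 + c ^ 2 * x ^ 3) / d := by ring
      _ ≤ (c * x ^ 4 + c ^ 2 * x ^ 4) / d := by
          gcongr (c * ?_ + c ^ 2 * ?_) / d <;> exact pow_le_pow_right₀ hx (by norm_num)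
      _ = (c + c ^ 2) * (x ^ 4 / d) := by ring
  have hR : |R i| ≤ c ^ 3 * (x ^ 4 / d) := (H.R_le_pow hN i).trans <| by
    gcongr
    exact le_self_pow₀ hd two_ne_zero
  linarith

lemma sub_second_eq (H : IsPerturbedRoot W G T α R κ x d h) :
    h - (-(W *ᵥ α) - W *ᵥ secondOrder G T (-(W *ᵥ α))) =
      -(W *ᵥ (secondOrder G T h - secondOrder G T (-(W *ᵥ α)) + R)) := by
  rw [← sub_add, H.sub_first_eq, Matrix.mulVec_add, Matrix.mulVec_add, Matrix.mulVec_sub]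
  abel

lemma sum_abs_sub_second_le (H : IsPerturbedRoot W G T α R κ x d h) {c' : ℝ} (hc : 0 ≤ c)
    (hN : ∑ j, |h j| ≤ c * x) (hN' : ∑ j, |(-(W *ᵥ α)) j| ≤ c * x)
    (hsub : ∑ j, |(h - -(W *ᵥ α)) j| ≤ c' * (x ^ 4 / d)) :
    ∑ j, |(h - (-(W *ᵥ α) - W *ᵥ secondOrder G T (-(W *ᵥ α)))) j| ≤
      (Fintype.card ι : ℝ) ^ 2 * κ * ((c' * (1 + 2 * c) + c ^ 3) * (x ^ 6 / d ^ 2)) := by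
  have hx := H.one_le_x
  have hd := H.one_le_d
  have : 0 ≤ c' * (x ^ 4 / d) := hsub.trans' (by positivity)
  simp only [H.sub_second_eq, Pi.neg_apply (W *ᵥ _), abs_neg]
  refine H.sum_abs_mulVec_le fun i => (abs_add_le _ _).trans ?_
  have hsecond : |secondOrder G T h i - secondOrder G T (-(W *ᵥ α)) i| ≤
      c' * (1 + 2 * c) * (x ^ 6 / d ^ 2) := by
    refine (abs_secondOrder_sub_le (by positivity) H.G_le H.T_le i).trans ?_
    calc x / d * ((∑ j, |(h - -(W *ᵥ α)) j|) * (1 + (∑ j, |h j| + ∑ j, |(-(W *ᵥ α)) j|)))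
        ≤ x / d * (c' * (x ^ 4 / d) * (x + (c * x + c * x))) := by gcongr
      _ = c' * (1 + 2 * c) * (x ^ 6 / d ^ 2) := by ring
  have hR : |R i| ≤ c ^ 3 * (x ^ 6 / d ^ 2) := (H.R_le_pow hN i).trans <| by
    gcongr c ^ 3 * (?_ / d ^ 2)
    exact pow_le_pow_right₀ hx (by norm_num)
  rw [Pi.sub_apply]
  linarith

end IsPerturbedRoot

lemma exists_perturbedRoot_expansion (ι : Type*) [Fintype ι] {κ : ℝ} (hκ : 0 ≤ κ) :
    ∃ C ≥ 0, ∀ {W G : Matrix ι ι ℝ} {T : ι → ι → ι → ℝ} {α R h : ι → ℝ} {x d : ℝ},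
      IsPerturbedRoot W G T α R κ x d h →
      4 * ((Fintype.card ι : ℝ) ^ 2 * κ) * (x * (1 + ∑ j, |h j|)) ≤ d →
      4 * ((Fintype.card ι : ℝ) ^ 2 * κ) * (x * (∑ j, |h j|) ^ 2) ≤ d ^ 2 →
      ∑ j, |h j| ≤ C * x ∧ ∑ j, |(-(W *ᵥ α)) j| ≤ C * x ∧
      ∑ j, |(h - -(W *ᵥ α)) j| ≤ C * (x ^ 4 / d) ∧
      ∑ j, |(h - (-(W *ᵥ α) - W *ᵥ secondOrder G T (-(W *ᵥ α)))) j| ≤ C * (x ^ 6 / d ^ 2) := by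
  set B : ℝ := (Fintype.card ι : ℝ) ^ 2 * κ with hB
  have hB0 : 0 ≤ B := by positivity
  set c₁ := 2 * B
  set c₂ := B * (c₁ + c₁ ^ 2 + c₁ ^ 3) with hc₂
  set c₃ := B * (c₂ * (1 + 2 * c₁) + c₁ ^ 3) with hc₃
  have h₁ : 0 ≤ c₁ := by positivity
  have h₂ : 0 ≤ c₂ := by positivity
  have h₃ : 0 ≤ c₃ := by positivity
  refine ⟨c₁ + c₂ + c₃, by positivity, fun {W G T α R h x d} H hsmall hsmall' => ?_⟩
  have hx := H.one_le_x
  have hd := H.one_le_d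
  have hN : ∑ j, |h j| ≤ c₁ * x := H.sum_abs_le hsmall hsmall'
  have hN' : ∑ j, |(-(W *ᵥ α)) j| ≤ c₁ * x := H.sum_abs_first_le.trans <| by
    gcongr
    linarith
  have hsub := H.sum_abs_sub_first_le h₁ hN
  rw [← mul_assoc, ← hB, ← hc₂] at hsub
  have hsub' := H.sum_abs_sub_second_le h₁ hN hN' hsub
  rw [← mul_assoc, ← hB, ← hc₃] at hsub'
  refine ⟨hN.trans ?_, hN'.trans ?_, hsub.trans ?_, hsub'.trans ?_⟩ <;> gcongr <;> linarith

lemma abs_quadratic_sub_le {w₁ : ι → ℝ} {w₂ : ι → ι → ℝ} {c₁ c₂ : ℝ} (h₁ : ∀ i, |w₁ i| ≤ c₁)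
    (h₂ : ∀ i j, |w₂ i j| ≤ c₂) (h u v : ι → ℝ) :
    |(∑ i, w₁ i * h i + 1 / 2 * ∑ i, ∑ j, w₂ i j * h i * h j)
      - (∑ i, w₁ i * v i + 1 / 2 * ∑ i, ∑ j, w₂ i j * u i * u j)| ≤
      c₁ * ∑ i, |(h - v) i| +
        1 / 2 * (c₂ * ((∑ i, |(h - u) i|) * (∑ i, |h i| + ∑ i, |u i|))) := by
  have hsplit : (∑ i, w₁ i * h i + 1 / 2 * ∑ i, ∑ j, w₂ i j * h i * h j)
      - (∑ i, w₁ i * v i + 1 / 2 * ∑ i, ∑ j, w₂ i j * u i * u j) = ∑ i, w₁ i * (h - v) i +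
      1 / 2 * (∑ i, ∑ j, w₂ i j * h i * h j - ∑ i, ∑ j, w₂ i j * u i * u j) := by
    simp only [Pi.sub_apply, mul_sub, Finset.sum_sub_distrib]
    ring
  rw [hsplit]
  refine (abs_add_le _ _).trans (add_le_add (abs_sum_mul_le h₁) ?_)
  rw [abs_mul, abs_of_pos (by norm_num : (0 : ℝ) < 1 / 2)]
  gcongr
  exact abs_sum_sum_mul_sub_le h₂

lemma abs_sum_mul_sum_mul_sum_mul_le {d : ι → ℝ} (hd : ∀ i, 0 ≤ d i) {c : ι → ι → ι → ℝ} {K : ℝ}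
    (hc : ∀ i j k, |c i j k| ≤ K * (d i * d j * d k)) (v : ι → ℝ) :
    |∑ i, v i * ∑ j, v j * ∑ k, v k * c i j k| ≤ K * (∑ i, |d i * v i|) ^ 3 := by
  have hcube : K * (∑ i, |d i * v i|) ^ 3 = ∑ i, ∑ j, ∑ k,
      |d i * v i| * (|d j * v j| * (|d k * v k| * K)) := by
    simp only [← Finset.mul_sum, ← Finset.sum_mul]
    ring
  rw [hcube]
  simp only [Finset.mul_sum]
  refine (Finset.abs_sum_le_sum_abs _ _).trans (Finset.sum_le_sum fun i _ => ?_)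
  refine (Finset.abs_sum_le_sum_abs _ _).trans (Finset.sum_le_sum fun j _ => ?_)
  refine (Finset.abs_sum_le_sum_abs _ _).trans (Finset.sum_le_sum fun k _ => ?_)
  simp only [abs_mul, abs_of_nonneg (hd _)]
  calc |v i| * (|v j| * (|v k| * |c i j k|))
      ≤ |v i| * (|v j| * (|v k| * (K * (d i * d j * d k)))) := by
        gcongr
        exact hc i j k
    _ = d i * |v i| * (d j * |v j| * (d k * |v k| * K)) := by ring

end RootExpansion

namespace Experiment

variable {s : ℕ} {M : Experiment.{u, v} s} {σ θ : Param s} {U : Set (Param s)} {y : M.𝒴}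
  {δ x m K : ℝ} {η : Param s → ℝ}

/-- The normalized deviation `D (θ - σ)`. -/
noncomputable def ndev (M : Experiment.{u, v} s) (σ θ : Param s) : Fin s → ℝ :=
  fun i => M.d i * (θ i - σ i)

namespace Dominates

lemma nhess_le (h : M.Dominates σ δ y x) (hd : ∀ i, 0 < M.d i) (hdstar : 0 < M.dstar)
    (i j : Fin s) : |M.nhess σ y i j| ≤ x / M.dstar := by
  have hle : M.dstar ≤ √(M.d i) * √(M.d j) := by
    rw [← Real.mul_self_sqrt hdstar.le]
    gcongr <;> exact M.dstar_le _
  rw [nhess_apply hd, inv_mul_eq_div, abs_div, abs_of_pos (hdstar.trans_le hle)]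
  exact div_le_div₀ (by linarith [h.one_le]) (h.lam2_le hd i j) hdstar hle

lemma nthird_le (h : M.Dominates σ δ y x) (hd : ∀ i, 0 < M.d i) (hδ : 0 ≤ δ) (i j k : Fin s) :
    |M.nthird σ y i j k| ≤ x / M.dstar := by
  have hpos : 0 < M.d i * M.d j * M.d k := mul_pos (mul_pos (hd i) (hd j)) (hd k)
  rw [nthird, abs_div, abs_of_pos hpos, div_le_iff₀ hpos]
  exact (h.l3_le i j k σ (M.self_mem_box hd hδ)).trans_eq (by ring)

lemma perturbationBound (h : M.Dominates σ δ y x) (hd : ∀ i, 0 < M.d i) (hδ : 0 ≤ δ)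
    (hdstar : 1 ≤ M.dstar) (hm : 0 < m) (hQ : IsNegDefBy m (M.Q σ)) :
    PerturbationBound (M.Q σ)⁻¹ (M.nhess σ y) (M.nthird σ y) (M.nscore σ y) (1 / m) x
      M.dstar where
  one_le_x := h.one_le
  one_le_d := hdstar
  nonneg := by positivity
  W_le := hQ.abs_inv_apply_le hm
  α_le := h.lam1_le hd
  G_le := h.nhess_le hd (by linarith)
  T_le := h.nthird_le hd hδ

end Dominates

namespace RegularOn

lemma sum_mul_pderiv_a (hreg : M.RegularOn U) (hd : ∀ i, 0 < M.d i) (hσ : σ ∈ U) (i : Fin s) :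
    ∑ j, (θ - σ) j * pderiv j (fun τ => M.a τ y i) σ =
      M.d i * ((M.Q σ *ᵥ M.ndev σ θ) i + ∑ j, M.nhess σ y i j * M.ndev σ θ j) := by
  simp only [Matrix.mulVec, dotProduct, Finset.mul_sum, ← Finset.sum_add_distrib]
  refine Finset.sum_congr rfl fun j _ => ?_
  have hF : pderiv j (fun τ => M.a τ y i) σ = M.F σ y i j := hreg.F_symm hσ j i y
  have := (hd i).ne'
  have := (hd j).ne'
  simp only [hF, Q_apply hd, nhess, ndev, Matrix.of_apply, PiLp.sub_apply]
  field_simp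
  ring

lemma sum_mul_sum_mul_pderiv_pderiv_a (hreg : M.RegularOn U) (hd : ∀ i, 0 < M.d i) (hσ : σ ∈ U)
    (i : Fin s) :
    ∑ j, (θ - σ) j * ∑ k, (θ - σ) k * pderiv k (pderiv j fun τ => M.a τ y i) σ =
      M.d i * ∑ j, ∑ k, M.nthird σ y i j k * M.ndev σ θ j * M.ndev σ θ k := by
  simp only [Finset.mul_sum]
  refine Finset.sum_congr rfl fun j _ => Finset.sum_congr rfl fun k _ => ?_
  have hl3 : pderiv k (pderiv j fun τ => M.a τ y i) σ = M.l3 i j k σ y :=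
    pderiv_reverse hreg.isOpen ((hreg.contDiffOn_l y).of_le (by norm_num)) i j k hσ
  have := (hd i).ne'
  have := (hd j).ne'
  have := (hd k).ne'
  simp only [hl3, nthird, ndev, PiLp.sub_apply]
  field_simp

lemma abs_nscore_sub_taylor_le (hreg : M.RegularOn U) (hd : ∀ i, 0 < M.d i)
    (hδ : 0 ≤ δ) (hbox : M.box σ δ ⊆ U) (h : M.Dominates σ δ y x) (hθ : θ ∈ M.box σ δ)
    (i : Fin s) :
    |M.nscore θ y i - (M.nscore σ y + M.Q σ *ᵥ M.ndev σ θ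
      + secondOrder (M.nhess σ y) (M.nthird σ y) (M.ndev σ θ)) i| ≤
      x / M.dstar ^ 2 * (∑ j, |M.ndev σ θ j|) ^ 3 := by
  have hσ := M.self_mem_box (σ := σ) hd hδ
  have htaylor := abs_sub_taylor_two_le hreg.isOpen (hreg.contDiffOn_a i y) σ (θ - σ)
    (fun t ht => hbox (segment_mem_box hσ hθ ht)) fun t ht =>
      abs_sum_mul_sum_mul_sum_mul_le (K := x / M.dstar ^ 2 * M.d i) (fun j => (hd j).le)
        (fun j k q => (h.l4_le q k j i _ (segment_mem_box hσ hθ ht)).trans_eq (by ring)) _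
  have ha (τ : Param s) : M.a τ y i = M.d i * M.nscore τ y i := (mul_div_cancel₀ _ (hd i).ne').symm
  rw [add_sub_cancel, hreg.sum_mul_pderiv_a hd (hbox hσ),
    hreg.sum_mul_sum_mul_pderiv_pderiv_a hd (hbox hσ), ha, ha] at htaylor
  have heq : M.d i * M.nscore θ y i - M.d i * M.nscore σ y i -
      M.d i * ((M.Q σ *ᵥ M.ndev σ θ) i + ∑ j, M.nhess σ y i j * M.ndev σ θ j) -
      1 / 2 * (M.d i * ∑ j, ∑ k, M.nthird σ y i j k * M.ndev σ θ j * M.ndev σ θ k) =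
      M.d i * (M.nscore θ y i - (M.nscore σ y + M.Q σ *ᵥ M.ndev σ θ
        + secondOrder (M.nhess σ y) (M.nthird σ y) (M.ndev σ θ)) i) := by
    simp only [Pi.add_apply, secondOrder]
    ring
  rw [heq, abs_mul, abs_of_pos (hd i)] at htaylor
  exact le_of_mul_le_mul_left (htaylor.trans_eq (by simp only [ndev, PiLp.sub_apply]; ring)) (hd i)

lemma isPerturbedRoot_ndev (hreg : M.RegularOn U) (hd : ∀ i, 0 < M.d i) (hδ : 0 ≤ δ)
    (hbox : M.box σ δ ⊆ U) (hdstar : 1 ≤ M.dstar) (hm : 0 < m) (hQ : IsNegDefBy m (M.Q σ))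
    (h : M.Dominates σ δ y x) (hθ : θ ∈ M.box σ δ) (hroot : M.a θ y = 0) :
    IsPerturbedRoot (M.Q σ)⁻¹ (M.nhess σ y) (M.nthird σ y) (M.nscore σ y)
      (-(M.nscore σ y + M.Q σ *ᵥ M.ndev σ θ
        + secondOrder (M.nhess σ y) (M.nthird σ y) (M.ndev σ θ)))
      (1 / m) x M.dstar (M.ndev σ θ) where
  toPerturbationBound := h.perturbationBound hd hδ hdstar hm hQ
  R_le i := by
    have := hreg.abs_nscore_sub_taylor_le hd hδ hbox h hθ i
    rwa [nscore, lam1, hroot, Pi.zero_apply, zero_div, zero_sub] at this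
  eq := by
    have hcancel (α q t : Fin s → ℝ) : α + t + -(α + q + t) = -q := by abel
    rw [hcancel, Matrix.mulVec_neg, neg_neg, Matrix.mulVec_mulVec,
      Matrix.nonsing_inv_mul _ (hQ.isUnit_det hm), Matrix.one_mulVec]

end RegularOn

lemma abs_div_d_le (hdstar : 0 < M.dstar) {b : ℝ} (hb : |b| ≤ K) (p : Fin s) :
    |b / M.d p| ≤ K / M.dstar := by
  rw [abs_div, abs_of_pos (hdstar.trans_le (M.dstar_le p))]
  exact div_le_div₀ ((abs_nonneg b).trans hb) hb hdstar (M.dstar_le p)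

lemma abs_div_d_mul_d_le (hdstar : 0 < M.dstar) {b : ℝ} (hb : |b| ≤ K) (p q : Fin s) :
    |b / (M.d p * M.d q)| ≤ K / M.dstar ^ 2 := by
  rw [← div_div, sq, ← div_div]
  exact abs_div_d_le hdstar (abs_div_d_le hdstar hb p) q

namespace SmoothBound

lemma abs_sub_taylor_le (h : M.SmoothBound σ δ η K) (hd : ∀ i, 0 < M.d i)
    (hdstar : 0 < M.dstar) (hδ : 0 ≤ δ) (hU : IsOpen U) (hη : ContDiffOn ℝ 3 η U)
    (hbox : M.box σ δ ⊆ U) (hθ : θ ∈ M.box σ δ) :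
    |η θ - η σ - (∑ p, gradVec η σ p / M.d p * M.ndev σ θ p +
      1 / 2 * ∑ p, ∑ q, hessMat η σ p q / (M.d p * M.d q) * M.ndev σ θ p * M.ndev σ θ q)| ≤
      K / M.dstar ^ 3 * (∑ j, |M.ndev σ θ j|) ^ 3 := by
  have hσ := M.self_mem_box (σ := σ) hd hδ
  have hK : 0 ≤ K := (abs_nonneg _).trans (h.zero_le σ hσ)
  have htaylor := abs_sub_taylor_two_le hU hη σ (θ - σ)
    (fun t ht => hbox (segment_mem_box hσ hθ ht)) fun t ht =>
      abs_sum_mul_sum_mul_sum_mul_le (d := M.d) (K := K / M.dstar ^ 3) (fun j => (hd j).le)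
        (fun j k q => (h.three_le q k j _ (segment_mem_box hσ hθ ht)).trans <| by
          rw [div_mul_eq_mul_div, le_div_iff₀ (by positivity)]
          exact mul_le_mul_of_nonneg_left (dstar_pow_three_le hd j k q) hK) _
  have hlin : ∑ i, (θ - σ) i * pderiv i η σ = ∑ p, gradVec η σ p / M.d p * M.ndev σ θ p := by
    refine Finset.sum_congr rfl fun p _ => ?_
    have := (hd p).ne'
    simp only [gradVec, ndev, PiLp.sub_apply]
    field_simp
  have hquad : ∑ i, (θ - σ) i * ∑ j, (θ - σ) j * pderiv j (pderiv i η) σ =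
      ∑ p, ∑ q, hessMat η σ p q / (M.d p * M.d q) * M.ndev σ θ p * M.ndev σ θ q := by
    simp only [Finset.mul_sum]
    refine Finset.sum_congr rfl fun p _ => Finset.sum_congr rfl fun q _ => ?_
    have := (hd p).ne'
    have := (hd q).ne'
    rw [pderiv_comm hU (hη.of_le (by norm_num)) q p (hbox hσ)]
    simp only [hessMat, ndev, Matrix.of_apply, PiLp.sub_apply]
    field_simp
  rw [add_sub_cancel, hlin, hquad, sub_sub (η θ - η σ)] at htaylor
  exact htaylor

end SmoothBound

end Experiment

namespace Experiment

variable {s : ℕ} {M : Experiment.{u, v} s} {σ θ : Param s} {U : Set (Param s)} {y : M.𝒴}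
  {δ x m K : ℝ} {η : Param s → ℝ}

/-- The conditions on the criterion of a single experiment under which its score roots near `σ` can
be analysed: it is smooth on an open set that contains the box `S_δ(σ)`, and `Q(σ)` is negative
definite by the margin `m`. -/
structure Nondegenerate (M : Experiment.{u, v} s) (σ : Param s) (δ : ℝ) (U : Set (Param s))
    (m : ℝ) : Prop where
  d_pos : ∀ i, 0 < M.d i
  one_le_dstar : 1 ≤ M.dstar
  δ_nonneg : 0 ≤ δ
  m_pos : 0 < m
  box_subset : M.box σ δ ⊆ U
  regularOn : M.RegularOn U
  isNegDefBy : IsNegDefBy m (M.Q σ)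

namespace Nondegenerate

lemma self_mem_box (h : M.Nondegenerate σ δ U m) : σ ∈ M.box σ δ :=
  M.self_mem_box h.d_pos h.δ_nonneg

lemma dstar_pos (h : M.Nondegenerate σ δ U m) : 0 < M.dstar :=
  one_pos.trans_le h.one_le_dstar

lemma isUnit_det_Q (h : M.Nondegenerate σ δ U m) : IsUnit (M.Q σ).det :=
  h.isNegDefBy.isUnit_det h.m_pos

lemma isSymm_A (h : M.Nondegenerate σ δ U m) : (M.A σ).IsSymm :=
  h.regularOn.A_isSymm (h.box_subset h.self_mem_box)

lemma perturbationBound (h : M.Nondegenerate σ δ U m) (hx : M.Dominates σ δ y x) :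
    PerturbationBound (M.Q σ)⁻¹ (M.nhess σ y) (M.nthird σ y) (M.nscore σ y) (1 / m) x
      M.dstar :=
  hx.perturbationBound h.d_pos h.δ_nonneg h.one_le_dstar h.m_pos h.isNegDefBy

end Nondegenerate

/-- The conditions on a single experiment under which `η` can be expanded at a score root: in
addition to those on the criterion, `η` is smooth and bounded by `K` near `σ` together with its
derivatives. -/
structure Expandable (M : Experiment.{u, v} s) (σ : Param s) (δ : ℝ) (U : Set (Param s)) (m K : ℝ)
    (η : Param s → ℝ) : Prop extends M.Nondegenerate σ δ U m where
  contDiffOn : ContDiffOn ℝ 3 η U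
  smoothBound : M.SmoothBound σ δ η K

namespace Expandable

lemma K_nonneg (h : M.Expandable σ δ U m K η) : 0 ≤ K :=
  (abs_nonneg _).trans (h.smoothBound.zero_le σ h.self_mem_box)

lemma leading_eq (h : M.Expandable σ δ U m K η) (y : M.𝒴) :
    M.leading η σ y = ∑ p, gradVec η σ p / M.d p *
        (M.step σ y - (M.Q σ)⁻¹ *ᵥ secondOrder (M.nhess σ y) (M.nthird σ y) (M.step σ y)) p
      + 1 / 2 * ∑ p, ∑ q, hessMat η σ p q / (M.d p * M.d q) * M.step σ y p * M.step σ y q :=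
  Experiment.leading_eq h.d_pos (isUnit_det_A h.isUnit_det_Q) h.isSymm_A η y

lemma abs_gradVec_div_le (h : M.Expandable σ δ U m K η) (p : Fin s) :
    |gradVec η σ p / M.d p| ≤ K / M.dstar :=
  abs_div_d_le h.dstar_pos (h.smoothBound.one_le p σ h.self_mem_box) p

lemma abs_hessMat_div_le (h : M.Expandable σ δ U m K η) (p q : Fin s) :
    |hessMat η σ p q / (M.d p * M.d q)| ≤ K / M.dstar ^ 2 :=
  abs_div_d_mul_d_le h.dstar_pos (h.smoothBound.two_le p q σ h.self_mem_box) p q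

end Expandable

lemma exists_abs_leading_le (s : ℕ) {m K : ℝ} (hm : 0 < m) (hK : 0 ≤ K) :
    ∃ C ≥ 0, ∀ {M : Experiment.{u, v} s} {σ : Param s} {δ : ℝ} {U : Set (Param s)}
      {η : Param s → ℝ} {y : M.𝒴} {x : ℝ}, M.Expandable σ δ U m K η → M.Dominates σ δ y x →
      |M.leading η σ y| ≤ C * (x ^ 3 / M.dstar) := by
  obtain ⟨B, hB0, hB⟩ : ∃ B, 0 ≤ B ∧ B = (s : ℝ) ^ 2 * (1 / m) := ⟨_, by positivity, rfl⟩
  refine ⟨K * (B + B * (B + B ^ 2) + B ^ 2), by positivity, ?_⟩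
  intro M σ δ U η y x h hx
  have hd := h.dstar_pos
  have hd1 := h.one_le_dstar
  have hx1 := hx.one_le
  have hP := h.perturbationBound hx
  have hfirst : ∑ p, |M.step σ y p| ≤ B * x :=
    hP.sum_abs_first_le.trans_eq (by rw [hB, Fintype.card_fin])
  have hsecond := hP.sum_abs_second_le (B := B) (by simpa only [Fintype.card_fin])
  have hquad := abs_quadratic_sub_le h.abs_gradVec_div_le h.abs_hessMat_div_le 0 (M.step σ y)
    (M.step σ y - (M.Q σ)⁻¹ *ᵥ secondOrder (M.nhess σ y) (M.nthird σ y) (M.step σ y))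
  rw [← h.leading_eq] at hquad
  simp only [Pi.zero_apply, mul_zero, Finset.sum_const_zero, add_zero, zero_sub, abs_neg,
    Pi.neg_apply, abs_zero, zero_add] at hquad
  have hpow : x ^ 2 / M.dstar ^ 2 ≤ x ^ 3 / M.dstar :=
    div_le_div₀ (by positivity) (pow_le_pow_right₀ hx1 (by norm_num)) hd
      (le_self_pow₀ hd1 two_ne_zero)
  calc |M.leading η σ y|
      ≤ K / M.dstar * ((B + B * (B + B ^ 2)) * x ^ 3) +
          1 / 2 * (K / M.dstar ^ 2 * ((B * x) * (B * x))) := hquad.trans <| by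
        gcongr
        exact hsecond
    _ = K * (B + B * (B + B ^ 2)) * (x ^ 3 / M.dstar) +
          1 / 2 * (K * B ^ 2 * (x ^ 2 / M.dstar ^ 2)) := by ring
    _ ≤ K * (B + B * (B + B ^ 2)) * (x ^ 3 / M.dstar) +
          1 * (K * B ^ 2 * (x ^ 3 / M.dstar)) := by
        gcongr
        norm_num
    _ = _ := by ring

lemma exists_abs_eta_sub_leading_le (s : ℕ) {m K : ℝ} (hm : 0 < m) (hK : 0 ≤ K) :
    ∃ C ≥ 0, ∀ {M : Experiment.{u, v} s} {σ θ : Param s} {δ : ℝ} {U : Set (Param s)}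
      {η : Param s → ℝ} {y : M.𝒴} {x : ℝ}, M.Expandable σ δ U m K η → M.Dominates σ δ y x →
      θ ∈ M.box σ δ → M.a θ y = 0 →
      4 * ((s : ℝ) ^ 2 * (1 / m)) * (x * (1 + ∑ j, |M.ndev σ θ j|)) ≤ M.dstar →
      4 * ((s : ℝ) ^ 2 * (1 / m)) * (x * (∑ j, |M.ndev σ θ j|) ^ 2) ≤ M.dstar ^ 2 →
      |η θ - η σ - M.leading η σ y| ≤ C * (x ^ 6 / M.dstar ^ 3) := by
  obtain ⟨C, hC, hexpand⟩ := exists_perturbedRoot_expansion (Fin s) (one_div_pos.2 hm).le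
  refine ⟨K * C ^ 3 + K * C + K * C ^ 2, by positivity, ?_⟩
  intro M σ θ δ U η y x h hx hθ hroot hsmall hsmall'
  have hd := h.dstar_pos
  have hx1 := hx.one_le
  obtain ⟨hN, hfirst, hsub, hsub'⟩ := hexpand (h.regularOn.isPerturbedRoot_ndev h.d_pos h.δ_nonneg
    h.box_subset h.one_le_dstar h.m_pos h.isNegDefBy hx hθ hroot)
    (by rwa [Fintype.card_fin]) (by rwa [Fintype.card_fin])
  have htaylor := (h.smoothBound.abs_sub_taylor_le h.d_pos hd h.δ_nonneg h.regularOn.isOpen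
    h.contDiffOn h.box_subset hθ).trans (b := _) (c := K * C ^ 3 * (x ^ 6 / M.dstar ^ 3)) <|
    calc K / M.dstar ^ 3 * (∑ j, |M.ndev σ θ j|) ^ 3 ≤ K / M.dstar ^ 3 * (C * x) ^ 3 := by gcongr
      _ = K * C ^ 3 * (x ^ 3 / M.dstar ^ 3) := by ring
      _ ≤ K * C ^ 3 * (x ^ 6 / M.dstar ^ 3) := by
        gcongr K * C ^ 3 * (?_ / M.dstar ^ 3)
        exact pow_le_pow_right₀ hx1 (by norm_num)
  have hquad := (abs_quadratic_sub_le h.abs_gradVec_div_le h.abs_hessMat_div_le (M.ndev σ θ)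
    (M.step σ y) (M.step σ y - (M.Q σ)⁻¹ *ᵥ secondOrder (M.nhess σ y) (M.nthird σ y)
    (M.step σ y))).trans (b := _) (c := (K * C + K * C ^ 2) * (x ^ 6 / M.dstar ^ 3)) <|
    calc _ ≤ K / M.dstar * (C * (x ^ 6 / M.dstar ^ 2)) +
          1 / 2 * (K / M.dstar ^ 2 * (C * (x ^ 4 / M.dstar) * (C * x + C * x))) := by
          gcongr
          exacts [hsub', hsub, hfirst]
      _ = K * C * (x ^ 6 / M.dstar ^ 3) + K * C ^ 2 * (x ^ 5 / M.dstar ^ 3) := by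
        field_simp
        ring
      _ ≤ K * C * (x ^ 6 / M.dstar ^ 3) + K * C ^ 2 * (x ^ 6 / M.dstar ^ 3) := by
        gcongr K * C * (x ^ 6 / M.dstar ^ 3) + K * C ^ 2 * (?_ / M.dstar ^ 3)
        exact pow_le_pow_right₀ hx1 (by norm_num)
      _ = (K * C + K * C ^ 2) * (x ^ 6 / M.dstar ^ 3) := by ring
  rw [← h.leading_eq] at hquad
  calc |η θ - η σ - M.leading η σ y| ≤ _ := abs_sub_le _ _ _
    _ ≤ _ := add_le_add htaylor hquad
    _ = _ := by ring

end Experiment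

section Moments

variable {Ω : Type*} [MeasurableSpace Ω] {μ : Measure Ω} {X : Ω → ℝ≥0∞} {g : ℝ} {K : ℝ≥0}

lemma measure_ofReal_le_of_lintegral_rpow_le (hX : Measurable X) (hg : 0 < g)
    (hK : ∫⁻ ω, X ω ^ g ∂μ ≤ K) {c : ℝ} (hc : 0 < c) :
    μ {ω | ENNReal.ofReal c ≤ X ω} ≤ ENNReal.ofReal (K * c ^ (-g)) := by
  have hcg : 0 < c ^ g := Real.rpow_pos_of_pos hc g
  have hmarkov := mul_meas_ge_le_lintegral (μ := μ) (hX.pow_const g) (ENNReal.ofReal c ^ g)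
  simp only [ENNReal.rpow_le_rpow_iff hg] at hmarkov
  rw [ENNReal.ofReal_rpow_of_pos hc] at hmarkov
  rw [Real.rpow_neg hc.le, ← div_eq_mul_inv, ENNReal.ofReal_div_of_pos hcg,
    ENNReal.ofReal_coe_nnreal, ENNReal.le_div_iff_mul_le (Or.inl (ENNReal.ofReal_pos.2 hcg).ne')
      (Or.inl ENNReal.ofReal_ne_top), mul_comm]
  exact hmarkov.trans hK

lemma ae_ne_top_of_lintegral_rpow_le (hX : Measurable X) (hg : 0 < g)
    (hK : ∫⁻ ω, X ω ^ g ∂μ ≤ K) : ∀ᵐ ω ∂μ, X ω ≠ ∞ := by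
  filter_upwards [ae_lt_top (hX.pow_const g) (ne_top_of_le_ne_top ENNReal.coe_ne_top hK)] with ω hω
  rw [← lt_top_iff_ne_top]
  exact (ENNReal.rpow_lt_top_iff_of_pos hg).1 hω

lemma integrable_toReal_rpow (hX : Measurable X) (hK : ∫⁻ ω, X ω ^ g ∂μ ≤ K) :
    Integrable (fun ω => (X ω).toReal ^ g) μ := by
  simpa only [ENNReal.toReal_rpow] using integrable_toReal_of_lintegral_ne_top
    (hX.pow_const g).aemeasurable (ne_top_of_le_ne_top ENNReal.coe_ne_top hK)

lemma integral_toReal_rpow_le (hX : Measurable X) (hK : ∫⁻ ω, X ω ^ g ∂μ ≤ K) :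
    ∫ ω, (X ω).toReal ^ g ∂μ ≤ K := by
  simp only [ENNReal.toReal_rpow]
  rw [integral_toReal (hX.pow_const g).aemeasurable
    (ae_lt_top (hX.pow_const g) (ne_top_of_le_ne_top ENNReal.coe_ne_top hK))]
  exact ENNReal.toReal_le_coe_of_le_coe hK

lemma abs_integral_le_of_abs_le_pow [IsProbabilityMeasure μ] (hX : Measurable X)
    (hX1 : ∀ ω, 1 ≤ X ω) {p : ℕ} (hp : p ≠ 0) (hg : p ≤ g) (hK : ∫⁻ ω, X ω ^ g ∂μ ≤ K) {N : Set Ω}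
    (hN : MeasurableSet N) {ψ : Ω → ℝ} {a a' b b' : ℝ} (ha : 0 ≤ a) (ha' : 0 ≤ a') (hb : 0 ≤ b)
    (hoff : ∀ ω, X ω ≠ ∞ → ω ∉ N → |ψ ω| ≤ a * (X ω).toReal ^ p + b)
    (hon : ∀ ω, X ω ≠ ∞ → ω ∈ N → |ψ ω| ≤ a' * (X ω).toReal ^ p + b') :
    |∫ ω, ψ ω ∂μ| ≤ (a + a') * K + b + b' * μ.real N := by
  have hg0 : 0 < g := hg.trans_lt' (by positivity)
  have hint := (integrable_toReal_rpow hX hK).const_mul (a + a')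
  have hint' : Integrable (fun ω => (a + a') * (X ω).toReal ^ g + b) μ :=
    hint.add (integrable_const b)
  have hind : Integrable (N.indicator fun _ => b') μ := (integrable_const b').indicator hN
  have hle : ∀ᵐ ω ∂μ,
      ‖ψ ω‖ ≤ (a + a') * (X ω).toReal ^ g + b + N.indicator (fun _ => b') ω := by
    filter_upwards [ae_ne_top_of_lintegral_rpow_le hX hg0 hK] with ω hω
    have hpow : (X ω).toReal ^ p ≤ (X ω).toReal ^ g := by
      rw [← Real.rpow_natCast]
      exact Real.rpow_le_rpow_of_exponent_le (ENNReal.toReal_mono hω (hX1 ω)) hg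
    have := mul_le_mul_of_nonneg_left hpow ha
    have := mul_le_mul_of_nonneg_left hpow ha'
    have : 0 ≤ (X ω).toReal ^ p := by positivity
    rw [Real.norm_eq_abs]
    by_cases hmem : ω ∈ N
    · rw [Set.indicator_of_mem hmem]
      linarith [hon ω hω hmem, mul_nonneg ha this]
    · rw [Set.indicator_of_notMem hmem]
      linarith [hoff ω hω hmem, mul_nonneg ha' this]
  calc |∫ ω, ψ ω ∂μ|
      ≤ ∫ ω, ((a + a') * (X ω).toReal ^ g + b + N.indicator (fun _ => b') ω) ∂μ :=
        norm_integral_le_of_norm_le (hint'.add hind) hle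
    _ = (a + a') * ∫ ω, (X ω).toReal ^ g ∂μ + b + b' * μ.real N := by
        rw [integral_add hint' hind, integral_add hint (integrable_const b), integral_const_mul,
          integral_indicator_const _ hN, integral_const, probReal_univ, one_smul, smul_eq_mul,
          mul_comm b']
    _ ≤ (a + a') * K + b + b' * μ.real N := by
        gcongr
        exact integral_toReal_rpow_le hX hK

end Moments

lemma exists_pos_forall_le_sqrt {c k : ℝ} (hc : 0 ≤ c) (hk : 0 ≤ k) :
    ∃ ε > 0, ∀ {d x N : ℝ}, 1 ≤ d → 0 ≤ x → x ≤ ε * √d → 0 ≤ N → N ≤ k * √d →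
      c * (x * (1 + N)) ≤ d ∧ c * (x * N ^ 2) ≤ d ^ 2 := by
  set c' := c * (1 + k) ^ 2 with hc'
  refine ⟨1 / (c' + 1), by positivity, fun {d x N} hd hx0 hx hN0 hN => ?_⟩
  have hq : √d * √d = d := Real.mul_self_sqrt (by linarith)
  have hq1 : 1 ≤ √d := Real.one_le_sqrt.2 hd
  have hcx : c' * x ≤ √d := by
    rw [div_mul_eq_mul_div, le_div_iff₀ (by positivity)] at hx
    linarith
  constructor
  · calc c * (x * (1 + N)) ≤ c * (x * ((1 + k) * ((1 + k) * √d))) := by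
          gcongr
          nlinarith
      _ = c' * x * √d := by ring
      _ ≤ √d * √d := by gcongr
      _ = d := hq
  · calc c * (x * N ^ 2) ≤ c * (x * (k * √d) ^ 2) := by gcongr
      _ = c * k ^ 2 * x * (√d * √d) := by ring
      _ ≤ c' * x * (√d * √d) := by
          rw [hc']
          gcongr
          linarith
      _ ≤ √d * (√d * √d) := by gcongr
      _ ≤ d ^ 2 := by
          rw [hq, sq]
          gcongr
          exact (Real.sqrt_le_left (by linarith)).2 (by nlinarith)

namespace Experiment

variable {s : ℕ} {M : Experiment.{u, v} s} {σ θ σstar : Param s} {U : Set (Param s)} {y : M.𝒴}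
  {δ r m K c₀ κ : ℝ} {η : Param s → ℝ} {σhat : M.𝒴 → Param s}

lemma mem_box_of_vecNorm_ndev_le (hd : ∀ i, 0 < M.d i)
    (h : vecNorm (M.ndev σ θ) ≤ r * M.dstar) : θ ∈ M.box σ r := fun i => by
  have hi := (abs_apply_le_vecNorm (M.ndev σ θ) i).trans h
  rwa [ndev, abs_mul, abs_of_pos (hd i), mul_comm, ← le_div_iff₀ (hd i)] at hi

lemma exists_abs_eta_sub_leading_le_of_le_sqrt (s : ℕ) {m K : ℝ} (hm : 0 < m) (hK : 0 ≤ K) :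
    ∃ ε > 0, ∃ C ≥ 0, ∀ {M : Experiment.{u, v} s} {σ θ : Param s} {δ : ℝ} {U : Set (Param s)}
      {η : Param s → ℝ} {y : M.𝒴} {x : ℝ}, M.Expandable σ δ U m K η → M.Dominates σ δ y x →
      x ≤ ε * √M.dstar → θ ∈ M.box σ δ → M.a θ y = 0 → vecNorm (M.ndev σ θ) ≤ √M.dstar →
      |η θ - η σ - M.leading η σ y| ≤ C * (x ^ 6 / M.dstar ^ 3) := by
  obtain ⟨C, hC, hexpand⟩ := exists_abs_eta_sub_leading_le.{u, v} s hm hK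
  obtain ⟨ε, hε, hsmall⟩ := exists_pos_forall_le_sqrt
    (by positivity : 0 ≤ 4 * ((s : ℝ) ^ 2 * (1 / m))) s.cast_nonneg
  refine ⟨ε, hε, C, hC, fun {M σ θ δ U η y x} h hx hxε hθ hroot hnorm => ?_⟩
  have hN : ∑ j, |M.ndev σ θ j| ≤ s * √M.dstar := by
    simpa only [Finset.card_univ, Fintype.card_fin, nsmul_eq_mul] using
      Finset.sum_le_card_nsmul Finset.univ _ _ fun j _ =>
        (abs_apply_le_vecNorm (M.ndev σ θ) j).trans hnorm
  obtain ⟨h₁, h₂⟩ := hsmall h.one_le_dstar (zero_le_one.trans hx.one_le) hxε (by positivity) hN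
  exact hexpand h hx hθ hroot h₁ h₂

lemma abs_etaHat_le (hc₀ : 0 ≤ c₀) (hd : 0 ≤ M.dstar) {K : ℝ}
    (hσstar : |η σstar| ≤ K * M.dstar ^ κ) (σhat : M.𝒴 → Param s) (y : M.𝒴) :
    |M.etaHat η c₀ κ σstar σhat y| ≤ (c₀ + |K|) * M.dstar ^ κ := by
  have hκ : 0 ≤ M.dstar ^ κ := Real.rpow_nonneg hd κ
  rw [etaHat, add_mul]
  split_ifs with h
  · linarith [mul_nonneg (abs_nonneg K) hκ]
  · linarith [mul_le_mul_of_nonneg_right (le_abs_self K) hκ, mul_nonneg hc₀ hκ]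

lemma hasExpect_etaHat (hc₀ : 0 ≤ c₀) (hd : 0 ≤ M.dstar) {K : ℝ}
    (hσstar : |η σstar| ≤ K * M.dstar ^ κ)
    (hmeas : Measurable (M.etaHat η c₀ κ σstar σhat)) (θ : Param s) :
    M.HasExpect θ (M.etaHat η c₀ κ σstar σhat) :=
  .of_bound (hmeas.comp M.measurable_Y).aestronglyMeasurable _ <| .of_forall fun ω =>
    abs_etaHat_le hc₀ hd hσstar σhat (M.Y ω)

/-- What is left of `η̂ - η(σ)` after its leading part, centred at its mean, has been removed. -/
noncomputable def remainder (M : Experiment.{u, v} s) (η : Param s → ℝ) (c₀ κ : ℝ)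
    (σstar σ : Param s) (σhat : M.𝒴 → Param s) (y : M.𝒴) : ℝ :=
  M.etaHat η c₀ κ σstar σhat y - η σ - (M.leading η σ y - M.bias η σ)

namespace Expandable

lemma hasMean_remainder (h : M.Expandable σ δ U m K η) (hexp : M.ExpectationsExist σ)
    (hη : M.HasExpect σ (M.etaHat η c₀ κ σstar σhat)) :
    M.HasMean σ (M.remainder η c₀ κ σstar σ σhat)
      (M.expect σ (M.etaHat η c₀ κ σstar σhat) - η σ) := by
  have hlead := hexp.hasMean_leading h.d_pos (isUnit_det_A h.isUnit_det_Q) h.isSymm_A η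
  have := (hη.hasMean.sub (.const (η σ))).sub (hlead.sub (.const (M.bias η σ)))
  rwa [sub_self, sub_zero] at this

lemma abs_remainder_le_of_mem_box (h : M.Expandable σ δ U m K η) (hmem : σhat y ∈ M.box σ δ)
    {e : ℝ} (hexpand : |η (σhat y) - η σ - M.leading η σ y| ≤ r)
    (hbias : |M.bias η (σhat y) - M.bias η σ| ≤ e)
    (htrunc : K + |M.bias η σ| + e ≤ c₀ * M.dstar ^ κ) :
    |M.remainder η c₀ κ σstar σ σhat y| ≤ r + e := by
  have hval : M.etaHat η c₀ κ σstar σhat y = η (σhat y) - M.bias η (σhat y) := by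
    refine if_pos (le_trans ?_ htrunc)
    calc |η (σhat y) - M.bias η (σhat y)|
        = |η (σhat y) - M.bias η σ - (M.bias η (σhat y) - M.bias η σ)| := by ring_nf
      _ ≤ |η (σhat y)| + |M.bias η σ| + |M.bias η (σhat y) - M.bias η σ| :=
          (abs_sub _ _).trans (add_le_add_left (abs_sub _ _) _)
      _ ≤ K + |M.bias η σ| + e := by
          gcongr
          exact h.smoothBound.zero_le _ hmem
  calc |M.remainder η c₀ κ σstar σ σhat y|
      = |(η (σhat y) - η σ - M.leading η σ y) - (M.bias η (σhat y) - M.bias η σ)| := by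
        rw [remainder, hval]
        ring_nf
    _ ≤ r + e := (abs_sub _ _).trans (add_le_add hexpand hbias)

lemma abs_remainder_le (h : M.Expandable σ δ U m K η) {Kstar L : ℝ} (hc₀ : 0 ≤ c₀) (hκ : 0 ≤ κ)
    (hσstar : |η σstar| ≤ Kstar * M.dstar ^ κ) (hL : |M.bias η σ| ≤ L)
    (hlead : |M.leading η σ y| ≤ r) :
    |M.remainder η c₀ κ σstar σ σhat y| ≤ (c₀ + |Kstar| + K + L) * M.dstar ^ κ + r := by
  have hp : 1 ≤ M.dstar ^ κ := Real.one_le_rpow h.one_le_dstar hκ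
  have hη := h.smoothBound.zero_le σ h.self_mem_box
  calc |M.remainder η c₀ κ σstar σ σhat y|
      ≤ |M.etaHat η c₀ κ σstar σhat y| + |η σ| + (|M.leading η σ y| + |M.bias η σ|) :=
        (abs_sub _ _).trans (add_le_add (abs_sub _ _) (abs_sub _ _))
    _ ≤ (c₀ + |Kstar|) * M.dstar ^ κ + K * M.dstar ^ κ +
          (r + L * M.dstar ^ κ) := by
        gcongr
        · exact abs_etaHat_le hc₀ h.dstar_pos.le hσstar σhat y
        · exact hη.trans (le_mul_of_one_le_right h.K_nonneg hp)
        · exact hL.trans (le_mul_of_one_le_right ((abs_nonneg _).trans hL) hp)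
    _ = _ := by ring

end Expandable

end Experiment

section Rates

lemma isLittleO_rpow_rpow_atTop {p q : ℝ} (h : p < q) :
    (fun x : ℝ => x ^ p) =o[atTop] fun x : ℝ => x ^ q := by
  have hlim := ((isLittleO_one_iff ℝ).2 (tendsto_rpow_neg_atTop (sub_pos.2 h))).mul_isBigO
    (isBigO_refl (fun x : ℝ => x ^ q) atTop)
  simp only [one_mul] at hlim
  refine hlim.congr' ?_ .rfl
  filter_upwards [eventually_gt_atTop 0] with x hx
  rw [← Real.rpow_add hx, neg_sub, sub_add_cancel]

lemma isLittleO_error_rpow_neg_two {κ g : ℝ} (hκ : 0 < κ) (hg : 8 + 4 * κ < g) (a b c : ℝ) :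
    (fun d : ℝ => a / d ^ 3 + b / (d ^ 2 * d ^ κ) + c * (d ^ κ * d ^ (-(g / 4)))) =o[atTop]
      fun d => d ^ (-2 : ℝ) := by
  have ha := (isLittleO_rpow_rpow_atTop (p := -3) (q := -2) (by norm_num)).const_mul_left a
  have hb := (isLittleO_rpow_rpow_atTop (p := -(2 + κ)) (q := -2) (by linarith)).const_mul_left b
  have hc := (isLittleO_rpow_rpow_atTop (p := κ + -(g / 4)) (q := -2)
    (by linarith)).const_mul_left c
  refine ((ha.add hb).add hc).congr' ?_ .rfl
  filter_upwards [eventually_gt_atTop 0] with d hd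
  rw [Real.rpow_neg hd.le, Real.rpow_neg hd.le, Real.rpow_add hd, Real.rpow_add hd,
    div_eq_mul_inv a, div_eq_mul_inv b, Real.rpow_ofNat, Real.rpow_ofNat]

lemma isLittleO_rpow_neg_two_of_abs_le {κ g a b c : ℝ} (hκ : 0 < κ) (hg : 8 + 4 * κ < g)
    {u d : ℕ → ℝ} (hd : Tendsto d atTop atTop)
    (h : ∀ e > 0, ∀ᶠ n in atTop, |u n| ≤ a / d n ^ 3 + b / (d n ^ 2 * d n ^ κ) +
      e / d n ^ 2 + c * (d n ^ κ * d n ^ (-(g / 4)))) :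
    u =o[atTop] fun n => d n ^ (-2 : ℝ) := by
  refine isLittleO_iff.2 fun e he => ?_
  filter_upwards [h (e / 2) (half_pos he), hd.eventually_gt_atTop 0,
    hd.eventually ((isLittleO_error_rpow_neg_two hκ hg a b c).def (half_pos he))] with n hu hd hrate
  rw [Real.norm_eq_abs, Real.norm_of_nonneg (by positivity)] at hrate ⊢
  have hinv : e / 2 / d n ^ 2 = e / 2 * d n ^ (-2 : ℝ) := by
    rw [Real.rpow_neg hd.le, Real.rpow_ofNat, div_eq_mul_inv]
  linarith [(le_abs_self _).trans hrate]

lemma cube_div_le {x d p : ℝ} (hd : 0 < d) (hp : 0 < p) :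
    x ^ 3 / d ≤ x ^ 6 / (d ^ 2 * p) + p := by
  have hsplit : x ^ 6 / (d ^ 2 * p) + p - x ^ 3 / d =
      ((x ^ 3 / d - p / 2) ^ 2 + 3 / 4 * p ^ 2) / p := by
    field_simp
    ring
  have : 0 ≤ ((x ^ 3 / d - p / 2) ^ 2 + 3 / 4 * p ^ 2) / p := by positivity
  linarith

lemma eventually_sqrt_le_mul {r : ℝ} (hr : 0 < r) : ∀ᶠ d : ℝ in atTop, √d ≤ r * d := by
  filter_upwards [Real.tendsto_sqrt_atTop.eventually_ge_atTop (1 / r), eventually_ge_atTop 0]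
    with d hd hd0
  rw [div_le_iff₀ hr] at hd
  calc √d ≤ √d * (√d * r) := le_mul_of_one_le_right (Real.sqrt_nonneg d) hd
    _ = r * d := by rw [← mul_assoc, Real.mul_self_sqrt hd0, mul_comm]

end Rates

section Tame

variable {s : ℕ} {M : ℕ → Experiment.{u, v} s} {σ : Param s} {f : ℕ → Param s → ℝ}

lemma Tame.exists_eventually_abs_le (h : Tame M σ fun n θ => (M n).dstar ^ 2 * f n θ)
    (hdstar : Tendsto (fun n => (M n).dstar) atTop atTop) : ∃ L, ∀ᶠ n in atTop, |f n σ| ≤ L := by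
  obtain ⟨L, hL⟩ := h.bounded.bound
  refine ⟨L, ?_⟩
  filter_upwards [hL, hdstar.eventually_ge_atTop 1] with n hL hd
  rw [norm_one, mul_one, Real.norm_eq_abs, abs_mul, abs_of_nonneg (sq_nonneg _)] at hL
  exact (le_mul_of_one_le_left (abs_nonneg _) (one_le_pow₀ hd)).trans hL

lemma Tame.exists_eventually_abs_sub_le (h : Tame M σ fun n θ => (M n).dstar ^ 2 * f n θ)
    (hd : ∀ n i, 0 < (M n).d i) (hdstar : Tendsto (fun n => (M n).dstar) atTop atTop) {e : ℝ}
    (he : 0 < e) :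
    ∃ r > 0, ∀ᶠ n in atTop, ∀ θ ∈ (M n).box σ r, |f n θ - f n σ| ≤ e / (M n).dstar ^ 2 := by
  obtain ⟨r, hr, hbound⟩ := (eventually_shrinkingBoxes hd).1
    (h.tendsto.abs.eventually_le_const (by rwa [abs_zero]) : ∀ᶠ p in shrinkingBoxes M σ, _ ≤ e)
  refine ⟨r, hr, ?_⟩
  filter_upwards [hbound, hdstar.eventually_gt_atTop 0] with n hbound hd θ hθ
  have hθ := hbound θ hθ
  rw [← mul_sub, abs_mul, abs_of_nonneg (sq_nonneg _)] at hθ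
  rwa [le_div_iff₀' (by positivity)]

end Tame

section ExceptionalSet

variable {s : ℕ} {M : ℕ → Experiment.{u, v} s} {Θ : Set (Param s)} {σ : Param s} {g ε : ℝ}
  {f : ∀ n, (M n).𝒴 → ℝ≥0∞} {σhat : ∀ n, (M n).𝒴 → Param s}

lemma MeasurableMomentsBounded.exists_measure_rpow_le (hf : MeasurableMomentsBounded M σ g f)
    (hg : 0 < g) (hε : 0 < ε) (τ : ℝ) :
    ∃ C ≥ 0, ∀ n, 0 < (M n).dstar →
      (M n).P σ {ω | ENNReal.ofReal (ε * (M n).dstar ^ τ) ≤ f n ((M n).Y ω)} ≤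
        ENNReal.ofReal (C * (M n).dstar ^ (-(τ * g))) := by
  obtain ⟨hmeas, K, hK⟩ := hf
  refine ⟨K * ε ^ (-g), by positivity, fun n hd => ?_⟩
  have hpow := Real.rpow_pos_of_pos hd τ
  refine (measure_ofReal_le_of_lintegral_rpow_le ((hmeas n).comp (M n).measurable_Y) hg (hK n)
    (mul_pos hε hpow)).trans_eq ?_
  rw [Real.mul_rpow hε.le hpow.le, ← Real.rpow_mul hd.le, mul_assoc, mul_neg]

lemma IsScoreRoot.exists_exceptionalSet (hroot : IsScoreRoot M Θ σ g σhat)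
    (hf : MeasurableMomentsBounded M σ g f) (hg : 0 < g) (hε : 0 < ε)
    (hdstar : Tendsto (fun n => (M n).dstar) atTop atTop) :
    ∃ C, ∀ᶠ n in atTop, ∃ N : Set (M n).Ω, MeasurableSet N ∧
      ((M n).P σ).real N ≤ C * (M n).dstar ^ (-(g / 4)) ∧
      ∀ ω ∉ N, f n ((M n).Y ω) ≤ ENNReal.ofReal (ε * √(M n).dstar) ∧
        (M n).a (σhat n ((M n).Y ω)) ((M n).Y ω) = 0 ∧
        vecNorm ((M n).ndev σ (σhat n ((M n).Y ω))) ≤ √(M n).dstar := by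
  obtain ⟨ℬ, c, hℬ⟩ := hroot.2 (1 / 2) (by norm_num) (by norm_num)
  obtain ⟨C, hC, hlevel⟩ := hf.exists_measure_rpow_le hg hε (1 / 4)
  refine ⟨|c| + C, ?_⟩
  filter_upwards [hℬ, hdstar.eventually_ge_atTop 1] with n ⟨hgood, hbad⟩ hd1
  have hd0 : 0 < (M n).dstar := by linarith
  have hdg : 0 < (M n).dstar ^ (-(g / 4)) := Real.rpow_pos_of_pos hd0 _
  refine ⟨toMeasurable ((M n).P σ) (ℬ n)ᶜ ∪
    {ω | ENNReal.ofReal (ε * (M n).dstar ^ (1 / 4 : ℝ)) ≤ f n ((M n).Y ω)},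
    (measurableSet_toMeasurable _ _).union
      (measurableSet_le measurable_const ((hf.1 n).comp (M n).measurable_Y)), ?_, fun ω hω => ?_⟩
  · refine ENNReal.toReal_le_of_le_ofReal (by positivity) ((measure_union_le _ _).trans ?_)
    rw [measure_toMeasurable, add_mul, ENNReal.ofReal_add (by positivity) (by positivity)]
    refine add_le_add (hbad.trans (ENNReal.ofReal_le_ofReal ?_)) ((hlevel n hd0).trans_eq ?_)
    · rw [min_eq_left (by norm_num), one_div_mul_eq_div]
      exact mul_le_mul_of_nonneg_right (le_abs_self c) hdg.le
    · rw [one_div_mul_eq_div]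
  · rw [Set.mem_union, not_or] at hω
    obtain ⟨_, hscore, hdev⟩ := hgood ω (not_not.1 fun h => hω.1 (subset_toMeasurable _ _ h))
    refine ⟨(not_le.1 hω.2).le.trans (ENNReal.ofReal_le_ofReal ?_), hscore, hdev.le.trans_eq ?_⟩
    · rw [Real.sqrt_eq_rpow]
      exact mul_le_mul_of_nonneg_left (Real.rpow_le_rpow_of_exponent_le hd1 (by norm_num)) hε.le
    · rw [Real.sqrt_eq_rpow]
      norm_num

end ExceptionalSet

section Expansion

variable {s : ℕ}

namespace Experiment

variable {M : Experiment.{u, v} s} {σ σstar : Param s} {U : Set (Param s)}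
  {δ m K c₀ κ g : ℝ} {η : Param s → ℝ} {σhat : M.𝒴 → Param s}

lemma Expandable.abs_expect_etaHat_sub_le (h : M.Expandable σ δ U m K η)
    (hexp : M.ExpectationsExist σ) (hmeas : Measurable (M.etaHat η c₀ κ σstar σhat))
    (hc₀ : 0 ≤ c₀) (hκ : 0 ≤ κ) {Kstar L : ℝ}
    (hσstar : |η σstar| ≤ Kstar * M.dstar ^ κ) (hL : |M.bias η σ| ≤ L)
    (hX : Measurable (M.envelope σ δ)) (hg : 6 ≤ g) {KX : ℝ≥0}
    (hKX : ∫⁻ ω, M.envelope σ δ (M.Y ω) ^ g ∂(M.P σ) ≤ KX) {C₁ : ℝ} (hC₁ : 0 ≤ C₁)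
    (hlead : ∀ {y x}, M.Dominates σ δ y x → |M.leading η σ y| ≤ C₁ * (x ^ 3 / M.dstar))
    {N : Set M.Ω} (hN : MeasurableSet N) {p : ℝ} (hPN : (M.P σ).real N ≤ p) {C e : ℝ}
    (hC : 0 ≤ C) (he : 0 ≤ e)
    (hoff : ∀ ω, M.envelope σ δ (M.Y ω) ≠ ∞ → ω ∉ N → |M.remainder η c₀ κ σstar σ σhat (M.Y ω)| ≤
      C * ((M.envelope σ δ (M.Y ω)).toReal ^ 6 / M.dstar ^ 3) + e) :
    |M.expect σ (M.etaHat η c₀ κ σstar σhat) - η σ| ≤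
      C * KX / M.dstar ^ 3 + C₁ * KX / (M.dstar ^ 2 * M.dstar ^ κ) + e +
        (c₀ + |Kstar| + K + L + C₁) * (M.dstar ^ κ * p) := by
  have hd := h.dstar_pos
  have hdκ : 0 < M.dstar ^ κ := Real.rpow_pos_of_pos hd κ
  obtain ⟨-, hmean⟩ := h.hasMean_remainder hexp (hasExpect_etaHat hc₀ hd.le hσstar hmeas σ)
  rw [← hmean]
  have hcoef : 0 ≤ c₀ + |Kstar| + K + L + C₁ := by
    linarith [abs_nonneg Kstar, h.K_nonneg, (abs_nonneg _).trans hL]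
  suffices hint : |∫ ω, M.remainder η c₀ κ σstar σ σhat (M.Y ω) ∂(M.P σ)| ≤
      (C / M.dstar ^ 3 + C₁ / (M.dstar ^ 2 * M.dstar ^ κ)) * KX + e +
        (c₀ + |Kstar| + K + L + C₁) * M.dstar ^ κ * (M.P σ).real N by
    refine hint.trans ?_
    rw [add_mul, div_mul_eq_mul_div, div_mul_eq_mul_div, mul_assoc _ (M.dstar ^ κ)]
    gcongr
  refine abs_integral_le_of_abs_le_pow (p := 6) (hX.comp M.measurable_Y)
    (fun ω => M.one_le_envelope σ δ (M.Y ω)) (by norm_num) (by exact_mod_cast hg) hKX hN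
    (by positivity) (by positivity) he (fun ω hω hmem => (hoff ω hω hmem).trans_eq ?_)
    fun ω hω _ => (h.abs_remainder_le hc₀ hκ hσstar hL
      (hlead (dominates_envelope h.d_pos hd hω))).trans ?_
  · rw [div_mul_eq_mul_div, mul_div_assoc]
    rfl
  · calc _ ≤ _ + C₁ * (_ / (M.dstar ^ 2 * M.dstar ^ κ) + _) := by
          gcongr
          exact cube_div_le hd hdκ
      _ = _ := by
        simp only [Function.comp_apply]
        ring

end Experiment

variable {M : ℕ → Experiment.{u, v} s} {Θ U : Set (Param s)} {σ σstar : Param s}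
  {η : ℕ → Param s → ℝ} {δ m K c₀ κ g Kstar : ℝ} {σhat : ∀ n, (M n).𝒴 → Param s}

theorem isLittleO_expect_etaHat (hc₀ : 0 < c₀) (hκ : 0 < κ) (hδ : 0 < δ) (hg : 8 + 4 * κ < g)
    (hd : ∀ n i, 0 < (M n).d i) (hdstar : Tendsto (fun n => (M n).dstar) atTop atTop)
    (hexpand : ∀ᶠ n in atTop, (M n).Expandable σ δ U m K (η n))
    (hησstar : ∀ n, |η n σstar| ≤ Kstar * (M n).dstar ^ κ)
    (hX : MeasurableMomentsBounded M σ g fun n => (M n).envelope σ δ)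
    (hexp : ∀ n, (M n).ExpectationsExist σ)
    (htame : Tame M σ fun n θ => (M n).dstar ^ 2 * (M n).bias (η n) θ)
    (hroot : IsScoreRoot M Θ σ g σhat)
    (hmeas : ∀ n, Measurable ((M n).etaHat (η n) c₀ κ σstar (σhat n))) :
    (fun n => (M n).expect σ ((M n).etaHat (η n) c₀ κ σstar (σhat n)) - η n σ)
      =o[atTop] fun n => (M n).dstar ^ (-2 : ℝ) := by
  obtain ⟨n₀, hn₀⟩ := hexpand.exists
  obtain ⟨C₁, hC₁, hlead⟩ := exists_abs_leading_le.{u, v} s hn₀.m_pos hn₀.K_nonneg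
  obtain ⟨ε, hε, C, hC, hsmall⟩ :=
    exists_abs_eta_sub_leading_le_of_le_sqrt.{u, v} s hn₀.m_pos hn₀.K_nonneg
  obtain ⟨Cₙ, hN⟩ := hroot.exists_exceptionalSet hX (by linarith) hε hdstar
  obtain ⟨L, hL⟩ := htame.exists_eventually_abs_le hdstar
  obtain ⟨KX, hKX⟩ := hX.2
  refine isLittleO_rpow_neg_two_of_abs_le (a := C * KX) (b := C₁ * KX)
    (c := (c₀ + |Kstar| + K + L + C₁) * Cₙ) hκ hg hdstar fun e he => ?_
  obtain ⟨r, hr, hbias⟩ := htame.exists_eventually_abs_sub_le hd hdstar he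
  have hbig : ∀ᶠ n in atTop, K + L + e ≤ c₀ * (M n).dstar ^ κ :=
    (((tendsto_rpow_atTop hκ).comp hdstar).const_mul_atTop hc₀).eventually_ge_atTop _
  filter_upwards [hexpand, hN, hL, hbias, hbig,
    hdstar.eventually (eventually_sqrt_le_mul (lt_min hδ hr))]
    with n hexpand ⟨N, hNmeas, hPN, hgood⟩ hL hbias hbig hsqrt
  have hdpos := hexpand.dstar_pos
  have hnear {θ : Param s} (h : vecNorm ((M n).ndev σ θ) ≤ √(M n).dstar) :=
    mem_box_of_vecNorm_ndev_le (hd n) (h.trans hsqrt)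
  have he' : e / (M n).dstar ^ 2 ≤ e := div_le_self he.le (one_le_pow₀ hexpand.one_le_dstar)
  have hmain := hexpand.abs_expect_etaHat_sub_le (e := e / (M n).dstar ^ 2) (hexp n) (hmeas n)
    hc₀.le hκ.le (hησstar n) hL (hX.1 n) (by linarith) (hKX n) hC₁ (hlead hexpand) hNmeas hPN hC
    (by positivity) fun ω hω hωN => by
      obtain ⟨hx, hscore, hdev⟩ := hgood ω hωN
      have hθ := (M n).box_mono (hd n) (min_le_left _ _) (hnear hdev)
      exact hexpand.abs_remainder_le_of_mem_box hθ
        (hsmall hexpand (dominates_envelope (hd n) hdpos hω)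
          (ENNReal.toReal_le_of_le_ofReal (by positivity) hx) hθ hscore hdev)
        (hbias _ ((M n).box_mono (hd n) (min_le_right _ _) (hnear hdev))) (by linarith)
  exact hmain.trans_eq (by ring)

end Expansion

section Existence

variable {s : ℕ}

lemma vecNorm_le_sum_abs (v : Fin s → ℝ) : vecNorm v ≤ ∑ i, |v i| := by
  rw [vecNorm, EuclideanSpace.norm_eq]
  refine Real.sqrt_le_iff.2 ⟨Finset.sum_nonneg fun i _ => abs_nonneg _, ?_⟩
  simp only [Real.norm_eq_abs]
  exact Finset.sum_sq_le_sq_sum_of_nonneg fun i _ => abs_nonneg _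

namespace Experiment

variable {M : Experiment.{u, v} s} {σ θ : Param s} {U : Set (Param s)} {y : M.𝒴}
  {δ r x m ε : ℝ}

lemma box_mem_nhds (h : ∀ i, |θ i - σ i| < r * M.dstar / M.d i) : M.box σ r ∈ 𝓝 θ := by
  have hnear (i : Fin s) : ∀ᶠ τ : Param s in 𝓝 θ, |τ i - σ i| < r * M.dstar / M.d i :=
    (Continuous.tendsto (by fun_prop) θ).eventually_lt_const (h i)
  filter_upwards [eventually_all.2 hnear] with τ hτ i
  exact (hτ i).le

/-- The normalized Hessian `D⁻¹ F D⁻¹` of the criterion function. -/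
noncomputable def normHess (M : Experiment.{u, v} s) (θ : Param s) (y : M.𝒴) :
    Matrix (Fin s) (Fin s) ℝ :=
  Matrix.of fun i j => M.F θ y i j / (M.d i * M.d j)

/-- The criterion function is strongly concave on `K`, in the first-order form and with modulus `m`
in the metric `|D (θ₂ - θ₁)|`. -/
def StronglyConcaveOn (M : Experiment.{u, v} s) (m : ℝ) (K : Set (Param s)) (y : M.𝒴) : Prop :=
  ∀ θ₁ ∈ K, ∀ θ₂ ∈ K, M.l θ₂ y ≤ M.l θ₁ y + M.nscore θ₁ y ⬝ᵥ M.ndev θ₁ θ₂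
    - m / 2 * (M.ndev θ₁ θ₂ ⬝ᵥ M.ndev θ₁ θ₂)

namespace StronglyConcaveOn

variable {K : Set (Param s)} {θ₁ θ₂ : Param s}

lemma of_isNegDefBy_normHess (hd : ∀ i, 0 < M.d i) (hreg : M.RegularOn U) (hK : Convex ℝ K)
    (hKU : K ⊆ U) (hneg : ∀ θ ∈ K, IsNegDefBy m (M.normHess θ y)) :
    M.StronglyConcaveOn m K y := by
  intro θ₁ h₁ θ₂ h₂
  have hseg (t : ℝ) (ht : t ∈ Set.Icc (0 : ℝ) 1) : θ₁ + t • (θ₂ - θ₁) ∈ K :=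
    hK.add_smul_sub_mem h₁ h₂ ht
  have hscore : ∑ i, (θ₂ - θ₁) i * pderiv i (fun θ => M.l θ y) θ₁ =
      M.nscore θ₁ y ⬝ᵥ M.ndev θ₁ θ₂ := Finset.sum_congr rfl fun i _ => by
    have := (hd i).ne'
    simp only [nscore, lam1, ndev, a, gradVec, PiLp.sub_apply]
    field_simp
  have hhess (θ : Param s) (hθ : θ ∈ K) :
      ∑ i, (θ₂ - θ₁) i * ∑ j, (θ₂ - θ₁) j * pderiv j (pderiv i fun θ => M.l θ y) θ =
        M.ndev θ₁ θ₂ ⬝ᵥ (M.normHess θ y *ᵥ M.ndev θ₁ θ₂) := by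
    simp only [dotProduct, Matrix.mulVec, Finset.mul_sum]
    refine Finset.sum_congr rfl fun i _ => Finset.sum_congr rfl fun j _ => ?_
    have hF : pderiv j (pderiv i fun θ => M.l θ y) θ = M.F θ y i j :=
      hreg.F_symm (hKU hθ) j i y
    have := (hd i).ne'
    have := (hd j).ne'
    simp only [hF, normHess, ndev, Matrix.of_apply, PiLp.sub_apply]
    field_simp
  have htaylor := le_taylor_one_of_sum_pderiv_le hreg.isOpen
    ((hreg.contDiffOn_l y).of_le (by norm_num)) θ₁ (θ₂ - θ₁) (fun t ht => hKU (hseg t ht))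
    (m := m * (M.ndev θ₁ θ₂ ⬝ᵥ M.ndev θ₁ θ₂)) fun t ht => by
      rw [hhess _ (hseg t ht), ← neg_mul]
      exact hneg _ (hseg t ht) _
  rw [add_sub_cancel, hscore] at htaylor
  exact htaylor.trans_eq (by ring)

lemma sum_abs_ndev_le (h : M.StronglyConcaveOn m K y) (hm : 0 < m) (h₁ : θ₁ ∈ K) (h₂ : θ₂ ∈ K)
    (hx : 0 ≤ x) (hscore : ∀ i, |M.nscore θ₁ y i| ≤ x) (hle : M.l θ₁ y ≤ M.l θ₂ y) :
    ∑ i, |M.ndev θ₁ θ₂ i| ≤ 2 * s / m * x := by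
  set N := ∑ i, |M.ndev θ₁ θ₂ i|
  have hN : 0 ≤ N := Finset.sum_nonneg fun _ _ => abs_nonneg _
  have hsq : N * N ≤ s * (M.ndev θ₁ θ₂ ⬝ᵥ M.ndev θ₁ θ₂) := by
    simpa only [N, Finset.sum_mul_sum, Fintype.card_fin] using sum_abs_mul_abs_le (M.ndev θ₁ θ₂)
  have hdot : M.nscore θ₁ y ⬝ᵥ M.ndev θ₁ θ₂ ≤ x * N :=
    (le_abs_self _).trans (abs_sum_mul_le hscore)
  have hquad : m / 2 * (M.ndev θ₁ θ₂ ⬝ᵥ M.ndev θ₁ θ₂) ≤ x * N := by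
    linarith [h θ₁ h₁ θ₂ h₂]
  rw [div_mul_eq_mul_div, le_div_iff₀ hm]
  rcases hN.eq_or_lt with h0 | h0
  · rw [← h0, zero_mul]
    positivity
  · refine le_of_mul_le_mul_right ?_ h0
    calc N * m * N = 2 * (m / 2) * (N * N) := by ring
      _ ≤ 2 * (m / 2) * (s * (M.ndev θ₁ θ₂ ⬝ᵥ M.ndev θ₁ θ₂)) := by gcongr
      _ = 2 * s * (m / 2 * (M.ndev θ₁ θ₂ ⬝ᵥ M.ndev θ₁ θ₂)) := by ring
      _ ≤ 2 * s * (x * N) := by gcongr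
      _ = 2 * s * x * N := by ring

lemma eq_of_le (h : M.StronglyConcaveOn m K y) (hm : 0 < m) (hd : ∀ i, 0 < M.d i)
    (h₁ : θ₁ ∈ K) (h₂ : θ₂ ∈ K) (ha : M.a θ₁ y = 0) (hle : M.l θ₁ y ≤ M.l θ₂ y) : θ₂ = θ₁ := by
  have hsum := h.sum_abs_ndev_le hm h₁ h₂ le_rfl (fun i => by simp [nscore, lam1, ha]) hle
  rw [mul_zero] at hsum
  ext i
  have hi : |M.ndev θ₁ θ₂ i| ≤ 0 :=
    (Finset.single_le_sum (fun _ _ => abs_nonneg _) (Finset.mem_univ i)).trans hsum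
  exact sub_eq_zero.1 ((mul_eq_zero.1 (abs_nonpos_iff.1 hi)).resolve_left (hd i).ne')

end StronglyConcaveOn

lemma a_eq_zero_of_isLocalMax (h : IsLocalMax (fun τ => M.l τ y) θ) : M.a θ y = 0 := by
  funext i
  change fderiv ℝ (fun τ => M.l τ y) θ _ = 0
  rw [h.fderiv_eq_zero, zero_apply]

namespace Nondegenerate

lemma abs_normHess_sub_Q_le (h : M.Nondegenerate σ δ U m) (hx : M.Dominates σ δ y x) (hr : 0 ≤ r)
    (hrδ : r ≤ δ) (hθ : θ ∈ M.box σ r) (i j : Fin s) :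
    |M.normHess θ y i j - M.Q σ i j| ≤ s * (r * x) + x / M.dstar := by
  have hdstar := h.dstar_pos
  have hdij : 0 < M.d i * M.d j := mul_pos (h.d_pos i) (h.d_pos j)
  have hsub := M.box_mono (σ := σ) h.d_pos hrδ
  have hF : |M.F θ y i j - M.F σ y i j| ≤ s * (r * (x * (M.d i * M.d j))) := by
    refine abs_sub_le_of_abs_pderiv_le h.d_pos h.regularOn.isOpen hr (hsub.trans h.box_subset)
      (f := fun τ => M.F τ y i j)
      ((h.regularOn.contDiffOn_F i j y).differentiableOn (by norm_num)) (fun k τ hτ => ?_) hθ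
    rw [← le_div_iff₀ hdstar]
    exact (hx.l3_le k i j τ (hsub hτ)).trans_eq (by ring)
  have hsplit : M.normHess θ y i j - M.Q σ i j =
      (M.F θ y i j - M.F σ y i j) / (M.d i * M.d j) + M.nhess σ y i j := by
    simp only [normHess, Q_apply h.d_pos, nhess, Matrix.of_apply]
    ring
  rw [hsplit]
  refine (abs_add_le _ _).trans (add_le_add ?_ (hx.nhess_le h.d_pos hdstar i j))
  rw [abs_div, abs_of_pos hdij, div_le_iff₀ hdij]
  exact hF.trans_eq (by ring)

lemma stronglyConcaveOn (h : M.Nondegenerate σ δ U m) (hx : M.Dominates σ δ y x) (hr : 0 ≤ r)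
    (hrδ : r ≤ δ) (hε : s * ((s + 1) * ε) ≤ m / 2) (hrx : r * x ≤ ε) (hxd : x ≤ ε * M.dstar) :
    M.StronglyConcaveOn (m / 2) (M.box σ r) y := by
  have hε0 : 0 ≤ ε := (mul_nonneg hr (by linarith [hx.one_le])).trans hrx
  refine .of_isNegDefBy_normHess h.d_pos h.regularOn (M.convex_box σ r)
    ((M.box_mono h.d_pos hrδ).trans h.box_subset) fun θ hθ =>
      h.isNegDefBy.of_close (ε := (s + 1) * ε) (fun i j => ?_) (by positivity) (by simpa)
  calc |M.normHess θ y i j - M.Q σ i j|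
      ≤ s * (r * x) + x / M.dstar := h.abs_normHess_sub_Q_le hx hr hrδ hθ i j
    _ ≤ s * ε + ε := by
        gcongr
        rwa [div_le_iff₀ h.dstar_pos]
    _ = (s + 1) * ε := by ring

lemma exists_unique_maximizer (h : M.Nondegenerate σ δ U m) (hx : M.Dominates σ δ y x) (hr : 0 ≤ r)
    (hrδ : r ≤ δ) (hconc : M.StronglyConcaveOn (m / 2) (M.box σ r) y)
    (hint : 4 * s / m * x < r * M.dstar) :
    ∃ θ ∈ M.box σ r, (∀ θ' ∈ M.box σ r, M.l θ' y ≤ M.l θ y) ∧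
      (∀ θ' ∈ M.box σ r, M.l θ y ≤ M.l θ' y → θ' = θ) ∧ M.a θ y = 0 ∧
      ∑ i, |M.ndev σ θ i| ≤ 4 * s / m * x := by
  have hσ : σ ∈ M.box σ r := M.self_mem_box h.d_pos hr
  have hm := half_pos h.m_pos
  obtain ⟨θ, hθ, hmax⟩ := (M.isCompact_box σ r).exists_isMaxOn ⟨σ, hσ⟩
    ((h.regularOn.contDiffOn_l y).continuousOn.mono
      ((M.box_mono h.d_pos hrδ).trans h.box_subset))
  have hdev : ∑ i, |M.ndev σ θ i| ≤ 4 * s / m * x :=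
    (hconc.sum_abs_ndev_le hm hσ hθ (by linarith [hx.one_le]) (hx.lam1_le h.d_pos)
      (hmax hσ)).trans_eq (by ring)
  have hnhds : M.box σ r ∈ 𝓝 θ := box_mem_nhds fun i => by
    have hi : |M.ndev σ θ i| ≤ ∑ i, |M.ndev σ θ i| :=
      Finset.single_le_sum (f := fun i => |M.ndev σ θ i|) (fun _ _ => abs_nonneg _)
        (Finset.mem_univ i)
    rw [lt_div_iff₀' (h.d_pos i), ← abs_of_pos (h.d_pos i), ← abs_mul]
    exact (hi.trans hdev).trans_lt hint
  have ha := a_eq_zero_of_isLocalMax (Filter.mem_of_superset hnhds fun τ hτ => hmax hτ)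
  exact ⟨θ, hθ, fun θ' hθ' => hmax hθ',
    fun θ' hθ' hle => hconc.eq_of_le hm h.d_pos hθ hθ' ha hle, ha, hdev⟩

lemma exists_unique_maximizer_of_le_rpow (h : M.Nondegenerate σ δ U m)
    (hx : M.Dominates σ δ y x) {τ : ℝ} (hτ : τ ≤ 1 / 4) (hrδ : M.dstar ^ (-(1 / 4) : ℝ) ≤ δ)
    (hxτ : x ≤ m / (4 * (s + 1) ^ 2) * M.dstar ^ τ) :
    ∃ θ ∈ M.box σ (M.dstar ^ (-(1 / 4) : ℝ)),
      (∀ θ' ∈ M.box σ (M.dstar ^ (-(1 / 4) : ℝ)), M.l θ' y ≤ M.l θ y) ∧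
      (∀ θ' ∈ M.box σ (M.dstar ^ (-(1 / 4) : ℝ)), M.l θ y ≤ M.l θ' y → θ' = θ) ∧
      M.a θ y = 0 ∧ ∑ i, |M.ndev σ θ i| < M.dstar ^ τ := by
  have hm := h.m_pos
  have hd := h.dstar_pos
  have hpow {p q : ℝ} (hpq : p ≤ q) : M.dstar ^ p ≤ M.dstar ^ q :=
    Real.rpow_le_rpow_of_exponent_le h.one_le_dstar hpq
  have hr : 0 ≤ M.dstar ^ (-(1 / 4) : ℝ) := Real.rpow_nonneg hd.le _
  set ε : ℝ := m / (4 * (s + 1) ^ 2) with hε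
  have hε0 : 0 < ε := by positivity
  have hεm : 4 * (s + 1) ^ 2 * ε = m := by rw [hε]; field_simp
  have hx4 : x ≤ ε * M.dstar ^ (1 / 4 : ℝ) := hxτ.trans (by gcongr; exact h.one_le_dstar)
  have hrx : M.dstar ^ (-(1 / 4) : ℝ) * x ≤ ε :=
    calc M.dstar ^ (-(1 / 4) : ℝ) * x
        ≤ M.dstar ^ (-(1 / 4) : ℝ) * (ε * M.dstar ^ (1 / 4 : ℝ)) := by gcongr
      _ = ε * M.dstar ^ (-(1 / 4) + 1 / 4 : ℝ) := by rw [Real.rpow_add hd]; ring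
      _ = ε := by norm_num
  have hxd : x ≤ ε * M.dstar :=
    hx4.trans (by gcongr; simpa only [Real.rpow_one] using hpow (q := 1) (by norm_num))
  have hxτ' : 4 * s / m * x < M.dstar ^ τ :=
    calc 4 * s / m * x ≤ 4 * s / m * (ε * M.dstar ^ τ) := by gcongr
      _ = 4 * s / m * ε * M.dstar ^ τ := by ring
      _ < 1 * M.dstar ^ τ := by
          refine mul_lt_mul_of_pos_right ?_ (Real.rpow_pos_of_pos hd τ)
          rw [div_mul_eq_mul_div, div_lt_one hm]
          nlinarith [(s.cast_nonneg : (0 : ℝ) ≤ s)]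
      _ = M.dstar ^ τ := one_mul _
  have hint : M.dstar ^ τ ≤ M.dstar ^ (-(1 / 4) : ℝ) * M.dstar := by
    rw [← Real.rpow_add_one hd.ne']
    exact hpow (by linarith)
  have hconc := h.stronglyConcaveOn hx hr hrδ (by nlinarith [(s.cast_nonneg : (0 : ℝ) ≤ s)]) hrx hxd
  obtain ⟨θ, hθ, hmax, huniq, ha, hdev⟩ :=
    h.exists_unique_maximizer hx hr hrδ hconc (hxτ'.trans_le hint)
  exact ⟨θ, hθ, hmax, huniq, ha, hdev.trans_lt hxτ'⟩

end Nondegenerate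

end Experiment

theorem exists_isScoreRoot {M : ℕ → Experiment.{u, v} s} {Θ U : Set (Param s)} {σ : Param s}
    {g δ m : ℝ} (hδ : 0 < δ) (hg : 0 < g) (hUΘ : U ⊆ Θ)
    (hdstar : Tendsto (fun n => (M n).dstar) atTop atTop)
    (hnd : ∀ᶠ n in atTop, (M n).Nondegenerate σ δ U m)
    (hX : MeasurableMomentsBounded M σ g fun n => (M n).envelope σ δ) :
    ∃ σhat : ∀ n, (M n).𝒴 → Param s, IsScoreRoot M Θ σ g σhat := by
  set r : ℕ → ℝ := fun n => (M n).dstar ^ (-(1 / 4) : ℝ)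
  have hsmall : ∀ᶠ n in atTop, r n ≤ δ :=
    ((tendsto_rpow_neg_atTop (by norm_num)).comp hdstar).eventually_le_const hδ
  have hselect (n : ℕ) : ∃ τ : (M n).𝒴 → Param s, Measurable τ ∧
      ((M n).Nondegenerate σ δ U m → r n ≤ δ → ∀ y, ∀ θ ∈ (M n).box σ (r n),
        (∀ θ' ∈ (M n).box σ (r n), (M n).l θ' y ≤ (M n).l θ y) →
        (∀ θ' ∈ (M n).box σ (r n), (M n).l θ y ≤ (M n).l θ' y → θ' = θ) → τ y = θ) := by
    by_cases h : (M n).Nondegenerate σ δ U m ∧ r n ≤ δ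
    · obtain ⟨h, hrδ⟩ := h
      have hsub := ((M n).box_mono h.d_pos hrδ).trans h.box_subset
      obtain ⟨τ, hτm, hτ⟩ := exists_measurable_unique_max ((M n).isCompact_box σ (r n))
        ⟨σ, (M n).self_mem_box h.d_pos (Real.rpow_nonneg h.dstar_pos.le _)⟩
        (fun θ hθ => h.regularOn.measurable_l θ (hsub hθ))
        fun y => (h.regularOn.contDiffOn_l y).continuousOn.mono hsub
      exact ⟨τ, hτm, fun _ _ => hτ⟩
    · exact ⟨fun _ => σ, measurable_const, fun h' hrδ => absurd ⟨h', hrδ⟩ h⟩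
  choose σhat hmeas hσhat using hselect
  refine ⟨σhat, hmeas, fun ρ _ _ => ?_⟩
  set τ : ℝ := min (1 / 4) (1 - ρ)
  set ε : ℝ := m / (4 * (s + 1) ^ 2)
  obtain ⟨n₀, hn₀⟩ := hnd.exists
  have hε : 0 < ε := div_pos hn₀.m_pos (by positivity)
  obtain ⟨C, -, hC⟩ := hX.exists_measure_rpow_le hg hε τ
  refine ⟨fun n => {ω | ENNReal.ofReal (ε * (M n).dstar ^ τ) ≤
    (M n).envelope σ δ ((M n).Y ω)}ᶜ, C, ?_⟩
  filter_upwards [hnd, hsmall] with n hnd hrδ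
  refine ⟨fun ω hω => ?_, by simpa only [compl_compl] using hC n hnd.dstar_pos⟩
  have hlt : (M n).envelope σ δ ((M n).Y ω) < ENNReal.ofReal (ε * (M n).dstar ^ τ) :=
    not_le.1 hω
  have hpow := Real.rpow_pos_of_pos hnd.dstar_pos τ
  obtain ⟨θ, hθ, hmax, huniq, ha, hdev⟩ := hnd.exists_unique_maximizer_of_le_rpow
    (dominates_envelope hnd.d_pos hnd.dstar_pos (hlt.trans ENNReal.ofReal_lt_top).ne)
    (min_le_left _ _) hrδ (ENNReal.toReal_le_of_le_ofReal (by positivity) hlt.le)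
  rw [hσhat n hnd hrδ _ θ hθ hmax huniq]
  exact ⟨hUΘ (hnd.box_subset ((M n).box_mono hnd.d_pos hrδ hθ)), ha,
    (vecNorm_le_sum_abs _).trans_lt (hdev.trans_le
      (Real.rpow_le_rpow_of_exponent_le hnd.one_le_dstar (min_le_right _ _)))⟩

end Existence

theorem theorem4p1_general {s : ℕ} {M : ℕ → Experiment.{u, v} s} {Θ U : Set (Param s)}
    {σ σstar : Param s} {η : ℕ → Param s → ℝ} {c₀ κ g δ : ℝ} (hc₀ : 0 < c₀) (hκ : 0 < κ)
    (hδ : 0 < δ) (hUΘ : U ⊆ Θ) (hbox : ∀ n, (M n).box σ δ ⊆ U)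
    (hησstar : ∃ K : ℝ, ∀ n, |η n σstar| ≤ K * (M n).dstar ^ κ)
    (hη : ∀ n, ContDiffOn ℝ 3 (η n) U)
    (hη0 : ∃ K : ℝ, ∀ n, |η n σ| ≤ K)
    (hη1 : ∃ K : ℝ, ∀ n, vecNorm (gradVec (η n) σ) ≤ K)
    (hη2 : ∃ K : ℝ, ∀ n, specNorm (hessMat (η n) σ) ≤ K)
    (hη3 : ∀ i j k, BoundedOnBoxes M σ δ fun n => pderiv i (pderiv j (pderiv k (η n))))
    (hreg : ∀ n, (M n).RegularOn U) (hd : ∀ n i, 0 < (M n).d i)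
    (hdstar : Tendsto (fun n => (M n).dstar) atTop atTop)
    (hlam : limsup (fun n => ((lambdaMax ((M n).Q σ) : ℝ) : EReal)) atTop < 0)
    (hg : 8 + 4 * κ < g) (hmom : DerivMomentsBounded M σ δ g)
    (hexp : ∀ n, ∀ θ ∈ (M n).box σ δ, (M n).ExpectationsExist θ)
    (hQ : VanishesUniformly M σ fun n θ => specNorm ((M n).Q θ - (M n).Q σ))
    (hU1 : VanishesUniformly M σ fun n θ => specNorm ((M n).U1 θ - (M n).U1 σ))
    (hU2 : VanishesUniformly M σ fun n θ => ‖(M n).U2 θ - (M n).U2 σ‖)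
    (hU3 : VanishesUniformly M σ fun n θ => ‖(M n).U3 θ - (M n).U3 σ‖)
    (hEa : ∃ K : ℝ, ∀ n, vecNorm ((M n).Ea σ) ≤ K)
    (hEa' : VanishesUniformly M σ fun n θ => vecNorm ((M n).Ea θ - (M n).Ea σ)) :
    (∃ σhat : ∀ n, (M n).𝒴 → Param s, IsScoreRoot M Θ σ g σhat) ∧
    ∀ σhat : ∀ n, (M n).𝒴 → Param s, IsScoreRoot M Θ σ g σhat →
      (∀ n, Measurable ((M n).etaHat (η n) c₀ κ σstar (σhat n))) →
      (∀ n, (M n).HasExpect σ ((M n).etaHat (η n) c₀ κ σstar (σhat n))) ∧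
      ((fun n => (M n).expect σ ((M n).etaHat (η n) c₀ κ σstar (σhat n)) - η n σ)
        =o[atTop] fun n => (M n).dstar ^ (-2 : ℝ)) ∧
      ∀ (t : ∀ n, Param s → (M n).𝒴 → ℝ) (μ : ∀ n, (M n).Ω → ℝ),
        (∀ n, MemLp (fun ω => t n (σhat n ((M n).Y ω)) ((M n).Y ω) - μ n ω) 2 ((M n).P σ)) →
        ((fun n => (M n).mse σ (fun y => t n (σhat n y) y) (μ n) - η n σ)
          =o[atTop] fun n => (M n).dstar ^ (-2 : ℝ)) →
        ((fun n => (M n).expect σ ((M n).etaHat (η n) c₀ κ σstar (σhat n)) -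
            (M n).mse σ (fun y => t n (σhat n y) y) (μ n))
          =o[atTop] fun n => (M n).dstar ^ (-2 : ℝ)) := by
  have hU : IsOpen U := (hreg 0).isOpen
  have hσ (n : ℕ) : σ ∈ (M n).box σ δ := (M n).self_mem_box (hd n) hδ.le
  have hX := hmom.envelope (by linarith) hreg (hbox 0 (hσ 0)) hbox
  obtain ⟨m, hm, hneg⟩ := eventually_isNegDefBy_Q hd
    (fun n => (hreg n).A_isSymm (hbox n (hσ n))) hlam
  obtain ⟨K, hK⟩ := exists_smoothBound hd hU hδ.le hbox hη hη0 hη1 hη2 hη3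
  have hexpand : ∀ᶠ n in atTop, (M n).Expandable σ δ U m K (η n) := by
    filter_upwards [hneg, hdstar.eventually_ge_atTop 1] with n hneg hd1
    exact ⟨⟨hd n, hd1, hδ.le, hm, hbox n, hreg n, hneg⟩, hη n, hK n⟩
  have htame := (tameMoments hd (hdstar.eventually_gt_atTop 0) hδ hbox hreg (by linarith) hX hm hneg
    hexp hQ hU1 hU2 hU3 hEa hEa').dstar_sq_mul_bias hd (tame_grad hK hd hU hδ hbox hη)
    (tame_hess hK hd hU hδ hbox hη)
  obtain ⟨Kstar, hKstar⟩ := hησstar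
  refine ⟨exists_isScoreRoot hδ (by linarith) hUΘ hdstar (hexpand.mono fun _ h => h.toNondegenerate)
    hX, fun σhat hroot hmeas => ?_⟩
  have hlim := isLittleO_expect_etaHat hc₀ hκ hδ hg hd hdstar hexpand hKstar hX
    (fun n => hexp n σ (hσ n)) htame hroot hmeas
  exact ⟨fun n => hasExpect_etaHat hc₀.le ((M n).dstar_nonneg (hd n)) (hKstar n) (hmeas n) σ, hlim,
    fun t μ _ hmse => (hlim.sub hmse).congr_left fun n => by ring⟩

theorem theorem4p1 {s : ℕ} (M : ℕ → Experiment.{u, v} s)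
    (Θ : Set (Param s)) (σ σstar : Param s) (η : ℕ → Param s → ℝ)
    (c₀ κ g δ : ℝ) (hc₀ : 0 < c₀) (hκ : 0 < κ) (hδ : 0 < δ)
    -- the true parameter is an interior point, and the neighbourhoods `S_δ(σ)` lie in the interior
    (hσ : σ ∈ interior Θ) (hbox : ∀ n, (M n).box σ δ ⊆ interior Θ)
    -- the fixed point used by the truncation
    (hσstar : σstar ∈ Θ)
    (hησstar : ∃ K : ℝ, ∀ n, |η n σstar| ≤ K * (M n).dstar ^ κ)
    -- (i) smoothness and boundedness of `η` and of its derivatives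
    (hη : ∀ n, ContDiffOn ℝ 3 (η n) (interior Θ))
    (hη0 : ∃ K : ℝ, ∀ n, |η n σ| ≤ K)
    (hη1 : ∃ K : ℝ, ∀ n, vecNorm (gradVec (η n) σ) ≤ K)
    (hη2 : ∃ K : ℝ, ∀ n, specNorm (hessMat (η n) σ) ≤ K)
    (hη3 : ∀ i j k, ∃ K : ℝ, ∀ n, ∀ θ ∈ (M n).box σ δ,
      |pderiv i (pderiv j (pderiv k (η n))) θ| ≤ K)
    -- (ii) the criterion function, the normalizing constants and the moments of the derivatives
    (hlmeas : ∀ n, ∀ θ ∈ interior Θ, Measurable ((M n).l θ))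
    (hl : ∀ n y, ContDiffOn ℝ 4 (fun θ => (M n).l θ y) (interior Θ))
    (hd : ∀ n i, 0 < (M n).d i)
    (hdstar : Tendsto (fun n => (M n).dstar) atTop atTop)
    (hlam_bot : ⊥ < limsup (fun n => ((lambdaMax ((M n).Q σ) : ℝ) : EReal)) atTop)
    (hlam_neg : limsup (fun n => ((lambdaMax ((M n).Q σ) : ℝ) : EReal)) atTop < 0)
    (hg : 8 + 4 * κ < g)
    (hm1 : ∀ i, MomentsBounded M σ g fun n y =>
      ENNReal.ofReal (|(M n).a σ y i| / (M n).d i))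
    (hm2 : ∀ i j, MomentsBounded M σ g fun n y =>
      ENNReal.ofReal (|(M n).F σ y i j - (M n).expect σ fun y' => (M n).F σ y' i j|
        / √((M n).d i * (M n).d j)))
    (hm3 : ∀ i j k, MomentsBounded M σ g fun n y =>
      ENNReal.ofReal ((M n).dstar / ((M n).d i * (M n).d j * (M n).d k)) *
        (M n).supBox σ δ fun θ => (M n).l3 i j k θ y)
    -- (iii) moments of the third and fourth derivatives
    (hm4 : ∀ i j k, MomentsBounded M σ g fun n y =>
      ENNReal.ofReal (|(M n).l3 i j k σ y - (M n).expect σ fun y' => (M n).l3 i j k σ y'|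
        / √((M n).d j * (M n).d k)))
    (hm5 : ∀ i j k, MomentsBounded M σ g fun n y =>
      ENNReal.ofReal (|(M n).l3 i j k σ y| / ((M n).d j * (M n).d k)))
    (hm6 : ∀ i j k m, MomentsBounded M σ g fun n y =>
      ENNReal.ofReal ((M n).dstar ^ 2 / ((M n).d i * (M n).d j * (M n).d k * (M n).d m)) *
        (M n).supBox σ δ fun θ => (M n).l4 i j k m θ y)
    -- the expectations used in (iv), (v) and in the correction terms exist near `σ`
    (hexp : ∀ n, ∀ θ ∈ (M n).box σ δ, (M n).ExpectationsExist θ)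
    -- (iv) continuity of `Q`, `U₁`, `U₂`, `U₃` at `σ`, uniformly in `n`
    (hQ : VanishesUniformly M σ fun n θ => specNorm ((M n).Q θ - (M n).Q σ))
    (hU1 : VanishesUniformly M σ fun n θ => specNorm ((M n).U1 θ - (M n).U1 σ))
    (hU2 : VanishesUniformly M σ fun n θ => ‖(M n).U2 θ - (M n).U2 σ‖)
    (hU3 : VanishesUniformly M σ fun n θ => ‖(M n).U3 θ - (M n).U3 σ‖)
    -- (v) `E(a)` is bounded and continuous at `σ`, uniformly in `n`
    (hEa : ∃ K : ℝ, ∀ n, vecNorm ((M n).Ea σ) ≤ K)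
    (hEa' : VanishesUniformly M σ fun n θ => vecNorm ((M n).Ea θ - (M n).Ea σ)) :
    -- a consistent solution of the score equation exists
    (∃ σhat : ∀ n, (M n).𝒴 → Param s, IsScoreRoot M Θ σ g σhat) ∧
    -- and for each such solution the truncated estimator has the asserted expectation
    ∀ σhat : ∀ n, (M n).𝒴 → Param s, IsScoreRoot M Θ σ g σhat →
      (∀ n, Measurable ((M n).etaHat (η n) c₀ κ σstar (σhat n))) →
      (∀ n, (M n).HasExpect σ ((M n).etaHat (η n) c₀ κ σstar (σhat n))) ∧
      ((fun n => (M n).expect σ ((M n).etaHat (η n) c₀ κ σstar (σhat n)) - η n σ)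
        =o[atTop] fun n => (M n).dstar ^ (-2 : ℝ)) ∧
      -- hence its bias for the mean squared error of an empirical predictor `t(σhat)` of `μ` that
      -- `η(σ)` approximates to second order is of smaller order than `d_*^{-2}`
      ∀ (t : ∀ n, Param s → (M n).𝒴 → ℝ) (μ : ∀ n, (M n).Ω → ℝ),
        (∀ n, MemLp (fun ω => t n (σhat n ((M n).Y ω)) ((M n).Y ω) - μ n ω) 2 ((M n).P σ)) →
        ((fun n => (M n).mse σ (fun y => t n (σhat n y) y) (μ n) - η n σ)
          =o[atTop] fun n => (M n).dstar ^ (-2 : ℝ)) →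
        ((fun n => (M n).expect σ ((M n).etaHat (η n) c₀ κ σstar (σhat n)) -
            (M n).mse σ (fun y => t n (σhat n y) y) (μ n))
          =o[atTop] fun n => (M n).dstar ^ (-2 : ℝ)) := by
  exact theorem4p1_general hc₀ hκ hδ interior_subset hbox hησstar hη hη0 hη1 hη2 hη3
    (fun n => ⟨isOpen_interior, hlmeas n, hl n⟩) hd hdstar hlam_neg hg ⟨hm1, hm2, hm3, hm5, hm6⟩
    hexp hQ hU1 hU2 hU3 hEa hEa'
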